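/- Let $k$ be a field; tensor products are over $k$. A rigid braided vector space $(M,c)$ is a finite-dimensional $k$-vector space $M$ with an automorphism $c$ of $M\otimes M$ such that $(\mathrm{id}\otimes c)(c\otimes \mathrm{id})(\mathrm{id}\otimes c)=(c\otimes \mathrm{id})(\mathrm{id}\otimes c)(c\otimes \mathrm{id})$ and such that the map $c^\flat: M^*\otimes M\to M\otimes M^*$, $c^\flat(\varphi\otimes m)=\sum_i(\varphi\otimes\mathrm{id})\bigl(c(m\otimes m_i)\bigr)\otimes m^i$ ($m_i$ a basis of $M$ with dual basis $m^i$) is an isomorphism. A left-left Yetter-Drinfeld module over a bialgebra $H$ is a left module and left comodule $M$ with $(h_{(1)}m)_{(-1)}h_{(2)}\otimes(h_{(1)}m)_{(0)}=h_{(1)}m_{(-1)}\otimes h_{(2)}m_{(0)}$; its induced braiding is $m\otimes n\mapsto m_{(-1)}n\otimes m_{(0)}$. A coquasitriangular Hopf algebra is a Hopf algebra $H$ with a convolution invertible form $r\in(H\otimes H)^*$ such that $\nabla^{op}=r\star\nabla\star r^{-1}$, $r\circ(\nabla\otimes\mathrm{id})=r_{13}\star r_{23}$ and $r\circ(\mathrm{id}\otimes\nabla)=r_{13}\star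 r_{12}$. On a left $H$-comodule $M$ it induces the braiding $m\otimes n\mapsto r(n_{(-1)}\otimes m_{(-1)})\,n_{(0)}\otimes m_{(0)}$ and the action $h\cdot m=r(m_{(-1)}\otimes h)m_{(0)}$. Its right radical is $J_H=\{h\in H\mid r(H\otimes h)=0\}$, and $H^{red}=H/J_H$. A coalgebra is pointed if all its simple subcoalgebras are one-dimensional. Let $(M,c)$ be a rigid braided vector space. The FRT Hopf algebra $H(c)$ exists: it is a coquasitriangular Hopf algebra with a left coaction on $M$ whose induced braiding is $c$, such that for every Hopf algebra $B$ having $M$ as a Yetter-Drinfeld module with induced braiding $c$ there is a unique morphism of Hopf algebras $H(c)\to B$ compatible with the coactions and the actions on $M$. Put $H^{red}(c)=H(c)^{red}=H(c)/J_{H(c)}$, which coacts on $M$ through $H(c)\to H^{red}(c)$. For every such $H(c)$ (it is unique up to isomorphism) the following are equivalent: 1. $H^{red}(c)$ is pointed. 2. There is a pointed Hopf algebra $H$ having $M$ as a Yetter-Drinfeld module such that the induced braiding is $c$. 3. There is a flag $0=M_0\subset M_1\subset\dots\subset M_r=M$ of left $H^{red}(c)$-subcomodules with $\dim M_i=i$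 for all $i$. 4. There is a flag $0=M_0\subset M_1\subset\dots\subset M_r=M$ of subspaces with $\dim M_i=i$ and $c(M_i\otimes M)\subset M\otimes M_i$ for all $i$. -/

import Mathlib

universe u v w

open scoped TensorProduct
open TensorProduct Coalgebra

noncomputable section

namespace FRT

/-! ### Braided vector spaces and rigidity -/

section Braided

variable (k : Type u) [Field k] (M : Type v) [AddCommGroup M] [Module k M]

variable {k M} in
/-- The braid equation
`(id ⊗ c)(c ⊗ id)(id ⊗ c) = (c ⊗ id)(id ⊗ c)(c ⊗ id)` on `M ⊗ (M ⊗ M)`. -/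
def IsBraiding (c : M ⊗[k] M ≃ₗ[k] M ⊗[k] M) : Prop :=
  let c₂₃ : M ⊗[k] (M ⊗[k] M) →ₗ[k] M ⊗[k] (M ⊗[k] M) := (c : M ⊗[k] M →ₗ[k] M ⊗[k] M).lTensor M
  let c₁₂ : M ⊗[k] (M ⊗[k] M) →ₗ[k] M ⊗[k] (M ⊗[k] M) :=
    (TensorProduct.assoc k M M M).toLinearMap ∘ₗ
      (c : M ⊗[k] M →ₗ[k] M ⊗[k] M).rTensor M ∘ₗ
      (TensorProduct.assoc k M M M).symm.toLinearMap
  c₂₃ ∘ₗ c₁₂ ∘ₗ c₂₃ = c₁₂ ∘ₗ c₂₃ ∘ₗ c₁₂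

variable {k M} in
/-- The map `c♭ = (ev ⊗ id ⊗ id)(id ⊗ c ⊗ id)(id ⊗ id ⊗ db) : M* ⊗ M → M ⊗ M*`, that is
`φ ⊗ m ↦ ∑ᵢ (φ ⊗ id)(c (m ⊗ mᵢ)) ⊗ mⁱ` for a basis `mᵢ` with dual basis `mⁱ`. -/
def flat [FiniteDimensional k M] (c : M ⊗[k] M ≃ₗ[k] M ⊗[k] M) :
    Module.Dual k M ⊗[k] M →ₗ[k] M ⊗[k] Module.Dual k M :=
  (TensorProduct.lid k (M ⊗[k] Module.Dual k M)).toLinearMap ∘ₗ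
    (contractLeft k M).rTensor (M ⊗[k] Module.Dual k M) ∘ₗ
    (tensorTensorTensorAssoc k (Module.Dual k M) M M (Module.Dual k M)).symm.toLinearMap ∘ₗ
    ((c : M ⊗[k] M →ₗ[k] M ⊗[k] M).lTensor (Module.Dual k M)).rTensor (Module.Dual k M) ∘ₗ
    (tensorTensorTensorAssoc k (Module.Dual k M) M M (Module.Dual k M)).toLinearMap ∘ₗ
    (coevaluation k M).lTensor (Module.Dual k M ⊗[k] M) ∘ₗ
    (TensorProduct.rid k (Module.Dual k M ⊗[k] M)).symm.toLinearMap

variable {k M} in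
/-- A finite dimensional braided vector space `(M, c)` that is rigid: `c` is an automorphism of
`M ⊗ M` which satisfies the braid equation, and `c♭` is an isomorphism. -/
structure IsRigidBraiding [FiniteDimensional k M] (c : M ⊗[k] M ≃ₗ[k] M ⊗[k] M) : Prop where
  braid : IsBraiding c
  rigid : Function.Bijective (flat c)

variable {k M} in
/-- A complete flag `0 = M₀ ⊂ M₁ ⊂ ⋯ ⊂ M_r = M` of subspaces with `dim Mᵢ = i`. -/
structure IsCompleteFlag {r : ℕ} (F : Fin (r + 1) → Submodule k M) : Prop where
  zero : F 0 = ⊥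
  last : F (Fin.last r) = ⊤
  mono : Monotone F
  finrank_eq : ∀ i, Module.finrank k (F i) = (i : ℕ)

end Braided

/-! ### Pointed coalgebras -/

section Pointed

variable {k : Type u} [Field k] {C : Type w} [AddCommGroup C] [Module k C] [Coalgebra k C]

/-- A subspace `D` with `Δ(D) ⊆ D ⊗ D`. -/
def IsSubcoalgebra (D : Submodule k C) : Prop :=
  ∀ x ∈ D, comul (R := k) x ∈ LinearMap.range (TensorProduct.map D.subtype D.subtype)

/-- A nonzero subcoalgebra without subcoalgebras other than `0` and itself. -/
structure IsSimpleSubcoalgebra (D : Submodule k C) : Prop where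
  isSubcoalgebra : IsSubcoalgebra D
  ne_bot : D ≠ ⊥
  eq_bot_or_eq : ∀ E : Submodule k C, IsSubcoalgebra E → E ≤ D → E = ⊥ ∨ E = D

variable (k C) in
/-- A coalgebra is pointed if all its simple subcoalgebras are one-dimensional. -/
def IsPointed : Prop :=
  ∀ D : Submodule k C, IsSimpleSubcoalgebra D → Module.finrank k D = 1

end Pointed

/-! ### Comodules and Yetter-Drinfeld modules -/

section Comodules

variable (k : Type u) [Field k]

/-- A left comodule structure `δ : M → H ⊗ M`, `m ↦ m₍₋₁₎ ⊗ m₍₀₎`, over a coalgebra `H`. -/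
structure LeftComodule (H : Type w) [AddCommGroup H] [Module k H] [Coalgebra k H]
    (M : Type v) [AddCommGroup M] [Module k M] where
  coact : M →ₗ[k] H ⊗[k] M
  coassoc : (TensorProduct.assoc k H H M).toLinearMap ∘ₗ
    (comul (R := k) (A := H)).rTensor M ∘ₗ coact = coact.lTensor H ∘ₗ coact
  counit_coact : (TensorProduct.lid k M).toLinearMap ∘ₗ
    (counit (R := k) (A := H)).rTensor M ∘ₗ coact = LinearMap.id

variable {k} in
/-- A subspace `N` with `δ(N) ⊆ H ⊗ N`. -/
def IsSubcomodule {H : Type w} [AddCommGroup H] [Module k H]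
    {M : Type v} [AddCommGroup M] [Module k M] (δ : M →ₗ[k] H ⊗[k] M) (N : Submodule k M) : Prop :=
  ∀ m ∈ N, δ m ∈ LinearMap.range (N.subtype.lTensor H)

variable (H : Type w) [Ring H] [Bialgebra k H] (M : Type v) [AddCommGroup M] [Module k M]

/-- A (left-left) Yetter-Drinfeld module structure on `M` over a bialgebra `H`: a left module
structure and a left comodule structure with
`(h₍₁₎ m)₍₋₁₎ h₍₂₎ ⊗ (h₍₁₎ m)₍₀₎ = h₍₁₎ m₍₋₁₎ ⊗ h₍₂₎ m₍₀₎`. -/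
structure YetterDrinfeld extends LeftComodule k H M where
  act : H →ₐ[k] Module.End k M
  compat :
    (LinearMap.mul' k H).rTensor M ∘ₗ
        (TensorProduct.rightComm k H M H).toLinearMap ∘ₗ
        (coact ∘ₗ TensorProduct.lift act.toLinearMap).rTensor H ∘ₗ
        (TensorProduct.rightComm k H H M).toLinearMap ∘ₗ
        (comul (R := k) (A := H)).rTensor M =
      TensorProduct.map (LinearMap.mul' k H) (TensorProduct.lift act.toLinearMap) ∘ₗ
        (TensorProduct.tensorTensorTensorComm k H H H M).toLinearMap ∘ₗ
        TensorProduct.map (comul (R := k) (A := H)) coact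

variable {k H M} in
/-- The induced braiding `m ⊗ n ↦ m₍₋₁₎ n ⊗ m₍₀₎`. -/
def YetterDrinfeld.braiding (V : YetterDrinfeld k H M) : M ⊗[k] M →ₗ[k] M ⊗[k] M :=
  (TensorProduct.lift V.act.toLinearMap).rTensor M ∘ₗ
    (TensorProduct.rightComm k H M M).toLinearMap ∘ₗ
    V.coact.rTensor M

end Comodules

/-! ### Coquasitriangular bialgebras and the right radical -/

section Coquasitriangular

open LinearMap WithConv

variable {k : Type u} [Field k] {H : Type w} [Ring H] [Bialgebra k H]

/-- `r₁₂ (g ⊗ h ⊗ l) = r (g ⊗ h) ε(l)`. -/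
def r₁₂ (r : H ⊗[k] H →ₗ[k] k) : H ⊗[k] (H ⊗[k] H) →ₗ[k] k :=
  mul' k k ∘ₗ TensorProduct.map r (counit (R := k) (A := H)) ∘ₗ
    (TensorProduct.assoc k H H H).symm.toLinearMap

/-- `r₂₃ (g ⊗ h ⊗ l) = ε(g) r (h ⊗ l)`. -/
def r₂₃ (r : H ⊗[k] H →ₗ[k] k) : H ⊗[k] (H ⊗[k] H) →ₗ[k] k :=
  mul' k k ∘ₗ TensorProduct.map (counit (R := k) (A := H)) r

/-- `r₁₃ (g ⊗ h ⊗ l) = ε(h) r (g ⊗ l)`. -/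
def r₁₃ (r : H ⊗[k] H →ₗ[k] k) : H ⊗[k] (H ⊗[k] H) →ₗ[k] k :=
  mul' k k ∘ₗ TensorProduct.map (counit (R := k) (A := H)) r ∘ₗ
    (TensorProduct.leftComm k H H H).toLinearMap

/-- `r` is a coquasitriangular structure on the bialgebra `H`: `r` has a convolution inverse `s`
with `∇ᵒᵖ = r ⋆ ∇ ⋆ s`, and `r (∇ ⊗ id) = r₁₃ ⋆ r₂₃`, `r (id ⊗ ∇) = r₁₃ ⋆ r₁₂`.
The products are convolution products; in the first equation the scalar valued forms are composed
with the unit `k → H`. -/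
structure IsCoquasitriangular (r : H ⊗[k] H →ₗ[k] k) : Prop where
  exists_inv : ∃ s : H ⊗[k] H →ₗ[k] k,
    toConv r * toConv s = 1 ∧ toConv s * toConv r = 1 ∧
    toConv (mul' k H ∘ₗ (TensorProduct.comm k H H).toLinearMap) =
      toConv (Algebra.linearMap k H ∘ₗ r) * toConv (mul' k H) *
        toConv (Algebra.linearMap k H ∘ₗ s)
  mul_left : toConv (r ∘ₗ (mul' k H).rTensor H ∘ₗ (TensorProduct.assoc k H H H).symm.toLinearMap) =
    toConv (r₁₃ r) * toConv (r₂₃ r)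
  mul_right : toConv (r ∘ₗ (mul' k H).lTensor H) = toConv (r₁₃ r) * toConv (r₁₂ r)

lemma IsCoquasitriangular.apply_mul_left {r : H ⊗[k] H →ₗ[k] k} (hr : IsCoquasitriangular r)
    (a b c : H) :
    r ((a * b) ⊗ₜ c) = ∑ i ∈ (ℛ k c).index,
      r (a ⊗ₜ (ℛ k c).left i) * r (b ⊗ₜ (ℛ k c).right i) := by
  have h := congr(($hr.mul_left).ofConv (a ⊗ₜ (b ⊗ₜ c)))
  have ha := (ℛ k a).eq
  have hb := (ℛ k b).eq
  have hc := (ℛ k c).eq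
  have ha' := congr(TensorProduct.rid k H ($(sum_tmul_counit_eq (ℛ k a))))
  have hb' := sum_counit_smul (ℛ k b)
  simp only [map_sum, TensorProduct.rid_tmul, one_smul] at ha'
  have e1 : ∀ l, r (a ⊗ₜ (ℛ k c).left l) = ∑ i ∈ (ℛ k a).index,
      counit (R := k) ((ℛ k a).right i) * r ((ℛ k a).left i ⊗ₜ (ℛ k c).left l) := fun l => by
    conv_lhs => rw [← ha']
    simp [TensorProduct.sum_tmul, ← TensorProduct.smul_tmul']
  have e2 : ∀ l, r (b ⊗ₜ (ℛ k c).right l) = ∑ i ∈ (ℛ k b).index,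
      counit (R := k) ((ℛ k b).left i) * r ((ℛ k b).right i ⊗ₜ (ℛ k c).right l) := fun l => by
    conv_lhs => rw [← hb']
    simp [TensorProduct.sum_tmul, ← TensorProduct.smul_tmul']
  simp only [e1, e2]
  simp [r₁₃, r₂₃, LinearMap.convMul_def, ← ha, ← hb, ← hc, TensorProduct.sum_tmul,
    TensorProduct.tmul_sum] at h
  rw [h]
  simp only [Finset.sum_mul, Finset.mul_sum]
  refine Finset.sum_congr rfl fun _ _ => Finset.sum_congr rfl fun _ _ =>
    Finset.sum_congr rfl fun _ _ => ?_
  ring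

lemma IsCoquasitriangular.apply_mul_right {r : H ⊗[k] H →ₗ[k] k} (hr : IsCoquasitriangular r)
    (a b c : H) :
    r (a ⊗ₜ (b * c)) = ∑ i ∈ (ℛ k a).index,
      r ((ℛ k a).left i ⊗ₜ c) * r ((ℛ k a).right i ⊗ₜ b) := by
  have h := congr(($hr.mul_right).ofConv (a ⊗ₜ (b ⊗ₜ c)))
  have ha := (ℛ k a).eq
  have hb := (ℛ k b).eq
  have hc := (ℛ k c).eq
  have hc' := congr(TensorProduct.rid k H ($(sum_tmul_counit_eq (ℛ k c))))
  have hb' := sum_counit_smul (ℛ k b)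
  simp only [map_sum, TensorProduct.rid_tmul, one_smul] at hc'
  have e1 : ∀ l, r ((ℛ k a).left l ⊗ₜ c) = ∑ i ∈ (ℛ k c).index,
      counit (R := k) ((ℛ k c).right i) * r ((ℛ k a).left l ⊗ₜ (ℛ k c).left i) := fun l => by
    conv_lhs => rw [← hc']
    simp [TensorProduct.tmul_sum]
  have e2 : ∀ l, r ((ℛ k a).right l ⊗ₜ b) = ∑ i ∈ (ℛ k b).index,
      counit (R := k) ((ℛ k b).left i) * r ((ℛ k a).right l ⊗ₜ (ℛ k b).right i) := fun l => by
    conv_lhs => rw [← hb']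
    simp [TensorProduct.tmul_sum]
  simp only [e1, e2]
  simp [r₁₃, r₁₂, LinearMap.convMul_def, ← ha, ← hb, ← hc, TensorProduct.sum_tmul,
    TensorProduct.tmul_sum] at h
  rw [h]
  simp only [Finset.sum_mul, Finset.mul_sum]
  rw [Finset.sum_comm]
  simp only [Finset.sum_comm (s := (ℛ k c).index)]
  rw [Finset.sum_comm]
  refine Finset.sum_congr rfl fun _ _ => Finset.sum_congr rfl fun _ _ =>
    Finset.sum_congr rfl fun _ _ => ?_
  ring

lemma IsCoquasitriangular.apply_one_left {r : H ⊗[k] H →ₗ[k] k} (hr : IsCoquasitriangular r)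
    (c : H) : r (1 ⊗ₜ c) = counit (R := k) c := by
  obtain ⟨s, h1, h2, -⟩ := hr.exists_inv
  let ι : H →ₗc[k] H ⊗[k] H :=
    { toLinearMap := TensorProduct.mk k H H 1
      counit_comp := by ext; simp
      map_comp_comul := by
        ext x
        have hx := (ℛ k x).eq
        simp [← hx, TensorProduct.tmul_sum, Algebra.TensorProduct.one_def] }
  let e : WithConv (H →ₗ[k] k) := toConv (r ∘ₗ ι.toLinearMap)
  let f : WithConv (H →ₗ[k] k) := toConv (s ∘ₗ ι.toLinearMap)
  have hef : e * f = 1 := by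
    have := convMul_comp_coalgHom_distrib (toConv r) (toConv s) ι
    rw [h1] at this
    apply ofConv_injective
    rw [← this]
    ext x; simp [ι]
  have hee : e * e = e := by
    ext x
    have hx := (ℛ k x).eq
    have := hr.apply_mul_left 1 1 x
    rw [one_mul] at this
    simp [e, ι, ← hx, this]
  have he : e = 1 := by
    calc e = e * (e * f) := by rw [hef, mul_one]
      _ = 1 := by rw [← mul_assoc, hee, hef]
  exact congr(($he).ofConv c)

/-- The right radical `J = {h | r (H ⊗ h) = 0}`, as an ideal. -/
def rightRadical {r : H ⊗[k] H →ₗ[k] k} (hr : IsCoquasitriangular r) : Ideal H where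
  carrier := {h | ∀ x : H, r (x ⊗ₜ h) = 0}
  add_mem' ha hb x := by rw [tmul_add, map_add, ha x, hb x, add_zero]
  zero_mem' x := by simp
  smul_mem' b c hc x := by
    rw [smul_eq_mul, hr.apply_mul_right]
    exact Finset.sum_eq_zero fun i _ => by rw [hc, zero_mul]

instance {r : H ⊗[k] H →ₗ[k] k} (hr : IsCoquasitriangular r) : (rightRadical hr).IsTwoSided where
  mul_mem_of_left {a} b ha x := by
    rw [hr.apply_mul_right]
    exact Finset.sum_eq_zero fun i _ => by rw [ha, mul_zero]

/-- The form `r (x ⊗ ·)` on the quotient by the right radical. -/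
def radicalForm {r : H ⊗[k] H →ₗ[k] k} (hr : IsCoquasitriangular r) (x : H) :
    H ⧸ (rightRadical hr).restrictScalars k →ₗ[k] k :=
  Submodule.liftQ _ (r ∘ₗ TensorProduct.mk k H H x) fun _ hh => hh x

lemma eq_zero_of_radicalForm {r : H ⊗[k] H →ₗ[k] k} (hr : IsCoquasitriangular r)
    (v : H ⧸ (rightRadical hr).restrictScalars k) (hv : ∀ x, radicalForm hr x v = 0) : v = 0 := by
  induction v using Submodule.Quotient.induction_on with
  | H h => exact (Submodule.Quotient.mk_eq_zero _).2 hv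

lemma eq_zero_of_radicalForm_tmul {r : H ⊗[k] H →ₗ[k] k} (hr : IsCoquasitriangular r)
    (z : (H ⧸ (rightRadical hr).restrictScalars k) ⊗[k] (H ⧸ (rightRadical hr).restrictScalars k))
    (hz : ∀ x y, mul' k k (TensorProduct.map (radicalForm hr x) (radicalForm hr y) z) = 0) :
    z = 0 := by
  classical
  let b := Module.Basis.ofVectorSpace k (H ⧸ (rightRadical hr).restrictScalars k)
  apply (TensorProduct.equivFinsuppOfBasisRight b).injective
  rw [map_zero]
  ext i : 1
  apply eq_zero_of_radicalForm hr
  intro x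
  have h1 : TensorProduct.lid k _ ((radicalForm hr x).rTensor _ z) = 0 := by
    apply eq_zero_of_radicalForm hr
    intro y
    have key : radicalForm hr y ∘ₗ (TensorProduct.lid k _).toLinearMap ∘ₗ
        (radicalForm hr x).rTensor _ =
          mul' k k ∘ₗ TensorProduct.map (radicalForm hr x) (radicalForm hr y) :=
      TensorProduct.ext' fun u v => by simp
    exact congr($key z).trans (hz x y)
  have h2 := congr(b.coord i $h1)
  rw [map_zero] at h2
  rw [← h2, TensorProduct.equivFinsuppOfBasisRight_apply]
  have key : radicalForm hr x ∘ₗ (TensorProduct.rid k _).toLinearMap ∘ₗ (b.coord i).lTensor _ =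
      b.coord i ∘ₗ (TensorProduct.lid k _).toLinearMap ∘ₗ (radicalForm hr x).rTensor _ :=
    TensorProduct.ext' fun u v => by simp [mul_comm]
  exact congr($key z)

instance {r : H ⊗[k] H →ₗ[k] k} (hr : IsCoquasitriangular r) :
    ((rightRadical hr).restrictScalars k).IsCoideal where
  counit_eq_zero h hh := by rw [← hr.apply_one_left]; exact hh 1
  map_mkQ_comul_eq_zero h hh := by
    apply eq_zero_of_radicalForm_tmul hr
    intro x y
    have e := hr.apply_mul_left x y h
    rw [hh] at e
    rw [e, ← (ℛ k h).eq]
    simp only [map_sum, TensorProduct.map_tmul, mul'_apply]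
    rfl

variable {M : Type v} [AddCommGroup M] [Module k M]

/-- The braiding `m ⊗ n ↦ r (n₍₋₁₎ ⊗ m₍₋₁₎) n₍₀₎ ⊗ m₍₀₎` on a left comodule `M`. -/
def cqtBraiding (r : H ⊗[k] H →ₗ[k] k) (δ : M →ₗ[k] H ⊗[k] M) : M ⊗[k] M →ₗ[k] M ⊗[k] M :=
  (TensorProduct.lid k (M ⊗[k] M)).toLinearMap ∘ₗ
    TensorProduct.map (r ∘ₗ (TensorProduct.comm k H H).toLinearMap)
      (TensorProduct.comm k M M).toLinearMap ∘ₗ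
    (TensorProduct.tensorTensorTensorComm k H M H M).toLinearMap ∘ₗ
    TensorProduct.map δ δ

/-- The action `h ⊗ m ↦ r (m₍₋₁₎ ⊗ h) m₍₀₎` on a left comodule `M`. -/
def cqtAction (r : H ⊗[k] H →ₗ[k] k) (δ : M →ₗ[k] H ⊗[k] M) : H ⊗[k] M →ₗ[k] M :=
  (TensorProduct.lid k M).toLinearMap ∘ₗ
    r.rTensor M ∘ₗ
    (TensorProduct.assoc k H H M).symm.toLinearMap ∘ₗ
    (TensorProduct.leftComm k H H M).toLinearMap ∘ₗ
    δ.lTensor H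

end Coquasitriangular

/-! ### The FRT Hopf algebra and its reduced version -/

section FRTHopfAlgebra

variable (k : Type u) [Field k] (M : Type v) [AddCommGroup M] [Module k M]
  (c : M ⊗[k] M ≃ₗ[k] M ⊗[k] M)

/-- The FRT Hopf algebra `H(c)` of `(M, c)`, given by its universal property: a coquasitriangular
Hopf algebra with a left coaction on `M` whose coquasitriangular structure induces the braiding
`c`, such that for every Hopf algebra `B` with a Yetter-Drinfeld structure on `M` inducing `c`
there is a unique morphism `H(c) → B` of Hopf algebras (that is, of bialgebras) compatible with
the coactions and the actions on `M`, where `h ∈ H(c)` acts by `h m = r (m₍₋₁₎ ⊗ h) m₍₀₎`. -/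
structure FRTHopfAlgebra where
  carrier : Type (max u v w)
  [ring : Ring carrier]
  [hopf : HopfAlgebra k carrier]
  comodule : LeftComodule k carrier M
  r : carrier ⊗[k] carrier →ₗ[k] k
  cqt : IsCoquasitriangular r
  braiding_eq : cqtBraiding r comodule.coact = c
  universal : ∀ (B : Type (max u v w)) [Ring B] [HopfAlgebra k B] (V : YetterDrinfeld k B M),
    V.braiding = c → ∃! ψ : carrier →ₐc[k] B,
      (ψ : carrier →ₗ[k] B).rTensor M ∘ₗ comodule.coact = V.coact ∧
      ∀ (h : carrier) (m : M), cqtAction r comodule.coact (h ⊗ₜ m) = V.act (ψ h) m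

attribute [instance] FRTHopfAlgebra.ring FRTHopfAlgebra.hopf

namespace FRTHopfAlgebra

variable {k M c}

/-- The reduced FRT Hopf algebra `H^red(c) = H(c) / J`, the quotient by the right radical. It carries
the quotient bialgebra structure; its antipode (unique if it exists) plays no role in pointedness or
for subcomodules. -/
abbrev Reduced (A : FRTHopfAlgebra.{u, v, w} k M c) : Type (max u v w) :=
  A.carrier ⧸ rightRadical A.cqt

/-- The left coaction of `H^red(c)` on `M`, induced by the coaction of `H(c)`. -/
def reducedCoact (A : FRTHopfAlgebra.{u, v, w} k M c) : M →ₗ[k] A.Reduced ⊗[k] M :=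
  (Ideal.Quotient.mkₐ k (rightRadical A.cqt)).toLinearMap.rTensor M ∘ₗ A.comodule.coact

end FRTHopfAlgebra

end FRTHopfAlgebra

end FRT

end

/-! Conditions 3 and 4 are two forms of one stability condition. The forms r(x ⊗ ·) separate the
points of H^red(c), so a subspace F of M is an H^red(c)-subcomodule exactly when all operators m ↦
r(x ⊗ m₍₋₁₎) m₍₀₎ preserve it (`isSubcomodule_reducedCoact_iff`). The condition c(F ⊗ M) ⊆ M ⊗ F
says the same with x restricted to the matrix coefficients of M (`braiding_mem_iff`). These
coefficients and their antipodes generate H(c). The operators of the antipodes make up the inverse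
of an operator on a finite power of M, and in finite dimension an inverse preserves the same
subspaces (`stable_of_stable_X`).

A flag of subcomodules makes the coefficient matrix triangular over H^red(c), and its antipode as
well, because the radical is stable under the antipode. The entries of such a matrix span a left
coideal filtered with grouplike subquotients. These coideals are closed under sums and products,
hence exhaust the algebra, and a coalgebra exhausted by them is pointed
(`isPointed_of_isTriangular`). Conversely, a nonzero finite-dimensional comodule over a pointed
coalgebra contains a line that is a subcomodule (`LeftComodule.exists_coact_eq`), and passing to
quotients yields a flag. Over H^red(c) this gives 1 ⇒ 3. Over an arbitrary pointed H it gives 2 ⇒ 4,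
since the braiding m ⊗ n ↦ m₍₋₁₎n ⊗ m₍₀₎ carries F ⊗ M into M ⊗ F. For 4 ⇒ 2 the reduced Hopf
algebra itself is a witness.

Existence of H(c) is by construction. Take the algebra generated by the entries of an invertible
matrix X, with inverse Y, subject to R X₁ X₂ = X₂ X₁ R, where R is c composed with the flip.
Rigidity provides a skew inverse N of R. A matrix W formed from N is invertible, and over the
opposite algebra W Y W⁻¹ is the inverse of X (`op_X_mul`, `mul_op_X`); so the antipode exists and is
bijective. The form r is an algebra map into the convolution dual, and its commutation identities
spread from the generators by `intertwine`. Any other Hopf algebra with the universal property is a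
quotient of this one with the same form (`ofFRT_surjective`, `apply_ofFRT`), so facts about
generators carry over. -/

noncomputable section

namespace FRT

/-! ### Matrix solutions of the Yang-Baxter equation -/

/-- A solution `R` of the Yang-Baxter equation in matrix form, with an inverse `Ri` and with an
inverse `N` of its partial transpose. -/
structure RMatrix (k : Type*) [Field k] (ι : Type*) [Fintype ι] [DecidableEq ι] where
  R : ι → ι → ι → ι → k
  Ri : ι → ι → ι → ι → k
  N : ι → ι → ι → ι → k
  mul_inv : ∀ i l m n, ∑ a, ∑ b, R i l a b * Ri a b m n = if i = m ∧ l = n then 1 else 0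
  inv_mul : ∀ i l m n, ∑ a, ∑ b, Ri i l a b * R a b m n = if i = m ∧ l = n then 1 else 0
  mul_skew : ∀ s l s' l', ∑ a, ∑ b, R s b a l * N a l' s' b = if s = s' ∧ l = l' then 1 else 0
  skew_mul : ∀ s i s' i', ∑ a, ∑ b, N s b a i * R a i' s' b = if s = s' ∧ i = i' then 1 else 0
  ybe : ∀ i l m j l' n, ∑ a, ∑ b, ∑ p, R i l a b * R a m j p * R b p l' n =
    ∑ a, ∑ b, ∑ p, R l m b p * R i p a n * R a b j l'

variable {k : Type*} [Field k] {ι : Type*} [Fintype ι] [DecidableEq ι]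
  {A : Type*} [Ring A] [Algebra k A] {B : Type*} [Ring B] [Algebra k B]

namespace RMatrix

/-- The transposed solution. -/
@[simps R Ri N]
def transpose (r : RMatrix k ι) : RMatrix k ι where
  R i l a b := r.R a b i l
  Ri i l a b := r.Ri a b i l
  N i l a b := r.N a b i l
  mul_inv i l m n := by
    simp only [mul_comm (r.R _ _ _ _), r.inv_mul, @eq_comm _ i, @eq_comm _ l]
  inv_mul i l m n := by
    simp only [mul_comm (r.Ri _ _ _ _), r.mul_inv, @eq_comm _ i, @eq_comm _ l]
  mul_skew s l s' l' := by
    simp only [mul_comm (r.R _ _ _ _), r.skew_mul, @eq_comm _ s, @eq_comm _ l]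
  skew_mul s l s' l' := by
    simp only [mul_comm (r.N _ _ _ _), r.mul_skew, @eq_comm _ s, @eq_comm _ l]
  ybe i l m j l' n := by
    have h := r.ybe j l' n i l m
    calc _ = ∑ a, ∑ b, ∑ p, r.R l' n b p * r.R j p a m * r.R a b i l := by
            refine Finset.sum_congr rfl fun _ _ => Finset.sum_congr rfl fun _ _ =>
              Finset.sum_congr rfl fun _ _ => ?_
            ring
      _ = _ := by
            rw [← h]
            refine Finset.sum_congr rfl fun _ _ => Finset.sum_congr rfl fun _ _ =>
              Finset.sum_congr rfl fun _ _ => ?_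
            ring

/-- The matrix `W` whose conjugation is the inverse of the square of the antipode. -/
def W (r : RMatrix k ι) : Matrix ι ι k := .of fun j p => ∑ m, r.N j m m p

/-- `R` as a matrix over an algebra, with rows and columns indexed by pairs. -/
def mat (r : RMatrix k ι) (A : Type*) [Ring A] [Algebra k A] : Matrix (ι × ι) (ι × ι) A :=
  .of fun x y => algebraMap k A (r.R x.1 x.2 y.1 y.2)

end RMatrix

/-! ### The relation R X₁ X₂ = X₂ X₁ R and its consequences for X⁻¹ -/

/-- `X ⊗ 1`. -/
def leg₁ (X : Matrix ι ι A) : Matrix (ι × ι) (ι × ι) A :=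
  .of fun x y => if x.2 = y.2 then X x.1 y.1 else 0

/-- `1 ⊗ X`. -/
def leg₂ (X : Matrix ι ι A) : Matrix (ι × ι) (ι × ι) A :=
  .of fun x y => if x.1 = y.1 then X x.2 y.2 else 0

lemma leg₁_mul (X Y : Matrix ι ι A) : leg₁ (X * Y) = leg₁ X * leg₁ Y := by
  ext x y
  simp [leg₁, Matrix.mul_apply, Fintype.sum_prod_type]

lemma leg₂_mul (X Y : Matrix ι ι A) : leg₂ (X * Y) = leg₂ X * leg₂ Y := by
  ext x y
  simp [leg₂, Matrix.mul_apply, Fintype.sum_prod_type]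

omit [Fintype ι] in
lemma leg₁_one : leg₁ (1 : Matrix ι ι A) = 1 := by
  ext x y
  simp only [leg₁, Matrix.of_apply, Matrix.one_apply, Prod.ext_iff]
  split_ifs <;> simp_all

omit [Fintype ι] in
lemma leg₂_one : leg₂ (1 : Matrix ι ι A) = 1 := by
  ext x y
  simp only [leg₂, Matrix.of_apply, Matrix.one_apply, Prod.ext_iff]
  split_ifs <;> simp_all

lemma leg₁_mul_leg₂ (X Y : Matrix ι ι A) (x y : ι × ι) :
    (leg₁ X * leg₂ Y) x y = X x.1 y.1 * Y x.2 y.2 := by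
  simp [leg₁, leg₂, Matrix.mul_apply, Fintype.sum_prod_type]

lemma leg₂_mul_leg₁ (X Y : Matrix ι ι A) (x y : ι × ι) :
    (leg₂ X * leg₁ Y) x y = X x.2 y.2 * Y x.1 y.1 := by
  simp [leg₁, leg₂, Matrix.mul_apply, Fintype.sum_prod_type]

lemma leg₁_mul_leg₂_comm {X Y : Matrix ι ι A} (h : ∀ i j l m, Commute (X i j) (Y l m)) :
    leg₁ X * leg₂ Y = leg₂ Y * leg₁ X := by
  ext x y
  rw [leg₁_mul_leg₂, leg₂_mul_leg₁, (h _ _ _ _).eq]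

/-- An invertible matrix `X` over `A` that satisfies the relation `R X₁ X₂ = X₂ X₁ R`. -/
@[ext]
structure RMatrix.Point (r : RMatrix k ι) (A : Type*) [Ring A] [Algebra k A] where
  X : Matrix ι ι A
  Y : Matrix ι ι A
  mul_inv : X * Y = 1
  inv_mul : Y * X = 1
  rtt : r.mat A * leg₁ X * leg₂ X = leg₂ X * leg₁ X * r.mat A

namespace RMatrix

variable {r : RMatrix k ι}

lemma rtt_iff (X : Matrix ι ι A) : r.mat A * leg₁ X * leg₂ X = leg₂ X * leg₁ X * r.mat A ↔
    ∀ i l j m, ∑ a, ∑ b, r.R i l a b • (X a j * X b m) =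
      ∑ a, ∑ b, r.R a b j m • (X l b * X i a) := by
  have e1 (x y : ι × ι) : (r.mat A * leg₁ X * leg₂ X) x y =
      ∑ a, ∑ b, r.R x.1 x.2 a b • (X a y.1 * X b y.2) := by
    rw [mul_assoc, Matrix.mul_apply, Fintype.sum_prod_type]
    simp [leg₁_mul_leg₂, mat, Algebra.smul_def]
  have e2 (x y : ι × ι) : (leg₂ X * leg₁ X * r.mat A) x y =
      ∑ a, ∑ b, r.R a b y.1 y.2 • (X x.2 b * X x.1 a) := by
    rw [Matrix.mul_apply, Fintype.sum_prod_type]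
    simp [leg₂_mul_leg₁, mat, Algebra.smul_def, Algebra.commutes]
  refine ⟨fun h i l j m => ?_, fun h => ?_⟩
  · rw [← e1 (i, l) (j, m), ← e2 (i, l) (j, m), h]
  · ext x y
    rw [e1, e2, h]

/-- For invertible p and q, the relations R p = q R and R p⁻¹ = q⁻¹ R are equivalent. Here p = X₁X₂
and q = X₂X₁, whose inverses reverse the order of the legs. -/
lemma rtt_iff_of_inv {X Y : Matrix ι ι A} (h1 : X * Y = 1) (h2 : Y * X = 1) :
    r.mat A * leg₁ X * leg₂ X = leg₂ X * leg₁ X * r.mat A ↔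
      r.mat A * leg₂ Y * leg₁ Y = leg₁ Y * leg₂ Y * r.mat A := by
  have a1 : leg₁ X * leg₁ Y = 1 := by rw [← leg₁_mul, h1, leg₁_one]
  have a2 : leg₁ Y * leg₁ X = 1 := by rw [← leg₁_mul, h2, leg₁_one]
  have b1 : leg₂ X * leg₂ Y = 1 := by rw [← leg₂_mul, h1, leg₂_one]
  have b2 : leg₂ Y * leg₂ X = 1 := by rw [← leg₂_mul, h2, leg₂_one]
  have key {S : Type _} [Ring S] (R p p' q q' : S) (h1 : p * p' = 1) (h2 : q' * q = 1)
      (h : R * p = q * R) : R * p' = q' * R := by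
    calc R * p' = q' * q * R * p' := by rw [h2, one_mul]
      _ = q' * (R * p) * p' := by rw [h, mul_assoc q']
      _ = q' * R := by rw [mul_assoc, mul_assoc, h1, mul_one]
  simp only [mul_assoc (r.mat A)]
  refine ⟨key _ _ _ _ _ ?_ ?_, key _ _ _ _ _ ?_ ?_⟩
  · rw [mul_assoc, ← mul_assoc (leg₂ X), b1, one_mul, a1]
  · rw [mul_assoc, ← mul_assoc (leg₂ Y), b2, one_mul, a2]
  · rw [mul_assoc, ← mul_assoc (leg₁ Y), a2, one_mul, b2]
  · rw [mul_assoc, ← mul_assoc (leg₁ X), a1, one_mul, b1]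

omit [DecidableEq ι] in
lemma sum_sum_sum_sum_comm {S : Type*} [AddCommMonoid S] (f : ι → ι → ι → ι → S) :
    ∑ a, ∑ b, ∑ c, ∑ d, f a b c d = ∑ c, ∑ d, ∑ a, ∑ b, f a b c d := by
  have h := Finset.sum_comm (s := (Finset.univ : Finset (ι × ι)))
    (t := (Finset.univ : Finset (ι × ι))) (f := fun x y => f x.1 x.2 y.1 y.2)
  simpa only [Fintype.sum_prod_type] using h

/-- Since N inverts the partial transpose of R, a linear system with coefficients R can be solved
for its unknowns G. The variant below uses the inverse on the other side. -/
lemma sum_skew_smul (r : RMatrix k ι) {F G : ι → ι → A}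
    (h : ∀ j p, F j p = ∑ a, ∑ l, r.R a p j l • G a l) (s l : ι) :
    ∑ j, ∑ p, r.N j l s p • F j p = G s l := by
  simp only [h, Finset.smul_sum, smul_smul]
  rw [sum_sum_sum_sum_comm]
  simp only [mul_comm (r.N _ _ _ _), ← Finset.sum_smul, r.mul_skew, ite_smul, zero_smul, one_smul,
    ite_and]
  simp

lemma sum_skew_smul' (r : RMatrix k ι) {F G : ι → ι → A}
    (h : ∀ i q, F i q = ∑ a, ∑ l, r.R i l a q • G a l) (s l : ι) :
    ∑ i, ∑ q, r.N s q i l • F i q = G s l := by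
  simp only [h, Finset.smul_sum, smul_smul]
  rw [sum_sum_sum_sum_comm]
  simp only [← Finset.sum_smul, r.skew_mul, ite_smul, zero_smul, one_smul, ite_and]
  simp

namespace Point

/-- Multiplying R X₁ X₂ = X₂ X₁ R by Y₂ on both sides gives Y₂ R X₁ = X₁ R Y₂. -/
lemma rtt_exchange (p : r.Point A) (i s j q : ι) :
    ∑ a, ∑ l, r.R i l a q • (p.Y s l * p.X a j) = ∑ a, ∑ l, r.R a s j l • (p.X i a * p.Y l q) := by
  have h : leg₂ p.Y * (r.mat A * leg₁ p.X) = leg₁ p.X * (r.mat A * leg₂ p.Y) := by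
    have h1 : leg₂ p.X * leg₂ p.Y = 1 := by rw [← leg₂_mul, p.mul_inv, leg₂_one]
    have h2 : leg₂ p.Y * leg₂ p.X = 1 := by rw [← leg₂_mul, p.inv_mul, leg₂_one]
    calc _ = leg₂ p.Y * (r.mat A * leg₁ p.X * leg₂ p.X) * leg₂ p.Y := by
            simp only [mul_assoc, h1, mul_one]
      _ = _ := by
            rw [p.rtt]
            simp only [← mul_assoc, h2, one_mul]
  have := congr($h (i, s) (j, q))
  simp only [Matrix.mul_apply, leg₁, leg₂, mat, Fintype.sum_prod_type, Matrix.of_apply, ite_mul,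
    mul_ite, zero_mul, mul_zero, Finset.sum_ite_eq', Finset.mem_univ, if_true,
    Finset.mul_sum] at this
  rw [Finset.sum_comm]
  simpa only [← Algebra.smul_def, mul_smul_comm, Finset.sum_ite_irrel, Finset.sum_const_zero,
    Finset.sum_ite_eq, Finset.sum_ite_eq', Finset.mem_univ, if_true] using this

/-- This is X W Y = W with the products of entries reversed, so conjugation by W relates Y to an
inverse of X over the opposite algebra. In the exchange relation one application of N turns the
right-hand side into the entries of X Y = 1, and a second one solves for the wanted sum, leaving a
partial trace of N, which is W. -/
lemma sum_W_smul (p : r.Point A) (s w : ι) :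
    ∑ j, ∑ q, r.W j q • (p.Y q w * p.X s j) = algebraMap k A (r.W s w) := by
  have h1 (i q : ι) : ∑ a, ∑ l, r.R i l a q • ∑ j, ∑ t, r.W j t • (p.Y t l * p.X a j) =
      if i = q then 1 else 0 := by
    simp only [Finset.smul_sum]
    rw [sum_sum_sum_sum_comm]
    simp only [smul_comm (r.R _ _ _ _)]
    simp only [← Finset.smul_sum, p.rtt_exchange]
    simp only [W, Matrix.of_apply, Finset.sum_smul]
    have h2 : ∑ m, ∑ j, ∑ t, r.N j m m t • ∑ a, ∑ l, r.R a t j l • (p.X i a * p.Y l q) =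
      ∑ m, p.X i m * p.Y m q := Finset.sum_congr rfl fun m _ => r.sum_skew_smul (fun _ _ => rfl) m m
    rw [← Matrix.mul_apply, p.mul_inv, Matrix.one_apply] at h2
    rw [← h2]
    symm
    rw [Finset.sum_comm]
    exact Finset.sum_congr rfl fun _ _ => Finset.sum_comm
  rw [← r.sum_skew_smul' (fun i q => (h1 i q).symm) s w]
  simp [W, Algebra.smul_def]

end Point

end RMatrix

/-! ### Points given by R itself and the invertibility of W -/

namespace RMatrix

variable {k : Type*} [Field k] {ι : Type*} [Fintype ι] [DecidableEq ι] {r : RMatrix k ι}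
  {A : Type*} [Ring A] [Algebra k A] {B : Type*} [Ring B] [Algebra k B]

open MulOpposite

omit [DecidableEq ι] in
lemma sum_sum_sum_rotate {S : Type*} [AddCommMonoid S] (f : ι → ι → ι → S) :
    ∑ a, ∑ b, ∑ c, f a b c = ∑ b, ∑ c, ∑ a, f a b c := by
  rw [Finset.sum_comm]
  exact Finset.sum_congr rfl fun _ _ => Finset.sum_comm

variable (r) in
/-- The point `X i j = (R i l j m)_{l m}` of matrices. -/
def leftPoint : r.Point (Matrix ι ι k) where
  X := .of fun i j => .of fun l m => r.R i l j m
  Y := .of fun i j => .of fun l m => r.Ri i l j m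
  mul_inv := by
    refine Matrix.ext fun i m => Matrix.ext fun l n => ?_
    simp only [Matrix.mul_apply, Matrix.of_apply, Matrix.sum_apply, r.mul_inv]
    by_cases h1 : i = m <;> by_cases h2 : l = n <;> simp [h1, h2, Matrix.one_apply]
  inv_mul := by
    refine Matrix.ext fun i m => Matrix.ext fun l n => ?_
    simp only [Matrix.mul_apply, Matrix.of_apply, Matrix.sum_apply, r.inv_mul]
    by_cases h1 : i = m <;> by_cases h2 : l = n <;> simp [h1, h2, Matrix.one_apply]
  rtt := by
    refine (rtt_iff _).2 fun i l j m => ?_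
    ext s t
    have h := r.ybe i l s j m t
    simp only [Matrix.mul_apply, Matrix.of_apply, Matrix.sum_apply, Matrix.smul_apply, smul_eq_mul,
      Finset.mul_sum]
    simp only [mul_assoc] at h
    rw [h]
    refine Finset.sum_congr rfl fun _ _ => Finset.sum_congr rfl fun _ _ =>
      Finset.sum_congr rfl fun _ _ => ?_
    ring

variable (r) in
/-- The point `X l m = (R i l j m)_{j i}` of matrices. -/
def rightPoint : r.Point (Matrix ι ι k) where
  X := .of fun l m => .of fun j i => r.R i l j m
  Y := .of fun l m => .of fun j i => r.N i l j m
  mul_inv := by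
    refine Matrix.ext fun l n => Matrix.ext fun j i => ?_
    simp only [Matrix.mul_apply, Matrix.of_apply, Matrix.sum_apply]
    have h := r.skew_mul i n j l
    simp only [mul_comm (r.N _ _ _ _)] at h
    rw [Finset.sum_comm, h]
    simp only [@eq_comm _ i, @eq_comm _ n]
    by_cases h1 : l = n <;> by_cases h2 : j = i <;> simp [h1, h2, Matrix.one_apply]
  inv_mul := by
    refine Matrix.ext fun l n => Matrix.ext fun j i => ?_
    simp only [Matrix.mul_apply, Matrix.of_apply, Matrix.sum_apply]
    have h := r.mul_skew i n j l
    simp only [mul_comm (r.R _ _ _ _)] at h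
    rw [Finset.sum_comm, h]
    simp only [@eq_comm _ i, @eq_comm _ n]
    by_cases h1 : l = n <;> by_cases h2 : j = i <;> simp [h1, h2, Matrix.one_apply]
  rtt := by
    refine (rtt_iff _).2 fun i l j m => ?_
    ext s t
    have h := r.ybe t i l s j m
    rw [sum_sum_sum_rotate, sum_sum_sum_rotate] at h
    conv_rhs at h => rw [sum_sum_sum_rotate]
    simp only [Matrix.mul_apply, Matrix.of_apply, Matrix.sum_apply, Matrix.smul_apply, smul_eq_mul,
      Finset.mul_sum]
    calc _ = _ := ?_
      _ = _ := h.symm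
      _ = _ := ?_
    · refine Finset.sum_congr rfl fun _ _ => Finset.sum_congr rfl fun _ _ =>
        Finset.sum_congr rfl fun _ _ => ?_
      ring
    · rw [← sum_sum_sum_rotate, ← sum_sum_sum_rotate,
        sum_sum_sum_rotate (f := fun a b p => r.R t i a b * r.R a l s p * r.R b p j m)]
      refine Finset.sum_congr rfl fun _ _ => Finset.sum_congr rfl fun _ _ =>
        Finset.sum_congr rfl fun _ _ => ?_
      ring

/-- This is `sum_W_smul` for the point given by R, whose inverse is `Ri`, after solving with N. It
is used to see that the left kernel of W is stable under the slices of N. -/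
lemma W_mul_Ri (r : RMatrix k ι) (i l w m : ι) :
    ∑ p, r.W i p * r.Ri p l w m = ∑ s, r.N i l s m * r.W s w := by
  have h (s t : ι) : ∑ j, ∑ n, r.R s n j t • ∑ q, r.W j q * r.Ri q l w n =
      if l = t then r.W s w else 0 := by
    have := congr($(r.leftPoint.sum_W_smul s w) l t)
    simp only [Matrix.sum_apply, leftPoint, Matrix.mul_apply, Matrix.of_apply, Matrix.smul_apply,
      Matrix.algebraMap_matrix_apply, Algebra.algebraMap_self, RingHom.id_apply] at this
    rw [← this]
    refine Finset.sum_congr rfl fun _ _ => ?_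
    simp only [Finset.smul_sum]
    rw [Finset.sum_comm]
    refine Finset.sum_congr rfl fun _ _ => Finset.sum_congr rfl fun _ _ => ?_
    simp only [smul_eq_mul]
    ring
  have h' := r.sum_skew_smul' (G := fun j n => ∑ q, r.W j q * r.Ri q l w n) (fun _ _ => rfl) i m
  simp only [h] at h'
  rw [← h']
  simp

/-- Let L be the left kernel of W. By `W_mul_Ri` the slices of N preserve L. Assembled into one
injective operator on tuples, they map the finite-dimensional space of L-valued tuples onto itself,
so the slices of R preserve L too. Contracting R with W gives the identity matrix, which writes each
coordinate of z ∈ L as a sum of entries of vectors in L multiplied by W, hence as zero. -/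
lemma isUnit_W (r : RMatrix k ι) : IsUnit r.W := by
  rw [← Matrix.vecMul_injective_iff_isUnit, ← Matrix.coe_vecMulLinear, ← LinearMap.ker_eq_bot]
  set L := LinearMap.ker (Matrix.vecMulLinear r.W)
  have hL (z : ι → k) : z ∈ L ↔ ∀ w, ∑ i, z i * r.W i w = 0 := by
    simp [L, funext_iff, Matrix.vecMul, dotProduct]
  have hN (z : ι → k) (hz : z ∈ L) (l m : ι) : (fun s => ∑ i, z i * r.N i l s m) ∈ L := by
    rw [hL] at hz ⊢
    intro w
    simp only [Finset.sum_mul]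
    rw [Finset.sum_comm]
    simp only [mul_assoc, ← Finset.mul_sum, ← W_mul_Ri]
    simp only [Finset.mul_sum, ← mul_assoc]
    rw [Finset.sum_comm]
    simp [← Finset.sum_mul, hz]
  have hR (z : ι → k) (hz : z ∈ L) (l m : ι) : (fun a => ∑ s, z s * r.R s l a m) ∈ L := by
    -- `f` applies all slices of N at once to a tuple of vectors, and `g` does the same with R; the
    -- skew inverse relation makes `g` a left inverse of `f`.
    let f : (ι → ι → k) →ₗ[k] (ι → ι → k) :=
      { toFun F l s := ∑ m, ∑ i, F m i * r.N i l s m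
        map_add' F G := by ext; simp [add_mul, Finset.sum_add_distrib]
        map_smul' F G := by ext; simp [Finset.mul_sum, mul_assoc] }
    let g (G : ι → ι → k) : ι → ι → k := fun m a => ∑ l, ∑ s, G l s * r.R s m a l
    have hgf (F) : g (f F) = F := by
      ext m a
      simp only [f, g, LinearMap.coe_mk, AddHom.coe_mk, Finset.sum_mul]
      rw [sum_sum_sum_sum_comm]
      have h (c d : ι) : ∑ a', ∑ b, F c d * r.N d a' b c * r.R b m a a' =
          if d = a ∧ c = m then F c d else 0 := by
        simp only [mul_assoc, ← Finset.mul_sum]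
        rw [Finset.sum_comm, r.skew_mul]
        simp
      simp [h, ite_and]
    let p : Submodule k (ι → ι → k) := Submodule.pi Set.univ fun _ => L
    have hfp : p ≤ p.comap f := by
      intro F hF l _
      have : f F l = ∑ m, fun s => ∑ i, F m i * r.N i l s m := by
        ext; simp [f]
      rw [this]
      exact Submodule.sum_mem _ fun m _ => hN _ (hF m trivial) l m
    have hfi : Function.Injective f := Function.LeftInverse.injective hgf
    have hp : p.map f = p :=
      Submodule.eq_of_le_of_finrank_eq (Submodule.map_le_iff_le_comap.2 hfp)
        (Submodule.equivMapOfInjective f hfi p).finrank_eq.symm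
    -- The tuple with z in place m has a preimage F under `f` with values in L, and F is recovered
    -- by `g`, whose values on this tuple are the slices of R applied to z.
    have hzp : (fun l' => if l' = m then z else 0) ∈ p := by
      intro l' _
      dsimp only
      split_ifs
      exacts [hz, L.zero_mem]
    rw [← hp] at hzp
    obtain ⟨F, hF, hFz⟩ := hzp
    have := hF l trivial
    rw [← hgf F, hFz] at this
    convert this using 2 with a
    simp [g, ite_apply, Finset.sum_ite_irrel]
  refine (Submodule.eq_bot_iff _).2 fun z hz => ?_
  have hW (s l : ι) : ∑ a, ∑ b, r.R s b a l * r.W a b = if s = l then 1 else 0 := by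
    simp only [W, Matrix.of_apply, Finset.mul_sum]
    rw [← sum_sum_sum_rotate]
    simp [r.mul_skew, ite_and, @eq_comm _ l]
  ext l
  have h2 : z l = ∑ b, ∑ a, (∑ s, z s * r.R s b a l) * r.W a b := by
    calc z l = ∑ s, z s * ∑ a, ∑ b, r.R s b a l * r.W a b := by simp [hW]
      _ = _ := by
        simp only [Finset.mul_sum, Finset.sum_mul, ← mul_assoc]
        rw [sum_sum_sum_rotate, Finset.sum_comm]
  rw [h2]
  exact Finset.sum_eq_zero fun b _ => (hL _).1 (hR z hz b l) b

end RMatrix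

namespace RMatrix

variable {k : Type*} [Field k] {ι : Type*} [Fintype ι] [DecidableEq ι] {r : RMatrix k ι}
  {A : Type*} [Ring A] [Algebra k A] {B : Type*} [Ring B] [Algebra k B]

open MulOpposite

/-! ### Points of the FRT algebra -/

lemma mat_map (f : A →ₐ[k] B) : (r.mat A).map f = r.mat B := by
  ext; simp [mat]

omit [Fintype ι] in
lemma leg₁_map (X : Matrix ι ι A) (f : A →ₐ[k] B) : (leg₁ X).map f = leg₁ (X.map f) := by
  ext; simp [leg₁, apply_ite f]

omit [Fintype ι] in
lemma leg₂_map (X : Matrix ι ι A) (f : A →ₐ[k] B) : (leg₂ X).map f = leg₂ (X.map f) := by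
  ext; simp [leg₂, apply_ite f]

lemma mat_op_mul (M : Matrix (ι × ι) (ι × ι) A) :
    r.mat Aᵐᵒᵖ * M.map op = (r.mat A * M).map op := by
  ext
  simp [Matrix.mul_apply, mat, Finset.op_sum, Algebra.commutes]

lemma mul_mat_op (M : Matrix (ι × ι) (ι × ι) A) :
    M.map op * r.mat Aᵐᵒᵖ = (M * r.mat A).map op := by
  ext
  simp only [Matrix.mul_apply, mat, Matrix.map_apply, Matrix.of_apply, Finset.op_sum, op_mul]
  exact Finset.sum_congr rfl fun _ _ => (Algebra.commutes _ _).symm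

lemma leg₁_op_mul_leg₂_op (X Y : Matrix ι ι A) :
    leg₁ (X.map op) * leg₂ (Y.map op) = (leg₂ Y * leg₁ X).map op := by
  ext
  simp [leg₁_mul_leg₂, leg₂_mul_leg₁]

lemma leg₂_op_mul_leg₁_op (X Y : Matrix ι ι A) :
    leg₂ (X.map op) * leg₁ (Y.map op) = (leg₁ Y * leg₂ X).map op := by
  ext
  simp [leg₁_mul_leg₂, leg₂_mul_leg₁]

namespace Point

@[ext]
lemma ext_X {p q : r.Point A} (h : p.X = q.X) : p = q :=
  Point.ext h (left_inv_eq_right_inv p.inv_mul (by rw [h, q.mul_inv]))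

/-- The image of a point under a homomorphism. -/
@[simps]
def map (p : r.Point A) (f : A →ₐ[k] B) : r.Point B where
  X := p.X.map f
  Y := p.Y.map f
  mul_inv := by
    rw [← Matrix.map_mul, p.mul_inv]; exact Matrix.map_one _ (map_zero f) (map_one f)
  inv_mul := by
    rw [← Matrix.map_mul, p.inv_mul]; exact Matrix.map_one _ (map_zero f) (map_one f)
  rtt := by
    have h := congr(($p.rtt).map f)
    simpa only [Matrix.map_mul, leg₁_map, leg₂_map, mat_map] using h

/-- The product of two points with commuting entries. -/
@[simps]
def mul (p q : r.Point A) (h : ∀ i j l m, Commute (p.X i j) (q.X l m)) : r.Point A where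
  X := p.X * q.X
  Y := q.Y * p.Y
  mul_inv := by rw [mul_assoc, ← mul_assoc q.X, q.mul_inv, one_mul, p.mul_inv]
  inv_mul := by rw [mul_assoc, ← mul_assoc p.Y, p.inv_mul, one_mul, q.inv_mul]
  rtt := by
    have h1 : leg₁ q.X * leg₂ p.X = leg₂ p.X * leg₁ q.X :=
      leg₁_mul_leg₂_comm fun i j l m => (h l m i j).symm
    have h2 : leg₁ p.X * leg₂ q.X = leg₂ q.X * leg₁ p.X :=
      leg₁_mul_leg₂_comm fun i j l m => (h i j l m)
    simp only [leg₁_mul, leg₂_mul]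
    calc _ = r.mat A * leg₁ p.X * (leg₁ q.X * leg₂ p.X) * leg₂ q.X := by simp only [mul_assoc]
      _ = r.mat A * leg₁ p.X * leg₂ p.X * leg₁ q.X * leg₂ q.X := by rw [h1]; simp only [mul_assoc]
      _ = leg₂ p.X * leg₁ p.X * (r.mat A * leg₁ q.X * leg₂ q.X) := by
        rw [p.rtt]; simp only [mul_assoc]
      _ = leg₂ p.X * (leg₁ p.X * leg₂ q.X) * leg₁ q.X * r.mat A := by
        rw [q.rtt]; simp only [mul_assoc]
      _ = _ := by rw [h2]; simp only [mul_assoc]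

/-- The transposed point, with values in the opposite algebra. -/
def transpose (p : r.Point A) : r.transpose.Point Aᵐᵒᵖ where
  X := (p.X.map op).transpose
  Y := (p.Y.map op).transpose
  mul_inv := by
    ext i j
    have := congr(op ($(p.inv_mul) j i))
    simp only [Matrix.mul_apply, Finset.op_sum, op_mul] at this
    simp only [Matrix.mul_apply, Matrix.transpose_apply, Matrix.map_apply, this, Matrix.one_apply,
      @eq_comm _ i]
    split_ifs <;> rfl
  inv_mul := by
    ext i j
    have := congr(op ($(p.mul_inv) j i))
    simp only [Matrix.mul_apply, Finset.op_sum, op_mul] at this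
    simp only [Matrix.mul_apply, Matrix.transpose_apply, Matrix.map_apply, this, Matrix.one_apply,
      @eq_comm _ i]
    split_ifs <;> rfl
  rtt := (rtt_iff _).2 fun i l j m => by
    have := congr(op $((rtt_iff _).1 p.rtt j m i l))
    simpa [Finset.op_sum] using this.symm

variable (r A) in
/-- The matrix `W` over the opposite algebra. -/
def opW : Matrix ι ι Aᵐᵒᵖ := r.W.map (algebraMap k Aᵐᵒᵖ)

variable (r A) in
/-- The inverse of the matrix `W` over the opposite algebra. -/
def opWInv : Matrix ι ι Aᵐᵒᵖ := r.W⁻¹.map (algebraMap k Aᵐᵒᵖ)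

lemma opW_mul_opWInv : opW r A * opWInv r A = 1 := by
  rw [opW, opWInv, ← Matrix.map_mul, Matrix.mul_nonsing_inv _ ((Matrix.isUnit_iff_isUnit_det _).1
    r.isUnit_W)]
  simp

lemma opWInv_mul_opW : opWInv r A * opW r A = 1 := by
  rw [opW, opWInv, ← Matrix.map_mul, Matrix.nonsing_inv_mul _ ((Matrix.isUnit_iff_isUnit_det _).1
    r.isUnit_W)]
  simp

/-- This is `sum_W_smul` read over the opposite algebra, where it becomes a plain identity of
matrices. -/
lemma op_X_mul_opW_mul_op_Y (p : r.Point A) : p.X.map op * opW r A * p.Y.map op = opW r A := by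
  refine Matrix.ext fun s w => ?_
  have := congr(op $(p.sum_W_smul s w))
  simp only [Finset.op_sum, op_smul, op_mul, ← MulOpposite.algebraMap_apply] at this
  simp only [opW, Matrix.mul_apply, Matrix.map_apply, Finset.sum_mul]
  rw [Finset.sum_comm]
  simpa only [← Algebra.commutes, ← mul_assoc, ← Algebra.smul_def, smul_mul_assoc] using this

/-- `sum_W_smul` only gives a right inverse of X over the opposite algebra. Applied to the
transposed point it gives a left inverse, with the matrix W of the transposed solution in place of
W. -/
lemma exists_mul_op_X (p : r.Point A) : ∃ L, L * p.X.map op = 1 := by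
  let V : Matrix ι ι Aᵐᵒᵖ := r.transpose.W.transpose.map (algebraMap k Aᵐᵒᵖ)
  let V' : Matrix ι ι Aᵐᵒᵖ := r.transpose.W⁻¹.transpose.map (algebraMap k Aᵐᵒᵖ)
  have hV : V' * V = 1 := by
    simp only [V, V']
    rw [← Matrix.map_mul, ← Matrix.transpose_mul,
      Matrix.mul_nonsing_inv _ ((Matrix.isUnit_iff_isUnit_det _).1 r.transpose.isUnit_W)]
    simp
  have h : p.Y.map op * V * p.X.map op = V := by
    refine Matrix.ext fun w s => ?_
    have := p.transpose.sum_W_smul s w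
    simp only [Point.transpose, Matrix.transpose_apply, Matrix.map_apply] at this
    simp only [Matrix.mul_apply, Matrix.map_apply, Finset.sum_mul, V, Matrix.transpose_apply]
    simpa only [← Algebra.commutes, ← mul_assoc, ← Algebra.smul_def, smul_mul_assoc] using this
  exact ⟨V' * (p.Y.map op * V), by rw [mul_assoc, h, hV]⟩

lemma op_X_mul (p : r.Point A) :
    p.X.map op * (opW r A * p.Y.map op * opWInv r A) = 1 := by
  rw [← mul_assoc, ← mul_assoc, op_X_mul_opW_mul_op_Y, opW_mul_opWInv]

/-- A left inverse exists, so it coincides with the right inverse already found. -/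
lemma mul_op_X (p : r.Point A) :
    opW r A * p.Y.map op * opWInv r A * p.X.map op = 1 := by
  obtain ⟨L, hL⟩ := p.exists_mul_op_X
  rw [← left_inv_eq_right_inv hL p.op_X_mul, hL]

/-- The composition of a point with the antipode. -/
@[simps]
def antipode (p : r.Point A) : r.Point Aᵐᵒᵖ where
  X := p.Y.map op
  -- The image of Y under the antipode, that is, the square of the antipode on X: conjugation by W
  -- of X over the opposite algebra.
  Y := opWInv r A * p.X.map op * opW r A
  mul_inv := by
    calc _ = opWInv r A * (opW r A * p.Y.map op * opWInv r A * p.X.map op) * opW r A := by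
            simp only [← mul_assoc, opWInv_mul_opW, one_mul]
      _ = 1 := by rw [p.mul_op_X, mul_one, opWInv_mul_opW]
  inv_mul := by
    rw [mul_assoc, mul_assoc, ← mul_assoc (p.X.map op), op_X_mul_opW_mul_op_Y, opWInv_mul_opW]
  rtt := by
    rw [mul_assoc, leg₂_op_mul_leg₁_op, leg₁_op_mul_leg₂_op, mat_op_mul, mul_mat_op,
      ← (rtt_iff_of_inv p.mul_inv p.inv_mul).1 p.rtt, mul_assoc]

/-- The composition of a point with the inverse of the antipode. -/
@[simps]
def antipodeInv (p : r.Point A) : r.Point Aᵐᵒᵖ where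
  X := opW r A * p.Y.map op * opWInv r A
  Y := p.X.map op
  mul_inv := p.mul_op_X
  inv_mul := p.op_X_mul
  rtt := by
    rw [rtt_iff_of_inv p.mul_op_X p.op_X_mul, mul_assoc, leg₂_op_mul_leg₁_op, leg₁_op_mul_leg₂_op,
      mat_op_mul, mul_mat_op, ← p.rtt, mul_assoc]

end Point

/-! ### The universal point -/

variable (k ι) in
/-- The matrix of the first family of free generators. -/
def freeX : Matrix ι ι (FreeAlgebra k (ι × ι ⊕ ι × ι)) :=
  .of fun i j => FreeAlgebra.ι k (Sum.inl (i, j))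

variable (k ι) in
/-- The matrix of the second family of free generators. -/
def freeY : Matrix ι ι (FreeAlgebra k (ι × ι ⊕ ι × ι)) :=
  .of fun i j => FreeAlgebra.ι k (Sum.inr (i, j))

variable (r) in
/-- The relations of the FRT algebra. -/
inductive Rel : FreeAlgebra k (ι × ι ⊕ ι × ι) → FreeAlgebra k (ι × ι ⊕ ι × ι) → Prop
  | mul_inv (i j : ι) : Rel ((freeX k ι * freeY k ι) i j) ((1 : Matrix ι ι _) i j)
  | inv_mul (i j : ι) : Rel ((freeY k ι * freeX k ι) i j) ((1 : Matrix ι ι _) i j)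
  | rtt (x y : ι × ι) : Rel
    ((r.mat (FreeAlgebra k (ι × ι ⊕ ι × ι)) * leg₁ (freeX k ι) * leg₂ (freeX k ι)) x y)
      ((leg₂ (freeX k ι) * leg₁ (freeX k ι) * r.mat (FreeAlgebra k (ι × ι ⊕ ι × ι))) x y)

variable (r) in
/-- The FRT algebra, which represents the points of `r`. -/
def FRTAlgebra := RingQuot (Rel r)

instance : Ring (FRTAlgebra r) := inferInstanceAs (Ring (RingQuot (Rel r)))
instance : Algebra k (FRTAlgebra r) := inferInstanceAs (Algebra k (RingQuot (Rel r)))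

variable (r) in
/-- The quotient map onto the FRT algebra. -/
def FRTAlgebra.mk : FreeAlgebra k (ι × ι ⊕ ι × ι) →ₐ[k] FRTAlgebra r :=
  RingQuot.mkAlgHom k (Rel r)

lemma FRTAlgebra.mk_rel {x y} (h : Rel r x y) : FRTAlgebra.mk r x = FRTAlgebra.mk r y :=
  RingQuot.mkAlgHom_rel k h

variable (r) in
/-- The universal point. -/
def univ : r.Point (FRTAlgebra r) where
  X := (freeX k ι).map (FRTAlgebra.mk r)
  Y := (freeY k ι).map (FRTAlgebra.mk r)
  mul_inv := by
    rw [← Matrix.map_mul]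
    refine Eq.trans ?_ (Matrix.map_one _ (map_zero (FRTAlgebra.mk r)) (map_one (FRTAlgebra.mk r)))
    ext i j
    exact FRTAlgebra.mk_rel (Rel.mul_inv i j)
  inv_mul := by
    rw [← Matrix.map_mul]
    refine Eq.trans ?_ (Matrix.map_one _ (map_zero (FRTAlgebra.mk r)) (map_one (FRTAlgebra.mk r)))
    ext i j
    exact FRTAlgebra.mk_rel (Rel.inv_mul i j)
  rtt := by
    simp only [← leg₁_map, ← leg₂_map, ← mat_map (FRTAlgebra.mk r), ← Matrix.map_mul]
    ext x y
    exact FRTAlgebra.mk_rel (Rel.rtt x y)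

/-- The homomorphism given by a point. -/
def Point.lift (p : r.Point A) : FRTAlgebra r →ₐ[k] A :=
  let f : FreeAlgebra k (ι × ι ⊕ ι × ι) →ₐ[k] A :=
    FreeAlgebra.lift k (Sum.elim (fun x => p.X x.1 x.2) fun x => p.Y x.1 x.2)
  have hX : (freeX k ι).map f = p.X := by ext; simp [f, freeX]
  have hY : (freeY k ι).map f = p.Y := by ext; simp [f, freeY]
  RingQuot.liftAlgHom k ⟨f, fun x y h => by
    have h1 : (1 : Matrix ι ι (FreeAlgebra k (ι × ι ⊕ ι × ι))).map f = 1 :=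
      Matrix.map_one _ (map_zero f) (map_one f)
    cases h with
    | mul_inv i j =>
      have : (freeX k ι * freeY k ι).map f = (1 : Matrix ι ι _).map f := by
        rw [Matrix.map_mul, hX, hY, p.mul_inv, h1]
      exact congr($this i j)
    | inv_mul i j =>
      have : (freeY k ι * freeX k ι).map f = (1 : Matrix ι ι _).map f := by
        rw [Matrix.map_mul, hX, hY, p.inv_mul, h1]
      exact congr($this i j)
    | rtt x y =>
      have : (r.mat (FreeAlgebra k (ι × ι ⊕ ι × ι)) * leg₁ (freeX k ι) * leg₂ (freeX k ι)).map f =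
          (leg₂ (freeX k ι) * leg₁ (freeX k ι) * r.mat (FreeAlgebra k (ι × ι ⊕ ι × ι))).map f := by
        simp only [Matrix.map_mul, leg₁_map, leg₂_map, mat_map, hX, p.rtt]
      exact congr($this x y)⟩

@[simp]
lemma Point.lift_X (p : r.Point A) (i j : ι) : p.lift ((univ r).X i j) = p.X i j := by
  refine (RingQuot.liftAlgHom_mkAlgHom_apply ..).trans ?_
  simp [freeX]

@[simp]
lemma Point.lift_Y (p : r.Point A) (i j : ι) : p.lift ((univ r).Y i j) = p.Y i j := by
  refine (RingQuot.liftAlgHom_mkAlgHom_apply ..).trans ?_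
  simp [freeY]

/-- The values on the entries of X determine those on Y, because inverses of matrices are unique. -/
lemma FRTAlgebra.hom_ext {f g : FRTAlgebra r →ₐ[k] A}
    (h : ∀ i j, f ((univ r).X i j) = g ((univ r).X i j)) : f = g := by
  have h1 : (univ r).map f = (univ r).map g := Point.ext_X (Matrix.ext h)
  refine RingQuot.ringQuot_ext' _ _ _ (FreeAlgebra.hom_ext (funext ?_))
  rintro (⟨i, j⟩ | ⟨i, j⟩)
  · exact h i j
  · exact congr($(h1).Y i j)

lemma FRTAlgebra.induction {p : FRTAlgebra r → Prop} (hk : ∀ c : k, p (algebraMap k _ c))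
    (hX : ∀ i j, p ((univ r).X i j)) (hY : ∀ i j, p ((univ r).Y i j))
    (hadd : ∀ a b, p a → p b → p (a + b)) (hmul : ∀ a b, p a → p b → p (a * b))
    (a : FRTAlgebra r) : p a := by
  obtain ⟨a, rfl⟩ := RingQuot.mkAlgHom_surjective k (Rel r) a
  induction a using FreeAlgebra.induction with
  | grade0 c => rw [AlgHom.commutes]; exact hk c
  | grade1 x => rcases x with ⟨i, j⟩ | ⟨i, j⟩; exacts [hX i j, hY i j]
  | mul a b ha hb => rw [map_mul]; exact hmul _ _ ha hb
  | add a b ha hb => rw [map_add]; exact hadd _ _ ha hb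

end RMatrix

namespace RMatrix

variable {k : Type*} [Field k] {ι : Type*} [Fintype ι] [DecidableEq ι] {r : RMatrix k ι}
  {A : Type*} [Ring A] [Algebra k A] {B : Type*} [Ring B] [Algebra k B]

open MulOpposite

/-! ### The Hopf algebra structure of the FRT algebra -/

lemma FRTAlgebra.hom_ext_Y {f g : FRTAlgebra r →ₐ[k] A}
    (h : ∀ i j, f ((univ r).Y i j) = g ((univ r).Y i j)) : f = g := by
  have h1 : (univ r).Y.map f = (univ r).Y.map g := Matrix.ext h
  refine FRTAlgebra.hom_ext fun i j => ?_
  have h2 := left_inv_eq_right_inv ((univ r).map f).mul_inv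
    (by rw [Point.map_Y, h1]; exact ((univ r).map g).inv_mul)
  exact congr($h2 i j)

/-- The product of two points in the tensor product of their algebras. -/
def Point.tensor (p : r.Point A) (q : r.Point B) : r.Point (A ⊗[k] B) :=
  (p.map Algebra.TensorProduct.includeLeft).mul (q.map Algebra.TensorProduct.includeRight)
    fun i j l m => by simp [commute_iff_eq]

@[simp]
lemma Point.tensor_X (p : r.Point A) (q : r.Point B) (i j : ι) :
    (p.tensor q).X i j = ∑ l, p.X i l ⊗ₜ q.X l j := by
  simp [Point.tensor, Matrix.mul_apply]

@[simp]
lemma Point.tensor_Y (p : r.Point A) (q : r.Point B) (i j : ι) :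
    (p.tensor q).Y i j = ∑ l, p.Y l j ⊗ₜ q.Y i l := by
  simp [Point.tensor, Matrix.mul_apply]

variable (r A) in
/-- The point given by the identity matrix. -/
@[simps]
def Point.one : r.Point A where
  X := 1
  Y := 1
  mul_inv := one_mul 1
  inv_mul := one_mul 1
  rtt := by simp [leg₁_one, leg₂_one]

instance : Bialgebra k (FRTAlgebra r) :=
  .ofAlgHom ((univ r).tensor (univ r)).lift (Point.one r k).lift
    (FRTAlgebra.hom_ext fun i j => by
      simp only [AlgHom.comp_apply, Point.lift_X, Point.tensor_X, map_sum,
        Algebra.TensorProduct.map_tmul, AlgHom.id_apply, TensorProduct.sum_tmul,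
        TensorProduct.tmul_sum]
      rw [Finset.sum_comm]
      rfl)
    (FRTAlgebra.hom_ext fun i j => by
      simp [Matrix.one_apply, TensorProduct.ite_tmul])
    (FRTAlgebra.hom_ext fun i j => by
      simp [Matrix.one_apply, TensorProduct.tmul_ite])

namespace FRTAlgebra

@[simp]
lemma comul_X (i j : ι) :
    comul (R := k) ((univ r).X i j) = ∑ l, (univ r).X i l ⊗ₜ (univ r).X l j :=
  (Point.lift_X _ i j).trans (Point.tensor_X ..)

@[simp]
lemma comul_Y (i j : ι) :
    comul (R := k) ((univ r).Y i j) = ∑ l, (univ r).Y l j ⊗ₜ (univ r).Y i l :=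
  (Point.lift_Y _ i j).trans (Point.tensor_Y ..)

@[simp]
lemma counit_X (i j : ι) : counit (R := k) ((univ r).X i j) = (1 : Matrix ι ι k) i j :=
  Point.lift_X _ i j

@[simp]
lemma counit_Y (i j : ι) : counit (R := k) ((univ r).Y i j) = (1 : Matrix ι ι k) i j :=
  Point.lift_Y _ i j

/-- The linear map underlying an antihomomorphism. -/
def antiLin (f : FRTAlgebra r →ₐ[k] Aᵐᵒᵖ) : FRTAlgebra r →ₗ[k] A :=
  (MulOpposite.opLinearEquiv k).symm.toLinearMap ∘ₗ f.toLinearMap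

@[simp]
lemma antiLin_apply (f : FRTAlgebra r →ₐ[k] Aᵐᵒᵖ) (a : FRTAlgebra r) :
    antiLin f a = unop (f a) := rfl

/-- The identity holds on the generators and passes to products, since the candidate reverses
products and the inner factor collapses to a central scalar. -/
lemma antipode_mul_id : WithConv.toConv (antiLin (univ r).antipode.lift) *
    WithConv.toConv LinearMap.id = 1 := by
  ext a
  simp only [LinearMap.convMul_apply, LinearMap.convOne_apply]
  induction a using FRTAlgebra.induction with
  | hk c => simp [Algebra.TensorProduct.algebraMap_apply]
  | hX i j =>
    have := congr($((univ r).inv_mul) i j)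
    simpa [Matrix.mul_apply, Matrix.one_apply, apply_ite] using this
  -- This case uses that Y is invertible over the opposite algebra, hence the invertibility of W.
  | hY i j =>
    have := congr(unop ($((univ r).antipode.mul_inv) i j))
    simp only [Matrix.mul_apply, Finset.unop_sum, unop_mul] at this
    simp [Matrix.one_apply, apply_ite] at this ⊢
    exact this
  | hadd a b ha hb => simp only [map_add, ha, hb]
  | hmul a b ha hb =>
    rw [← (ℛ k a).eq] at ha
    rw [← (ℛ k b).eq] at hb
    rw [Bialgebra.comul_mul, ← (ℛ k a).eq, ← (ℛ k b).eq]
    simp only [map_sum, TensorProduct.map_tmul, LinearMap.mul'_apply, LinearMap.id_apply,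
      antiLin_apply, Finset.sum_mul_sum, Algebra.TensorProduct.tmul_mul_tmul, map_mul,
      unop_mul] at ha hb ⊢
    rw [Finset.sum_comm, Bialgebra.counit_mul, map_mul, Algebra.commutes, ← hb, Finset.sum_mul]
    refine Finset.sum_congr rfl fun j _ => ?_
    rw [mul_assoc, ← Algebra.commutes, ← ha, Finset.sum_mul, Finset.mul_sum]
    simp only [mul_assoc]

lemma id_mul_antipode : WithConv.toConv LinearMap.id *
    WithConv.toConv (antiLin (univ r).antipode.lift) = 1 := by
  ext a
  simp only [LinearMap.convMul_apply, LinearMap.convOne_apply]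
  induction a using FRTAlgebra.induction with
  | hk c => simp [Algebra.TensorProduct.algebraMap_apply]
  | hX i j =>
    have := congr($((univ r).mul_inv) i j)
    simpa [Matrix.mul_apply, Matrix.one_apply, apply_ite] using this
  | hY i j =>
    have := congr(unop ($((univ r).antipode.inv_mul) i j))
    rw [Matrix.mul_apply, Finset.unop_sum] at this
    simp only [unop_mul] at this
    simp [Matrix.one_apply, apply_ite] at this ⊢
    exact this
  | hadd a b ha hb => simp only [map_add, ha, hb]
  | hmul a b ha hb =>
    rw [← (ℛ k a).eq] at ha
    rw [← (ℛ k b).eq] at hb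
    rw [Bialgebra.comul_mul, ← (ℛ k a).eq, ← (ℛ k b).eq]
    simp only [map_sum, TensorProduct.map_tmul, LinearMap.mul'_apply, LinearMap.id_apply,
      antiLin_apply, Finset.sum_mul_sum, Algebra.TensorProduct.tmul_mul_tmul, map_mul,
      unop_mul] at ha hb ⊢
    rw [Bialgebra.counit_mul, map_mul, ← ha, Finset.sum_mul]
    refine Finset.sum_congr rfl fun i _ => ?_
    rw [mul_assoc, ← Algebra.commutes, ← hb, Finset.sum_mul, Finset.mul_sum]
    simp only [mul_assoc]

instance : HopfAlgebra k (FRTAlgebra r) :=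
  HopfAlgebra.ofConvInverse (antiLin (univ r).antipode.lift) antipode_mul_id id_mul_antipode

open HopfAlgebra

@[simp]
lemma antipode_X (i j : ι) : antipode k ((univ r).X i j) = (univ r).Y i j :=
  congr(unop $(Point.lift_X (univ r).antipode i j))

variable (r) in
/-- The inverse of the antipode. -/
def antipodeInv : FRTAlgebra r →ₗ[k] FRTAlgebra r := antiLin (univ r).antipodeInv.lift

@[simp]
lemma antipodeInv_Y (i j : ι) : antipodeInv r ((univ r).Y i j) = (univ r).X i j :=
  congr(unop $(Point.lift_Y (univ r).antipodeInv i j))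

lemma antipodeInv_mul (a b : FRTAlgebra r) :
    antipodeInv r (a * b) = antipodeInv r b * antipodeInv r a := by
  simp [antipodeInv]

-- The composite of two antihomomorphisms is a homomorphism, and this one fixes Y.
@[simp]
lemma antipode_antipodeInv (a : FRTAlgebra r) : antipode k (antipodeInv r a) = a := by
  let f : FRTAlgebra r →ₐ[k] FRTAlgebra r := .ofLinearMap (antipode k ∘ₗ antipodeInv r)
    (by simp [antipodeInv]) (by simp [antipodeInv_mul, antipode_mul_antidistrib])
  have : f = AlgHom.id k _ := hom_ext_Y fun i j => by simp [f]
  exact congr($this a)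

@[simp]
lemma antipodeInv_antipode (a : FRTAlgebra r) : antipodeInv r (antipode k a) = a := by
  let f : FRTAlgebra r →ₐ[k] FRTAlgebra r := .ofLinearMap (antipodeInv r ∘ₗ antipode k)
    (by simp [antipodeInv]) (by simp [antipodeInv_mul, antipode_mul_antidistrib])
  have : f = AlgHom.id k _ := hom_ext fun i j => by simp [f]
  exact congr($this a)

end FRTAlgebra

end RMatrix

/-! ### The coquasitriangular axioms on elements -/

section

open LinearMap WithConv

variable {k : Type*} [Field k] {H : Type*} [Ring H] [Bialgebra k H] {r : H ⊗[k] H →ₗ[k] k}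

lemma toConv_mul_comm_iff {a b : H} {κ κ' : Type*} (𝓡 : Coalgebra.Repr k a κ)
    (𝓢 : Coalgebra.Repr k b κ') :
    (toConv (Algebra.linearMap k H ∘ₗ r) * toConv (mul' k H)) (a ⊗ₜ b) =
      (toConv (mul' k H ∘ₗ (TensorProduct.comm k H H).toLinearMap) *
        toConv (Algebra.linearMap k H ∘ₗ r)) (a ⊗ₜ b) ↔
    ∑ i ∈ 𝓡.index, ∑ j ∈ 𝓢.index,
        r (𝓡.left i ⊗ₜ 𝓢.left j) • (𝓡.right i * 𝓢.right j) =
      ∑ i ∈ 𝓡.index, ∑ j ∈ 𝓢.index,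
        r (𝓡.right i ⊗ₜ 𝓢.right j) • (𝓢.left j * 𝓡.left i) := by
  rw [(𝓡.tmul 𝓢).convMul_apply, (𝓡.tmul 𝓢).convMul_apply]
  simp [Finset.sum_product, Algebra.smul_def, Algebra.commutes]

/-- Convolving ∇ᵒᵖ = r ⋆ ∇ ⋆ r⁻¹ with r on the right gives r ⋆ ∇ = ∇ᵒᵖ ⋆ r. -/
lemma IsCoquasitriangular.mul_comm (hr : IsCoquasitriangular r) {a b : H} {κ κ' : Type*}
    (𝓡 : Coalgebra.Repr k a κ) (𝓢 : Coalgebra.Repr k b κ') :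
    ∑ i ∈ 𝓡.index, ∑ j ∈ 𝓢.index,
        r (𝓡.left i ⊗ₜ 𝓢.left j) • (𝓡.right i * 𝓢.right j) =
      ∑ i ∈ 𝓡.index, ∑ j ∈ 𝓢.index,
        r (𝓡.right i ⊗ₜ 𝓢.right j) • (𝓢.left j * 𝓡.left i) := by
  obtain ⟨s, h1, h2, h3⟩ := hr.exists_inv
  rw [← toConv_mul_comm_iff, h3, mul_assoc]
  have h : toConv (Algebra.linearMap k H ∘ₗ s) * toConv (Algebra.linearMap k H ∘ₗ r) = 1 := by
    have := algHom_comp_convMul_distrib (Algebra.ofId k H) (toConv s) (toConv r)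
    apply ofConv_injective
    refine this.symm.trans ?_
    rw [h2]
    rfl
  rw [h, mul_one]

lemma IsCoquasitriangular.apply_mul_left_repr (hr : IsCoquasitriangular r) (a b : H) {c : H}
    {κ : Type*} (𝓡 : Coalgebra.Repr k c κ) : r ((a * b) ⊗ₜ c) =
      ∑ i ∈ 𝓡.index, r (a ⊗ₜ 𝓡.left i) * r (b ⊗ₜ 𝓡.right i) := by
  rw [hr.apply_mul_left]
  exact ((ℛ k c).convMul_apply (toConv (r ∘ₗ TensorProduct.mk k H H a))
    (toConv (r ∘ₗ TensorProduct.mk k H H b))).symm.trans (𝓡.convMul_apply _ _)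

lemma IsCoquasitriangular.apply_mul_right_repr (hr : IsCoquasitriangular r) {a : H} (b c : H)
    {κ : Type*} (𝓡 : Coalgebra.Repr k a κ) : r (a ⊗ₜ (b * c)) =
      ∑ i ∈ 𝓡.index, r (𝓡.left i ⊗ₜ c) * r (𝓡.right i ⊗ₜ b) := by
  rw [hr.apply_mul_right]
  exact ((ℛ k a).convMul_apply (toConv (r ∘ₗ (TensorProduct.mk k H H).flip c))
    (toConv (r ∘ₗ (TensorProduct.mk k H H).flip b))).symm.trans (𝓡.convMul_apply _ _)

/-- The form r(· ⊗ 1) is idempotent for convolution because 1 · 1 = 1, and it is invertible, so it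
is the counit. -/
lemma IsCoquasitriangular.apply_one_right (hr : IsCoquasitriangular r) (a : H) :
    r (a ⊗ₜ 1) = counit (R := k) a := by
  obtain ⟨s, h1, h2, -⟩ := hr.exists_inv
  let ι : H →ₗc[k] H ⊗[k] H :=
    { toLinearMap := (TensorProduct.mk k H H).flip 1
      counit_comp := by ext; simp
      map_comp_comul := by
        ext x
        have hx := (ℛ k x).eq
        simp [← hx, TensorProduct.sum_tmul, Algebra.TensorProduct.one_def] }
  let e : WithConv (H →ₗ[k] k) := toConv (r ∘ₗ ι.toLinearMap)
  let f : WithConv (H →ₗ[k] k) := toConv (s ∘ₗ ι.toLinearMap)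
  have hef : e * f = 1 := by
    have := convMul_comp_coalgHom_distrib (toConv r) (toConv s) ι
    rw [h1] at this
    apply ofConv_injective
    rw [← this]
    ext x; simp [ι]
  have hee : e * e = e := by
    ext x
    have hx := (ℛ k x).eq
    have := hr.apply_mul_right x 1 1
    rw [one_mul] at this
    simp [e, ι, ← hx, this]
  have he : e = 1 := by
    calc e = e * (e * f) := by rw [hef, mul_one]
      _ = 1 := by rw [← mul_assoc, hee, hef]
  exact congr(($he).ofConv a)

lemma IsCoquasitriangular.of_apply (s : H ⊗[k] H →ₗ[k] k)
    (h1 : toConv r * toConv s = 1) (h2 : toConv s * toConv r = 1)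
    (hc : ∀ a b : H, ∑ i ∈ (ℛ k a).index, ∑ j ∈ (ℛ k b).index,
        r ((ℛ k a).left i ⊗ₜ (ℛ k b).left j) • ((ℛ k a).right i * (ℛ k b).right j) =
      ∑ i ∈ (ℛ k a).index, ∑ j ∈ (ℛ k b).index,
        r ((ℛ k a).right i ⊗ₜ (ℛ k b).right j) • ((ℛ k b).left j * (ℛ k a).left i))
    (hl : ∀ a b c : H, r ((a * b) ⊗ₜ c) = ∑ i ∈ (ℛ k c).index,
      r (a ⊗ₜ (ℛ k c).left i) * r (b ⊗ₜ (ℛ k c).right i))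
    (hr : ∀ a b c : H, r (a ⊗ₜ (b * c)) = ∑ i ∈ (ℛ k a).index,
      r ((ℛ k a).left i ⊗ₜ c) * r ((ℛ k a).right i ⊗ₜ b)) : IsCoquasitriangular r where
  exists_inv := by
    refine ⟨s, h1, h2, ?_⟩
    have h : toConv (Algebra.linearMap k H ∘ₗ r) * toConv (Algebra.linearMap k H ∘ₗ s) = 1 := by
      have := algHom_comp_convMul_distrib (Algebra.ofId k H) (toConv r) (toConv s)
      apply ofConv_injective
      refine this.symm.trans ?_
      rw [h1]
      rfl
    have h' : toConv (Algebra.linearMap k H ∘ₗ r) * toConv (mul' k H) =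
        toConv (mul' k H ∘ₗ (TensorProduct.comm k H H).toLinearMap) *
          toConv (Algebra.linearMap k H ∘ₗ r) := by
      apply ofConv_injective
      exact TensorProduct.ext' fun a b => (toConv_mul_comm_iff (ℛ k a) (ℛ k b)).2 (hc a b)
    rw [h', mul_assoc, h, mul_one]
  mul_left := by
    apply ofConv_injective
    refine TensorProduct.ext' fun a bc => ?_
    induction bc with
    | zero => simp only [tmul_zero, map_zero]
    | add x y hx hy => simp only [tmul_add, map_add, hx, hy]
    | tmul b c =>
    have ha := (ℛ k a).eq
    have hb := (ℛ k b).eq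
    have hc := (ℛ k c).eq
    have ha' := congr(TensorProduct.rid k H ($(sum_tmul_counit_eq (ℛ k a))))
    have hb' := sum_counit_smul (ℛ k b)
    simp only [map_sum, TensorProduct.rid_tmul, one_smul] at ha'
    have e1 : ∀ l, r (a ⊗ₜ (ℛ k c).left l) = ∑ i ∈ (ℛ k a).index,
        counit (R := k) ((ℛ k a).right i) * r ((ℛ k a).left i ⊗ₜ (ℛ k c).left l) := fun l => by
      conv_lhs => rw [← ha']
      simp [TensorProduct.sum_tmul, ← TensorProduct.smul_tmul']
    have e2 : ∀ l, r (b ⊗ₜ (ℛ k c).right l) = ∑ i ∈ (ℛ k b).index,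
        counit (R := k) ((ℛ k b).left i) * r ((ℛ k b).right i ⊗ₜ (ℛ k c).right l) := fun l => by
      conv_lhs => rw [← hb']
      simp [TensorProduct.sum_tmul, ← TensorProduct.smul_tmul']
    simp [r₁₃, r₂₃, LinearMap.convMul_def, ← ha, ← hb, ← hc, TensorProduct.sum_tmul,
      TensorProduct.tmul_sum]
    simp only [hl, e1, e2, Finset.sum_mul, Finset.mul_sum]
    refine Finset.sum_congr rfl fun _ _ => Finset.sum_congr rfl fun _ _ =>
      Finset.sum_congr rfl fun _ _ => ?_
    ring
  mul_right := by
    apply ofConv_injective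
    refine TensorProduct.ext' fun a bc => ?_
    induction bc with
    | zero => simp only [tmul_zero, map_zero]
    | add x y hx hy => simp only [tmul_add, map_add, hx, hy]
    | tmul b c =>
    have ha := (ℛ k a).eq
    have hb := (ℛ k b).eq
    have hc := (ℛ k c).eq
    have hc' := congr(TensorProduct.rid k H ($(sum_tmul_counit_eq (ℛ k c))))
    have hb' := sum_counit_smul (ℛ k b)
    simp only [map_sum, TensorProduct.rid_tmul, one_smul] at hc'
    have e1 : ∀ l, r ((ℛ k a).left l ⊗ₜ c) = ∑ i ∈ (ℛ k c).index,
        counit (R := k) ((ℛ k c).right i) * r ((ℛ k a).left l ⊗ₜ (ℛ k c).left i) := fun l => by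
      conv_lhs => rw [← hc']
      simp [TensorProduct.tmul_sum]
    have e2 : ∀ l, r ((ℛ k a).right l ⊗ₜ b) = ∑ i ∈ (ℛ k b).index,
        counit (R := k) ((ℛ k b).left i) * r ((ℛ k a).right l ⊗ₜ (ℛ k b).right i) := fun l => by
      conv_lhs => rw [← hb']
      simp [TensorProduct.tmul_sum]
    simp [r₁₃, r₁₂, LinearMap.convMul_def, ← ha, ← hb, ← hc, TensorProduct.sum_tmul,
      TensorProduct.tmul_sum]
    simp only [hr, e1, e2, Finset.sum_mul, Finset.mul_sum]
    symm
    rw [Finset.sum_comm]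
    simp only [Finset.sum_comm (s := (ℛ k c).index)]
    rw [Finset.sum_comm]
    refine Finset.sum_congr rfl fun _ _ => Finset.sum_congr rfl fun _ _ =>
      Finset.sum_congr rfl fun _ _ => ?_
    ring

end

namespace RMatrix

variable {k : Type*} [Field k] {ι : Type*} [Fintype ι] [DecidableEq ι] {r : RMatrix k ι}
  {A : Type*} [Ring A] [Algebra k A] {B : Type*} [Ring B] [Algebra k B]

namespace FRTAlgebra

open WithConv HopfAlgebra

/-! ### The coquasitriangular structure of the FRT algebra -/

/-- If u intertwines two homomorphisms on the entries of X, it intertwines the inverse matrices too,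
hence the homomorphisms on the whole algebra. Identities that are not visibly multiplicative become
accessible by a suitable choice of u. -/
lemma intertwine {f g : FRTAlgebra r →ₐ[k] A} {u : A}
    (h : ∀ i j, f ((univ r).X i j) * u = u * g ((univ r).X i j)) (a : FRTAlgebra r) :
    f a * u = u * g a := by
  have hX : ((univ r).map f).X * Matrix.scalar ι u = Matrix.scalar ι u * ((univ r).map g).X := by
    ext i j
    simp [h]
  have hY : ((univ r).map f).Y * Matrix.scalar ι u = Matrix.scalar ι u * ((univ r).map g).Y := by
    calc _ = ((univ r).map f).Y * (Matrix.scalar ι u * ((univ r).map g).X) *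
          ((univ r).map g).Y := by
            rw [mul_assoc, mul_assoc, ((univ r).map g).mul_inv, mul_one]
      _ = _ := by rw [← hX, ← mul_assoc, ((univ r).map f).inv_mul, one_mul]
  induction a using FRTAlgebra.induction with
  | hk c => rw [AlgHom.commutes, AlgHom.commutes, Algebra.commutes]
  | hX i j => exact h i j
  | hY i j => simpa using congr($hY i j)
  | hadd a b ha hb => rw [map_add, map_add, add_mul, mul_add, ha, hb]
  | hmul a b ha hb => rw [map_mul, map_mul, mul_assoc, hb, ← mul_assoc, ha, mul_assoc]

lemma antipodeInv_algebraMap (c : k) : antipodeInv r (algebraMap k _ c) = algebraMap k _ c := by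
  simp [antipodeInv]

lemma sum_antipodeInv_mul (a : FRTAlgebra r) :
    ∑ i ∈ (ℛ k a).index, antipodeInv r ((ℛ k a).right i) * (ℛ k a).left i =
      algebraMap k _ (counit (R := k) a) := by
  have h := congr(antipodeInv r $(sum_antipode_mul_eq_algebraMap_counit (ℛ k a)))
  simp only [map_sum, antipodeInv_mul, antipodeInv_antipode] at h
  rw [h, antipodeInv_algebraMap]

lemma sum_mul_antipodeInv (a : FRTAlgebra r) :
    ∑ i ∈ (ℛ k a).index, (ℛ k a).right i * antipodeInv r ((ℛ k a).left i) =
      algebraMap k _ (counit (R := k) a) := by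
  have h := congr(antipodeInv r $(sum_mul_antipode_eq_algebraMap_counit (ℛ k a)))
  simp only [map_sum, antipodeInv_mul, antipodeInv_antipode] at h
  rw [h, antipodeInv_algebraMap]

variable (r) in
/-- The representation whose matrix coefficients are the forms `r (X i j ⊗ ·)`. -/
def rightHom : FRTAlgebra r →ₐ[k] Matrix ι ι k := r.rightPoint.lift

variable (r) in
/-- The linear form `r (X i j ⊗ ·)`. -/
def formX (i j : ι) : FRTAlgebra r →ₗ[k] k :=
  Matrix.entryLinearMap k k j i ∘ₗ (rightHom r).toLinearMap

variable (r) in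
/-- The linear form `r (Y i j ⊗ ·)`. -/
def formY (i j : ι) : FRTAlgebra r →ₗ[k] k := formX r i j ∘ₗ antipodeInv r

@[simp]
lemma formX_apply (i j : ι) (a : FRTAlgebra r) : formX r i j a = rightHom r a j i := rfl

@[simp]
lemma formY_apply (i j : ι) (a : FRTAlgebra r) :
    formY r i j a = rightHom r (antipodeInv r a) j i := rfl

@[simp]
lemma rightHom_X (l m j i : ι) : rightHom r ((univ r).X l m) j i = r.R i l j m := by
  simp [rightHom, rightPoint]

/-- The square of `rightHom` under convolution. -/
def rightHomSq (r : RMatrix k ι) : FRTAlgebra r →ₐ[k] Matrix (ι × ι) (ι × ι) k :=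
  (Matrix.kroneckerAlgEquiv ι ι k).toAlgHom.comp
    ((Algebra.TensorProduct.map (rightHom r) (rightHom r)).comp (Bialgebra.comulAlgHom k _))

lemma rightHomSq_apply (a : FRTAlgebra r) (x y : ι × ι) :
    rightHomSq r a x y = (toConv (formX r y.1 x.1) * toConv (formX r y.2 x.2)) a := by
  have h : rightHomSq r a = Matrix.kroneckerAlgEquiv ι ι k
    (TensorProduct.map (rightHom r).toLinearMap (rightHom r).toLinearMap (comul a)) := rfl
  rw [(ℛ k a).convMul_apply, h, ← (ℛ k a).eq]
  simp only [map_sum, TensorProduct.map_tmul, Matrix.sum_apply]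
  rfl

variable (r) in
/-- The point of the convolution algebra that defines the coquasitriangular structure. -/
def formPoint : r.Point (WithConv (FRTAlgebra r →ₗ[k] k)) where
  X := .of fun i j => toConv (formX r i j)
  Y := .of fun i j => toConv (formY r i j)
  mul_inv := by
    refine Matrix.ext fun i l => WithConv.ext (LinearMap.ext fun a => ?_)
    -- The forms are transposed entries of `rightHom`, so their matrix product reverses the order of
    -- the factors. This is why the inverse of the antipode is needed in place of the antipode.
    have h := congr($(congrArg (rightHom r) (sum_antipodeInv_mul a)) l i)
    rw [Matrix.mul_apply, WithConv.ofConv_sum, LinearMap.sum_apply]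
    simp only [Matrix.of_apply, (ℛ k a).convMul_apply, formX_apply, formY_apply]
    rw [Finset.sum_comm]
    simp only [map_sum, map_mul, Matrix.sum_apply, Matrix.mul_apply, AlgHom.commutes] at h
    simp only [mul_comm (rightHom r ((ℛ k a).left _) _ _)]
    rw [h, Matrix.algebraMap_matrix_apply, Matrix.one_apply]
    by_cases h : i = l <;> simp [h, eq_comm]
  inv_mul := by
    refine Matrix.ext fun i l => WithConv.ext (LinearMap.ext fun a => ?_)
    have h := congr($(congrArg (rightHom r) (sum_mul_antipodeInv a)) l i)
    rw [Matrix.mul_apply, WithConv.ofConv_sum, LinearMap.sum_apply]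
    simp only [Matrix.of_apply, (ℛ k a).convMul_apply, formX_apply, formY_apply]
    rw [Finset.sum_comm]
    simp only [map_sum, map_mul, Matrix.sum_apply, Matrix.mul_apply, AlgHom.commutes] at h
    simp only [mul_comm (rightHom r (antipodeInv r ((ℛ k a).left _)) _ _)]
    rw [h, Matrix.algebraMap_matrix_apply, Matrix.one_apply]
    by_cases h : i = l <;> simp [h, eq_comm]
  rtt := by
    refine (rtt_iff _).2 fun i l j m => WithConv.ext (LinearMap.ext fun a => ?_)
    -- Evaluated at a, the relation says that the transpose of R intertwines `rightHomSq` with its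
    -- flip. On the entries of X this is the Yang-Baxter equation.
    have h := FRTAlgebra.intertwine (f := rightHomSq r)
      (g := (Matrix.reindexAlgEquiv k k (Equiv.prodComm ι ι)).toAlgHom.comp (rightHomSq r))
      (u := r.transpose.mat k) ?_ a
    · have h' := congr($h (j, m) (i, l))
      simp only [Matrix.mul_apply, Fintype.sum_prod_type, mat, rightHomSq_apply, Matrix.of_apply,
        transpose_R, Algebra.algebraMap_self, RingHom.id_apply, mul_comm _ (r.R _ _ _ _)] at h'
      simp only [WithConv.ofConv_sum, WithConv.ofConv_smul, LinearMap.sum_apply,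
        LinearMap.smul_apply, Matrix.of_apply, smul_eq_mul]
      refine h'.trans (Finset.sum_congr rfl fun _ _ => Finset.sum_congr rfl fun _ _ => ?_)
      congr 1
      exact rightHomSq_apply _ _ _
    · intro p q
      ext ⟨j, m⟩ ⟨i, l⟩
      have h' := r.ybe i l p j m q
      simp [Matrix.mul_apply, Fintype.sum_prod_type, mat, rightHomSq_apply]
      simp only [Finset.mul_sum, Finset.sum_mul]
      calc _ = _ := ?_
        _ = _ := h'
        _ = _ := ?_
      · refine Finset.sum_congr rfl fun _ _ => Finset.sum_congr rfl fun _ _ =>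
          Finset.sum_congr rfl fun _ _ => ?_
        ring
      · refine Finset.sum_congr rfl fun _ _ => Finset.sum_congr rfl fun _ _ =>
          Finset.sum_congr rfl fun _ _ => ?_
        ring

variable (r) in
/-- The coquasitriangular structure of the FRT algebra. -/
def form : FRTAlgebra r ⊗[k] FRTAlgebra r →ₗ[k] k :=
  TensorProduct.lift ((WithConv.linearEquiv k _).toLinearMap ∘ₗ (formPoint r).lift.toLinearMap)

lemma form_tmul (a b : FRTAlgebra r) : form r (a ⊗ₜ b) = (formPoint r).lift a b := rfl

lemma form_X (i j : ι) (a : FRTAlgebra r) :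
    form r ((univ r).X i j ⊗ₜ a) = rightHom r a j i := by
  simp [form_tmul, formPoint]

lemma form_Y (i j : ι) (a : FRTAlgebra r) :
    form r ((univ r).Y i j ⊗ₜ a) = rightHom r (antipodeInv r a) j i := by
  simp [form_tmul, formPoint]

lemma form_mul_left (a b c : FRTAlgebra r) : form r ((a * b) ⊗ₜ c) =
    ∑ i ∈ (ℛ k c).index, form r (a ⊗ₜ (ℛ k c).left i) * form r (b ⊗ₜ (ℛ k c).right i) := by
  simp only [form_tmul, map_mul, (ℛ k c).convMul_apply]

lemma form_mul_left_repr (a b : FRTAlgebra r) {c : FRTAlgebra r} {κ : Type*}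
    (𝓡 : Coalgebra.Repr k c κ) : form r ((a * b) ⊗ₜ c) =
    ∑ i ∈ 𝓡.index, form r (a ⊗ₜ 𝓡.left i) * form r (b ⊗ₜ 𝓡.right i) := by
  simp only [form_tmul, map_mul, 𝓡.convMul_apply]

lemma form_one_left (a : FRTAlgebra r) : form r (1 ⊗ₜ a) = counit a := by
  rw [form_tmul, map_one]
  rfl

/-- The multiplicativity step for the induction in `form_mul_right`. It is stated for arbitrary
tensors z and w, so that it applies to the product of two coproducts. -/
lemma form_mul_right_aux (b c : FRTAlgebra r)
    (z w : FRTAlgebra r ⊗[k] FRTAlgebra r) :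
    LinearMap.mul' k k (TensorProduct.map ((form r) ∘ₗ (TensorProduct.mk k _ _).flip c)
      ((form r) ∘ₗ (TensorProduct.mk k _ _).flip b) (z * w)) =
    ∑ j ∈ (ℛ k b).index, ∑ i ∈ (ℛ k c).index,
      LinearMap.mul' k k (TensorProduct.map
        ((form r) ∘ₗ (TensorProduct.mk k _ _).flip ((ℛ k c).left i))
        ((form r) ∘ₗ (TensorProduct.mk k _ _).flip ((ℛ k b).left j)) z) *
      LinearMap.mul' k k (TensorProduct.map
        ((form r) ∘ₗ (TensorProduct.mk k _ _).flip ((ℛ k c).right i))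
        ((form r) ∘ₗ (TensorProduct.mk k _ _).flip ((ℛ k b).right j)) w) := by
  induction z with
  | zero => simp
  | add x y hx hy => simp only [add_mul, map_add, hx, hy, Finset.sum_add_distrib]
  | tmul x y =>
    induction w with
    | zero => simp
    | add x y hx hy => simp only [mul_add, map_add, hx, hy, Finset.sum_add_distrib]
    | tmul x' y' =>
      simp only [Algebra.TensorProduct.tmul_mul_tmul, TensorProduct.map_tmul,
        LinearMap.comp_apply, LinearMap.flip_apply, TensorProduct.mk_apply, LinearMap.mul'_apply,
        form_mul_left, Finset.sum_mul_sum]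
      rw [Finset.sum_comm]
      refine Finset.sum_congr rfl fun _ _ => Finset.sum_congr rfl fun _ _ => ?_
      ring

/-- Multiplicativity in the left argument is built into r, so induction on a leaves the generators.
For X the identity is the multiplicativity of `rightHom`; for Y the order is reversed by the inverse
of the antipode. -/
lemma form_mul_right (a b c : FRTAlgebra r) : form r (a ⊗ₜ (b * c)) =
    LinearMap.mul' k k (TensorProduct.map ((form r) ∘ₗ (TensorProduct.mk k _ _).flip c)
      ((form r) ∘ₗ (TensorProduct.mk k _ _).flip b) (comul a)) := by
  induction a using FRTAlgebra.induction generalizing b c with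
  | hk x =>
    simp [Algebra.TensorProduct.one_def, Algebra.algebraMap_eq_smul_one,
      ← TensorProduct.smul_tmul', form_one_left, mul_comm]
  | hX i j => simp [form_X, Matrix.mul_apply, mul_comm]
  | hY i j => simp [form_Y, Matrix.mul_apply, antipodeInv_mul]
  | hadd x y hx hy => simp only [TensorProduct.add_tmul, map_add, hx, hy]
  | hmul x y hx hy =>
    rw [Bialgebra.comul_mul, form_mul_right_aux,
      form_mul_left_repr x y ((ℛ k b).mul (ℛ k c))]
    simp [hx, hy, Finset.sum_product]

end FRTAlgebra

end RMatrix

/-! ### Convolution algebras with values in an algebra -/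

section Convolution

open WithConv

variable (k C A : Type*) [Field k] [AddCommGroup C] [Module k C] [Coalgebra k C]
  [Ring A] [Algebra k A]

/-- Scalar valued linear forms as linear maps to the algebra. -/
def convScalar : WithConv (C →ₗ[k] k) →ₐ[k] WithConv (C →ₗ[k] A) :=
  .ofLinearMap
    { toFun f := toConv (Algebra.linearMap k A ∘ₗ f.ofConv)
      map_add' f g := by ext; simp
      map_smul' c f := WithConv.ext (LinearMap.ext fun x => by
        change algebraMap k A (c * f x) = c • algebraMap k A (f x)
        rw [map_mul, Algebra.smul_def]) }
    rfl
    (fun f g => congr(toConv $(LinearMap.algHom_comp_convMul_distrib (Algebra.ofId k A) f g)))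

/-- Elements of the algebra as linear maps via the counit. -/
def convConst : A →ₐ[k] WithConv (C →ₗ[k] A) :=
  .ofLinearMap
    { toFun a := toConv (LinearMap.toSpanSingleton k A a ∘ₗ counit)
      map_add' a b := by ext; simp
      map_smul' c a := WithConv.ext (LinearMap.ext fun x => smul_comm (counit (R := k) x) c a) }
    (WithConv.ext (LinearMap.ext fun x => (Algebra.algebraMap_eq_smul_one _).symm))
    (fun a b => by
      apply WithConv.ext
      ext x
      have h := congr(counit (R := k) $(sum_counit_smul (ℛ k x)))
      rw [(ℛ k x).convMul_apply]
      simp only [map_sum, map_smul, smul_eq_mul] at h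
      simp [smul_smul, ← Finset.sum_smul, h, mul_comm])

variable {k C A}

@[simp]
lemma convScalar_apply (f : WithConv (C →ₗ[k] k)) (x : C) :
    convScalar k C A f x = algebraMap k A (f x) := rfl

@[simp]
lemma convConst_apply (a : A) (x : C) :
    convConst k C A a x = counit (R := k) x • a := rfl

lemma convScalar_mul_convConst (f : WithConv (C →ₗ[k] k)) (a : A) (x : C) :
    (convScalar k C A f * convConst k C A a) x = f x • a := by
  have h := congr(TensorProduct.rid k C ($(sum_tmul_counit_eq (ℛ k x))))
  simp only [map_sum, TensorProduct.rid_tmul, one_smul] at h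
  have h' := congr(f $h)
  simp only [map_sum, map_smul, smul_eq_mul] at h'
  rw [(ℛ k x).convMul_apply, ← h', Finset.sum_smul]
  refine Finset.sum_congr rfl fun _ _ => ?_
  rw [convScalar_apply, convConst_apply, ← Algebra.smul_def, smul_smul, mul_comm]

lemma convConst_mul_convScalar (f : WithConv (C →ₗ[k] k)) (a : A) (x : C) :
    (convConst k C A a * convScalar k C A f) x = f x • a := by
  have h := congr(f $(sum_counit_smul (ℛ k x)))
  simp only [map_sum, map_smul, smul_eq_mul] at h
  rw [(ℛ k x).convMul_apply, ← h, Finset.sum_smul]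
  refine Finset.sum_congr rfl fun _ _ => ?_
  rw [convScalar_apply, convConst_apply, ← Algebra.commutes, ← Algebra.smul_def, smul_smul,
    mul_comm]

lemma convScalar_commute_convConst (f : WithConv (C →ₗ[k] k)) (a : A) :
    Commute (convScalar k C A f) (convConst k C A a) :=
  WithConv.ext (LinearMap.ext fun x =>
    (convScalar_mul_convConst f a x).trans (convConst_mul_convScalar f a x).symm)

end Convolution

/-! ### The commutation axiom and the antipode on the radical -/

namespace RMatrix

variable {k : Type*} [Field k] {ι : Type*} [Fintype ι] [DecidableEq ι] {r : RMatrix k ι}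

namespace FRTAlgebra

open WithConv HopfAlgebra

variable (r) in
/-- The homomorphism `x ⊗ y ↦ r (x ⊗ ·) y`. -/
def convHom : FRTAlgebra r ⊗[k] FRTAlgebra r →ₐ[k]
    WithConv (FRTAlgebra r →ₗ[k] FRTAlgebra r) :=
  Algebra.TensorProduct.lift ((convScalar k _ _).comp (formPoint r).lift) (convConst k _ _)
    fun _ _ => convScalar_commute_convConst _ _

lemma convHom_tmul (x y b : FRTAlgebra r) : convHom r (x ⊗ₜ y) b = form r (x ⊗ₜ b) • y := by
  have h : convHom r (x ⊗ₜ y) = convScalar k _ _ ((formPoint r).lift x) * convConst k _ _ y :=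
    Algebra.TensorProduct.lift_tmul _ _ _ x y
  rw [h, convScalar_mul_convConst]
  rfl

variable (r) in
/-- The homomorphism `b ↦ (r (X l i ⊗ b₍₁₎) b₍₂₎)_{i l}`. -/
def matHomLeft : FRTAlgebra r →ₐ[k] Matrix ι ι (FRTAlgebra r) :=
  (matrixEquivTensor ι k (FRTAlgebra r)).symm.toAlgHom.comp
    ((Algebra.TensorProduct.comm k _ _).toAlgHom.comp
      ((Algebra.TensorProduct.map (rightHom r) (AlgHom.id k _)).comp (Bialgebra.comulAlgHom k _)))

variable (r) in
/-- The homomorphism `b ↦ (b₍₁₎ r (X l i ⊗ b₍₂₎))_{i l}`. -/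
def matHomRight : FRTAlgebra r →ₐ[k] Matrix ι ι (FRTAlgebra r) :=
  (matrixEquivTensor ι k (FRTAlgebra r)).symm.toAlgHom.comp
      ((Algebra.TensorProduct.map (AlgHom.id k _) (rightHom r)).comp (Bialgebra.comulAlgHom k _))

lemma matHomLeft_apply {b : FRTAlgebra r} {κ : Type*} (𝓡 : Coalgebra.Repr k b κ) (l i : ι) :
    matHomLeft r b l i =
      ∑ j ∈ 𝓡.index, form r ((univ r).X i l ⊗ₜ 𝓡.left j) • 𝓡.right j := by
  have h : matHomLeft r b = (matrixEquivTensor ι k (FRTAlgebra r)).symm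
    (TensorProduct.comm k _ _
      (TensorProduct.map (rightHom r).toLinearMap LinearMap.id (comul b))) :=
    rfl
  rw [h, ← 𝓡.eq]
  simp [Matrix.sum_apply, form_X, matrixEquivTensor_apply_symm, Algebra.smul_def,
    Algebra.commutes]

lemma matHomRight_apply {b : FRTAlgebra r} {κ : Type*} (𝓡 : Coalgebra.Repr k b κ) (l i : ι) :
    matHomRight r b l i =
      ∑ j ∈ 𝓡.index, form r ((univ r).X i l ⊗ₜ 𝓡.right j) • 𝓡.left j := by
  have h : matHomRight r b = (matrixEquivTensor ι k (FRTAlgebra r)).symm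
    (TensorProduct.map LinearMap.id (rightHom r).toLinearMap (comul b)) :=
    rfl
  rw [h, ← 𝓡.eq]
  simp [Matrix.sum_apply, form_X, matrixEquivTensor_apply_symm, Algebra.smul_def,
    Algebra.commutes]

/-- The coproduct of the generators `X i j`. -/
@[simps]
def reprX (r : RMatrix k ι) (i j : ι) : Coalgebra.Repr k ((univ r).X i j) ι where
  index := Finset.univ
  left l := (univ r).X i l
  right l := (univ r).X l j
  eq := (comul_X i j).symm

/-- The commutation axiom r ⋆ ∇ = ∇ᵒᵖ ⋆ r with an entry of X in the first argument. For fixed first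
argument it is an intertwining property in b, and for b an entry of X it is the defining relation of
the FRT algebra. -/
lemma matHomRight_mul_transpose (b : FRTAlgebra r) :
    matHomRight r b * (univ r).X.transpose = (univ r).X.transpose * matHomLeft r b := by
  refine intertwine (fun p q => ?_) b
  ext j i
  have h := (rtt_iff _).1 (univ r).rtt i p j q
  simp only [Matrix.mul_apply, Matrix.transpose_apply, matHomRight_apply (reprX r p q),
    matHomLeft_apply (reprX r p q), reprX_index, reprX_left, reprX_right, form_X, rightHom_X,
    Finset.sum_mul, Finset.mul_sum, smul_mul_assoc, mul_smul_comm]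
  exact h.symm

/-- The homomorphism `a ↦ (b ↦ r (a₍₁₎ ⊗ b) a₍₂₎)`. -/
def commLeft (r : RMatrix k ι) : FRTAlgebra r →ₐ[k] WithConv (FRTAlgebra r →ₗ[k] FRTAlgebra r) :=
  (convHom r).comp (Bialgebra.comulAlgHom k _)

/-- The homomorphism `a ↦ (b ↦ r (a₍₂₎ ⊗ b) a₍₁₎)`. -/
def commRight (r : RMatrix k ι) : FRTAlgebra r →ₐ[k] WithConv (FRTAlgebra r →ₗ[k] FRTAlgebra r) :=
  (convHom r).comp ((Algebra.TensorProduct.comm k _ _).toAlgHom.comp (Bialgebra.comulAlgHom k _))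

lemma commLeft_apply {a : FRTAlgebra r} {κ : Type*} (𝓡 : Coalgebra.Repr k a κ)
    (b : FRTAlgebra r) : commLeft r a b = ∑ i ∈ 𝓡.index, form r (𝓡.left i ⊗ₜ b) • 𝓡.right i := by
  have h : commLeft r a = convHom r (comul a) := rfl
  rw [h, ← 𝓡.eq]
  simp [convHom_tmul]

lemma commRight_apply {a : FRTAlgebra r} {κ : Type*} (𝓡 : Coalgebra.Repr k a κ)
    (b : FRTAlgebra r) : commRight r a b = ∑ i ∈ 𝓡.index, form r (𝓡.right i ⊗ₜ b) • 𝓡.left i := by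
  have h : commRight r a = convHom r (TensorProduct.comm k _ _ (comul a)) := rfl
  rw [h, ← 𝓡.eq]
  simp [convHom_tmul]

/-- The commutation axiom for all first arguments: in the convolution algebra of endomorphisms the
identity map intertwines `commLeft` and `commRight`, and the preceding case covers the generators.
-/
lemma commLeft_mul_id (a : FRTAlgebra r) :
    commLeft r a * toConv LinearMap.id = toConv LinearMap.id * commRight r a := by
  refine intertwine (fun i j => WithConv.ext (LinearMap.ext fun b => ?_)) a
  have h := congr($(matHomRight_mul_transpose b) j i)
  simp only [Matrix.mul_apply, matHomRight_apply (ℛ k b), matHomLeft_apply (ℛ k b),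
    Matrix.transpose_apply, Finset.sum_mul, Finset.mul_sum] at h
  rw [(ℛ k b).convMul_apply, (ℛ k b).convMul_apply]
  simp only [commLeft_apply (reprX r i j), commRight_apply (reprX r i j), reprX_index, reprX_left,
    reprX_right, Finset.sum_mul, Finset.mul_sum, LinearMap.id_apply]
  rw [Finset.sum_comm, Finset.sum_comm (t := Finset.univ), eq_comm]
  simpa only [smul_mul_assoc, mul_smul_comm] using h

lemma convOne_tmul (a b : FRTAlgebra r) :
    (1 : WithConv (FRTAlgebra r ⊗[k] FRTAlgebra r →ₗ[k] k)) (a ⊗ₜ b) =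
      counit (R := k) a * counit (R := k) b := by
  simp [mul_comm]

lemma form_mul_antipode : toConv (form r) *
    toConv (form r ∘ₗ (antipode k (A := FRTAlgebra r)).rTensor _) = 1 := by
  apply ofConv_injective
  refine TensorProduct.ext' fun a b => ?_
  refine Eq.trans ?_ (convOne_tmul a b).symm
  rw [((ℛ k a).tmul (ℛ k b)).convMul_apply]
  have h := congr(form r ($(sum_mul_antipode_eq_algebraMap_counit (ℛ k a)) ⊗ₜ b))
  simp only [TensorProduct.sum_tmul, map_sum, form_mul_left] at h
  simp [Finset.sum_product, h, Algebra.algebraMap_eq_smul_one, ← TensorProduct.smul_tmul',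
    form_one_left]

lemma form_antipode_mul : toConv (form r ∘ₗ (antipode k (A := FRTAlgebra r)).rTensor _) *
    toConv (form r) = 1 := by
  apply ofConv_injective
  refine TensorProduct.ext' fun a b => ?_
  refine Eq.trans ?_ (convOne_tmul a b).symm
  rw [((ℛ k a).tmul (ℛ k b)).convMul_apply]
  have h := congr(form r ($(sum_antipode_mul_eq_algebraMap_counit (ℛ k a)) ⊗ₜ b))
  simp only [TensorProduct.sum_tmul, map_sum, form_mul_left] at h
  simp [Finset.sum_product, h, Algebra.algebraMap_eq_smul_one, ← TensorProduct.smul_tmul',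
    form_one_left]

lemma isCoquasitriangular_form (r : RMatrix k ι) : IsCoquasitriangular (form r) := by
  refine IsCoquasitriangular.of_apply _ form_mul_antipode form_antipode_mul ?_ form_mul_left ?_
  · intro a b
    have h := congr(($(commLeft_mul_id a)).ofConv b)
    rw [(ℛ k b).convMul_apply, (ℛ k b).convMul_apply] at h
    simp only [commLeft_apply (ℛ k a), commRight_apply (ℛ k a), Finset.sum_mul, Finset.mul_sum,
      smul_mul_assoc, mul_smul_comm] at h
    rw [Finset.sum_comm, Finset.sum_comm (s := (ℛ k a).index)]
    exact h
  · intro a b c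
    rw [form_mul_right, ← (ℛ k a).eq]
    simp

lemma form_mul_antipodeInv :
    toConv (form r) * toConv (form r ∘ₗ (antipodeInv r).lTensor _) = 1 := by
  apply ofConv_injective
  refine TensorProduct.ext' fun a b => ?_
  refine Eq.trans ?_ (convOne_tmul a b).symm
  rw [((ℛ k a).tmul (ℛ k b)).convMul_apply]
  have h := congr(form r (a ⊗ₜ $(sum_antipodeInv_mul b)))
  simp only [TensorProduct.tmul_sum, map_sum, (isCoquasitriangular_form r).apply_mul_right] at h
  rw [Finset.sum_comm] at h
  simp [Finset.sum_product, h, Algebra.algebraMap_eq_smul_one,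
    (isCoquasitriangular_form r).apply_one_right, mul_comm]

/-- Both r(S ⊗ id) and r(id ⊗ S⁻¹) are convolution inverse to r, so they coincide. -/
lemma form_antipode_antipode (a b : FRTAlgebra r) :
    form r (antipode k a ⊗ₜ antipode k b) = form r (a ⊗ₜ b) := by
  have h := left_inv_eq_right_inv (form_antipode_mul (r := r)) form_mul_antipodeInv
  simpa using congr(($h).ofConv (a ⊗ₜ antipode k b))

/-- Writing x as S(S⁻¹(x)) gives r(x ⊗ S(h)) = r(S⁻¹(x) ⊗ h). Thus the radical is a Hopf ideal and
the reduced quotient has an antipode. -/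
lemma antipode_mem_rightRadical {h : FRTAlgebra r}
    (hh : h ∈ rightRadical (isCoquasitriangular_form r)) :
    antipode k h ∈ rightRadical (isCoquasitriangular_form r) := by
  intro x
  rw [← antipode_antipodeInv x, form_antipode_antipode]
  exact hh _

instance : (rightRadical (isCoquasitriangular_form r)).IsHopfIdeal k where
  antipode_mem _ := antipode_mem_rightRadical

end FRTAlgebra

end RMatrix

/-! ### Structure constants of a rigid braiding -/

section Basis

open Module

variable {k : Type*} [Field k] {ι : Type*} [Fintype ι] [DecidableEq ι]
  {M : Type*} [AddCommGroup M] [Module k M]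

lemma repr_map_apply {κ κ' V V' : Type*} [Fintype κ] [AddCommMonoid V] [Module k V]
    [AddCommMonoid V'] [Module k V'] (b : Basis κ k V) (b' : Basis κ' k V') (f : V →ₗ[k] V') (x : V)
    (q : κ') : b'.repr (f x) q = ∑ p, b.repr x p * b'.repr (f (b p)) q := by
  conv_lhs => rw [← b.sum_repr x]
  simp only [map_sum, map_smul, Finsupp.finsetSum_apply, Finsupp.smul_apply, smul_eq_mul]

/-- The tensor does not depend on the basis: it corresponds to the identity endomorphism of M. -/
lemma coevaluation_apply_one_eq [FiniteDimensional k M] (e : Basis ι k M) :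
    coevaluation k M 1 = ∑ i, e i ⊗ₜ e.coord i := by
  rw [coevaluation_apply_one]
  apply (TensorProduct.comm k _ _).injective
  apply (dualTensorHomEquivOfBasis e).injective
  ext m
  simp only [map_sum, TensorProduct.comm_tmul, dualTensorHomEquivOfBasis_apply,
    LinearMap.sum_apply, dualTensorHom_apply, Basis.coord_apply, Basis.sum_repr]

variable (c : M ⊗[k] M ≃ₗ[k] M ⊗[k] M) (e : Basis ι k M)

/-- The coefficients of a braiding. -/
def coeff (i j a b : ι) : k := (e.tensorProduct e).repr (c (e i ⊗ₜ e j)) (a, b)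

omit [DecidableEq ι] in
lemma apply_tmul_eq_sum (i j : ι) :
    c (e i ⊗ₜ e j) = ∑ a, ∑ b, coeff c e i j a b • (e a ⊗ₜ e b) := by
  conv_lhs => rw [← (e.tensorProduct e).sum_repr (c (e i ⊗ₜ e j))]
  simp only [Fintype.sum_prod_type, coeff, Basis.tensorProduct_apply]

lemma flat_tmul_eq_sum [FiniteDimensional k M] (a i : ι) :
    flat c (e.coord a ⊗ₜ e i) = ∑ s, ∑ l, coeff c e i s a l • (e l ⊗ₜ e.coord s) := by
  simp [flat, coevaluation_apply_one_eq e, apply_tmul_eq_sum, tmul_sum, sum_tmul, ← smul_tmul',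
    Finsupp.single_apply]

lemma repr_flat [FiniteDimensional k M] (a i l s : ι) :
    (e.tensorProduct e.dualBasis).repr (flat c (e.coord a ⊗ₜ e i)) (l, s) =
      coeff c e i s a l := by
  have h (x y : ι) : (e.tensorProduct e.dualBasis).repr (e x ⊗ₜ e.coord y) (l, s) =
      if x = l then if y = s then 1 else 0 else 0 := by
    rw [← Basis.coe_dualBasis]
    simp [Finsupp.single_apply, eq_comm]
  simp only [flat_tmul_eq_sum, map_sum, map_smul, Finsupp.finsetSum_apply, Finsupp.smul_apply, h]
  simp

/-- Both sides are coefficients of e j ⊗ e l' ⊗ e n, in the two sides of the braid equation applied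
to e m ⊗ e l ⊗ e i. -/
lemma sum_coeff_braid (hc : IsBraiding c) (i l m j l' n : ι) :
    ∑ a, ∑ b, ∑ p, coeff c e l i a b * coeff c e m a j p * coeff c e p b l' n =
      ∑ a, ∑ b, ∑ p, coeff c e m l b p * coeff c e p i a n * coeff c e b a j l' := by
  let c₂₃ : M ⊗[k] (M ⊗[k] M) →ₗ[k] M ⊗[k] (M ⊗[k] M) := (c : M ⊗[k] M →ₗ[k] M ⊗[k] M).lTensor M
  let c₁₂ : M ⊗[k] (M ⊗[k] M) →ₗ[k] M ⊗[k] (M ⊗[k] M) :=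
    (TensorProduct.assoc k M M M).toLinearMap ∘ₗ
      (c : M ⊗[k] M →ₗ[k] M ⊗[k] M).rTensor M ∘ₗ
      (TensorProduct.assoc k M M M).symm.toLinearMap
  let φ := (e.tensorProduct (e.tensorProduct e)).coord (j, (l', n))
  have hφ (x y z : ι) : φ (e x ⊗ₜ (e y ⊗ₜ e z)) =
      (if x = j then 1 else 0) * ((if y = l' then 1 else 0) * (if z = n then 1 else 0)) := by
    simp only [φ, Basis.coord_apply, Basis.tensorProduct_repr_tmul_apply, Basis.repr_self,
      Finsupp.single_apply, smul_eq_mul]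
    ring
  have h₂₃ (x y z : ι) : c₂₃ (e x ⊗ₜ (e y ⊗ₜ e z)) =
      ∑ a, ∑ b, coeff c e y z a b • e x ⊗ₜ (e a ⊗ₜ e b) := by
    simp [c₂₃, apply_tmul_eq_sum, tmul_sum]
  have h₁₂ (x y z : ι) : c₁₂ (e x ⊗ₜ (e y ⊗ₜ e z)) =
      ∑ a, ∑ b, coeff c e x y a b • e a ⊗ₜ (e b ⊗ₜ e z) := by
    simp [c₁₂, apply_tmul_eq_sum, sum_tmul, ← smul_tmul']
  have h₂₃' (x y z : ι) : φ (c₂₃ (e x ⊗ₜ (e y ⊗ₜ e z))) =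
      if x = j then coeff c e y z l' n else 0 := by
    simp [h₂₃, hφ]
  have h₁₂' (x y z : ι) : φ (c₁₂ (e x ⊗ₜ (e y ⊗ₜ e z))) =
      if z = n then coeff c e x y j l' else 0 := by
    simp [h₁₂, hφ]
  have h := congr(φ ($hc (e m ⊗ₜ (e l ⊗ₜ e i))))
  change φ (c₂₃ (c₁₂ (c₂₃ _))) = φ (c₁₂ (c₂₃ (c₁₂ _))) at h
  have hL : φ (c₂₃ (c₁₂ (c₂₃ (e m ⊗ₜ (e l ⊗ₜ e i))))) =
      ∑ a, ∑ b, ∑ p, coeff c e l i a b * coeff c e m a j p * coeff c e p b l' n := by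
    rw [h₂₃]
    simp only [map_sum, map_smul]
    simp only [h₁₂, map_sum, map_smul]
    simp only [h₂₃', smul_eq_mul, mul_ite, mul_zero, Finset.mul_sum, mul_assoc]
    refine Finset.sum_congr rfl fun a _ => Finset.sum_congr rfl fun b _ => ?_
    rw [Finset.sum_comm]
    simp
  have hR : φ (c₁₂ (c₂₃ (c₁₂ (e m ⊗ₜ (e l ⊗ₜ e i))))) =
      ∑ a, ∑ b, ∑ p, coeff c e m l b p * coeff c e p i a n * coeff c e b a j l' := by
    rw [h₁₂]
    simp only [map_sum, map_smul]
    simp only [h₂₃, map_sum, map_smul]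
    simp only [h₁₂', smul_eq_mul, mul_ite, mul_zero, Finset.mul_sum, mul_assoc, Finset.sum_ite_eq',
      Finset.mem_univ, if_true]
    symm
    rw [Finset.sum_comm]
    exact Finset.sum_congr rfl fun _ _ => Finset.sum_comm
  rw [← hL, ← hR, h]

variable [FiniteDimensional k M]

/-- The structure constants of a rigid braiding. -/
def RMatrix.ofBraiding (hc : IsRigidBraiding c) : RMatrix k ι where
  -- The first two indices are interchanged, so R is c composed with the flip and the braid equation
  -- becomes the Yang-Baxter equation. The matrix of c♭ is a partial transpose of R, so N below
  -- consists of the coefficients of the inverse of c♭.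
  R i l a b := coeff c e l i a b
  Ri i l a b := coeff c.symm e i l b a
  N i l a b := (e.dualBasis.tensorProduct e).repr
    ((LinearEquiv.ofBijective _ hc.rigid).symm (e l ⊗ₜ e.coord a)) (i, b)
  mul_inv i l m n := by
    have h := repr_map_apply (e.tensorProduct e) (e.tensorProduct e) c.symm.toLinearMap
      (c (e l ⊗ₜ e i)) (n, m)
    simp only [LinearEquiv.coe_coe, LinearEquiv.symm_apply_apply, Fintype.sum_prod_type,
      Basis.tensorProduct_repr_tmul_apply, Basis.repr_self, Finsupp.single_apply, smul_eq_mul,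
      Basis.tensorProduct_apply] at h
    simp only [coeff]
    rw [← h]
    by_cases h1 : i = m <;> by_cases h2 : l = n <;> simp [h1, h2]
  inv_mul i l m n := by
    have h := repr_map_apply (e.tensorProduct e) (e.tensorProduct e) c.toLinearMap
      (c.symm (e i ⊗ₜ e l)) (m, n)
    simp only [LinearEquiv.coe_coe, LinearEquiv.apply_symm_apply, Fintype.sum_prod_type,
      Basis.tensorProduct_repr_tmul_apply, Basis.repr_self, Finsupp.single_apply, smul_eq_mul,
      Basis.tensorProduct_apply] at h
    simp only [coeff]
    rw [Finset.sum_comm, ← h]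
    by_cases h1 : i = m <;> by_cases h2 : l = n <;> simp [h1, h2]
  mul_skew s l s' l' := by
    have h := repr_map_apply (e.dualBasis.tensorProduct e) (e.tensorProduct e.dualBasis) (flat c)
      ((LinearEquiv.ofBijective _ hc.rigid).symm (e l' ⊗ₜ e.coord s')) (l, s)
    have h' := (LinearEquiv.ofBijective _ hc.rigid).apply_symm_apply (e l' ⊗ₜ e.coord s')
    rw [LinearEquiv.ofBijective_apply] at h'
    rw [h'] at h
    have hd : e.dualBasis.repr (e.coord s') s = if s' = s then 1 else 0 := by
      rw [← Basis.coe_dualBasis, Basis.repr_self, Finsupp.single_apply]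
    simp only [hd, Fintype.sum_prod_type, Basis.tensorProduct_apply, Basis.coe_dualBasis,
      repr_flat, Basis.tensorProduct_repr_tmul_apply, Basis.repr_self, Finsupp.single_apply,
      smul_eq_mul] at h
    simp only [mul_comm (coeff c e _ _ _ _)]
    rw [← h]
    by_cases h1 : s = s' <;> by_cases h2 : l = l' <;> simp [h1, h2, Ne.symm]
  skew_mul s i s' i' := by
    have h := repr_map_apply (e.tensorProduct e.dualBasis) (e.dualBasis.tensorProduct e)
      (LinearEquiv.ofBijective _ hc.rigid).symm.toLinearMap (flat c (e.dualBasis s' ⊗ₜ e i')) (s, i)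
    have h' := (LinearEquiv.ofBijective _ hc.rigid).symm_apply_apply (e.dualBasis s' ⊗ₜ e i')
    rw [LinearEquiv.ofBijective_apply] at h'
    rw [LinearEquiv.coe_coe, h'] at h
    simp only [Fintype.sum_prod_type, Basis.tensorProduct_apply, Basis.coe_dualBasis,
      repr_flat, Basis.tensorProduct_repr_tmul_apply, Basis.repr_self, Finsupp.single_apply,
      smul_eq_mul] at h
    simp only [mul_comm _ (coeff c e _ _ _ _)]
    rw [Finset.sum_comm, ← h]
    by_cases h1 : s = s' <;> by_cases h2 : i = i' <;> simp [h1, h2, Ne.symm]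
  ybe := sum_coeff_braid c e hc.braid

end Basis

/-! ### Comodules and Yetter-Drinfeld modules in coordinates -/

section Comodule

open Module

variable {k : Type*} [Field k] {ι : Type*} [Fintype ι]
  {M : Type*} [AddCommGroup M] [Module k M] {e : Basis ι k M}

/-- The coefficient of an element of `H ⊗ M` with respect to a basis of `M`. -/
def rightCoord {H : Type*} [AddCommGroup H] [Module k H] (e : Basis ι k M) (j : ι) :
    H ⊗[k] M →ₗ[k] H :=
  (TensorProduct.rid k H).toLinearMap ∘ₗ (e.coord j).lTensor H

omit [Fintype ι] in
@[simp]
lemma rightCoord_tmul {H : Type*} [AddCommGroup H] [Module k H] (j : ι) (x : H) (m : M) :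
    rightCoord e j (x ⊗ₜ m) = e.repr m j • x := by
  simp [rightCoord]

lemma sum_rightCoord {H : Type*} [AddCommGroup H] [Module k H] (z : H ⊗[k] M) :
    ∑ j, rightCoord e j z ⊗ₜ[k] e j = z := by
  induction z with
  | zero => simp
  | add x y hx hy =>
    simp only [map_add, add_tmul, Finset.sum_add_distrib, hx, hy]
  | tmul x m =>
    simp only [rightCoord_tmul, smul_tmul, ← tmul_sum, e.sum_repr]

lemma rightCoord_sum {H : Type*} [AddCommGroup H] [Module k H] [DecidableEq ι] (x : ι → H) (j : ι) :
    rightCoord e j (∑ i, x i ⊗ₜ[k] e i) = x j := by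
  simp [Finsupp.single_apply]

lemma ext_rightCoord {H : Type*} [AddCommGroup H] [Module k H] {z z' : H ⊗[k] M}
    (h : ∀ j, rightCoord e j z = rightCoord e j z') : z = z' := by
  rw [← sum_rightCoord (e := e) z, ← sum_rightCoord (e := e) z']
  simp only [h]

section Coalgebra

variable {H : Type*} [AddCommGroup H] [Module k H] [Coalgebra k H]

/-- The matrix of coefficients of a comodule. -/
def LeftComodule.mat (V : LeftComodule k H M) (e : Basis ι k M) : Matrix ι ι H :=
  .of fun i j => rightCoord e j (V.coact (e i))

lemma LeftComodule.coact_basis (V : LeftComodule k H M) (i : ι) :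
    V.coact (e i) = ∑ j, V.mat e i j ⊗ₜ e j :=
  (sum_rightCoord _).symm

lemma LeftComodule.comul_mat (V : LeftComodule k H M) (i j : ι) :
    comul (V.mat e i j) = ∑ l, V.mat e i l ⊗ₜ[k] V.mat e l j := by
  classical
  have h := congr((TensorProduct.assoc k H H M).symm ($V.coassoc (e i)))
  simp only [LinearMap.comp_apply, V.coact_basis, map_sum, LinearMap.lTensor_tmul,
    LinearMap.rTensor_tmul, LinearEquiv.coe_coe, LinearEquiv.symm_apply_apply, tmul_sum,
    TensorProduct.assoc_symm_tmul] at h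
  rw [Finset.sum_comm] at h
  simp only [← sum_tmul] at h
  simpa only [rightCoord_sum] using congr(rightCoord e j $h)

lemma LeftComodule.counit_mat [DecidableEq ι] (V : LeftComodule k H M) (i j : ι) :
    counit (R := k) (V.mat e i j) = (1 : Matrix ι ι k) i j := by
  have h := congr(e.repr ($V.counit_coact (e i)) j)
  simpa [V.coact_basis, Finsupp.single_apply, Matrix.one_apply] using h

/-- The coproduct of the coefficients of a comodule. -/
@[simps]
def LeftComodule.reprMat (V : LeftComodule k H M) (e : Basis ι k M) (i j : ι) :
    Coalgebra.Repr k (V.mat e i j) ι where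
  index := Finset.univ
  left l := V.mat e i l
  right l := V.mat e l j
  eq := (V.comul_mat i j).symm

/-- The comodule with a given matrix of coefficients. -/
def LeftComodule.ofMatrix [DecidableEq ι] (e : Basis ι k M) (T : Matrix ι ι H)
    (h₁ : ∀ i j, comul (T i j) = ∑ l, T i l ⊗ₜ[k] T l j)
    (h₂ : ∀ i j, counit (R := k) (T i j) = (1 : Matrix ι ι k) i j) : LeftComodule k H M where
  coact := e.constr k fun i => ∑ j, T i j ⊗ₜ e j
  coassoc := e.ext fun i => by
    simp only [LinearMap.comp_apply, Basis.constr_basis, map_sum, LinearMap.rTensor_tmul, h₁,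
      LinearMap.lTensor_tmul, sum_tmul, LinearEquiv.coe_coe, TensorProduct.assoc_tmul, tmul_sum]
    exact Finset.sum_comm
  counit_coact := e.ext fun i => by
    simp [h₂, Matrix.one_apply]

lemma LeftComodule.ofMatrix_coact [DecidableEq ι] (T : Matrix ι ι H)
    (h₁ : ∀ i j, comul (T i j) = ∑ l, T i l ⊗ₜ[k] T l j)
    (h₂ : ∀ i j, counit (R := k) (T i j) = (1 : Matrix ι ι k) i j) (i : ι) :
    (LeftComodule.ofMatrix e T h₁ h₂).coact (e i) = ∑ j, T i j ⊗ₜ e j :=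
  e.constr_basis _ _ _

lemma LeftComodule.mat_ofMatrix [DecidableEq ι] (T : Matrix ι ι H)
    (h₁ : ∀ i j, comul (T i j) = ∑ l, T i l ⊗ₜ[k] T l j)
    (h₂ : ∀ i j, counit (R := k) (T i j) = (1 : Matrix ι ι k) i j) :
    (LeftComodule.ofMatrix e T h₁ h₂).mat e = T := by
  ext i j
  rw [LeftComodule.mat, Matrix.of_apply, ofMatrix_coact, rightCoord_sum]

end Coalgebra

section Bialgebra

variable {H : Type*} [Ring H] [Bialgebra k H] (V : LeftComodule k H M)

lemma cqtAction_basis (r : H ⊗[k] H →ₗ[k] k) (h : H) (i : ι) :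
    cqtAction r V.coact (h ⊗ₜ e i) = ∑ j, r (V.mat e i j ⊗ₜ h) • e j := by
  simp [cqtAction, V.coact_basis, tmul_sum]

lemma cqtBraiding_basis (r : H ⊗[k] H →ₗ[k] k) (i i' : ι) :
    cqtBraiding r V.coact (e i ⊗ₜ e i') =
      ∑ a, ∑ b, r (V.mat e i' a ⊗ₜ V.mat e i b) • (e a ⊗ₜ e b) := by
  simp only [cqtBraiding, V.coact_basis, LinearMap.comp_apply, map_tmul, tmul_sum, sum_tmul,
    map_sum, LinearEquiv.coe_coe, tensorTensorTensorComm_tmul, TensorProduct.comm_tmul, lid_tmul]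

lemma YetterDrinfeld.braiding_basis (V : YetterDrinfeld k H M) (i : ι) (m : M) :
    V.braiding (e i ⊗ₜ m) = ∑ j, V.act (V.mat e i j) m ⊗ₜ e j := by
  simp [YetterDrinfeld.braiding, V.coact_basis, sum_tmul]

variable {r : H ⊗[k] H →ₗ[k] k} (hr : IsCoquasitriangular r)

/-- The action of a coquasitriangular bialgebra on a comodule. -/
def cqtAct [FiniteDimensional k M] : H →ₐ[k] Module.End k M :=
  .ofLinearMap (TensorProduct.curry (cqtAction r V.coact))
    ((finBasis k M).ext fun i => by
      simp [cqtAction_basis, hr.apply_one_right, V.counit_mat, Matrix.one_apply])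
    (fun a b => (finBasis k M).ext fun i => by
      simp [cqtAction_basis, hr.apply_mul_right_repr _ _ (V.reprMat (finBasis k M) i _),
        Finset.sum_smul, Finset.smul_sum, smul_smul]
      rw [Finset.sum_comm])

variable [FiniteDimensional k M]

lemma cqtAct_apply (h : H) (m : M) : cqtAct V hr h m = cqtAction r V.coact (h ⊗ₜ m) := rfl

/-- The Yetter-Drinfeld module structure on a comodule over a coquasitriangular bialgebra. -/
def cqtYetterDrinfeld : YetterDrinfeld k H M where
  toLeftComodule := V
  act := cqtAct V hr
  compat := by
    classical
    refine TensorProduct.ext ?_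
    refine LinearMap.ext fun h => (finBasis k M).ext fun i => ?_
    refine ext_rightCoord (e := finBasis k M) fun j => ?_
    -- In coordinates the Yetter-Drinfeld condition is the commutation relation between h and a
    -- matrix coefficient.
    have := hr.mul_comm (V.reprMat (finBasis k M) i j) (ℛ k h)
    simp [← (ℛ k h).eq, sum_tmul, tmul_sum, V.coact_basis, cqtAct_apply, cqtAction_basis,
      ← smul_tmul', Finsupp.single_apply]
    rw [Finset.sum_comm, Finset.sum_comm (s := Finset.univ)]
    simpa [Finset.sum_comm (s := Finset.univ)] using this

lemma cqtYetterDrinfeld_braiding :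
    (cqtYetterDrinfeld V hr).braiding = cqtBraiding r V.coact := by
  refine TensorProduct.ext ((finBasis k M).ext fun i => (finBasis k M).ext fun j => ?_)
  change (cqtYetterDrinfeld V hr).braiding (finBasis k M i ⊗ₜ finBasis k M j) =
    cqtBraiding r V.coact (finBasis k M i ⊗ₜ finBasis k M j)
  rw [YetterDrinfeld.braiding_basis, cqtBraiding_basis]
  change ∑ l, cqtAct V hr (V.mat _ i l) _ ⊗ₜ _ = _
  simp only [cqtAct_apply, cqtAction_basis, sum_tmul, smul_tmul']
  rw [Finset.sum_comm]

end Bialgebra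

end Comodule

open Module

/-! ### The universal property of the FRT algebra -/

section Comatrix

variable {k : Type*} [Field k] {ι : Type*} [Fintype ι] [DecidableEq ι]
  {M : Type*} [AddCommGroup M] [Module k M]
  {B : Type*} [Ring B] [HopfAlgebra k B] (V : LeftComodule k B M) (e : Basis ι k M)

lemma LeftComodule.mat_mul_map_antipode :
    V.mat e * (V.mat e).map (HopfAlgebra.antipode k) = 1 := by
  ext i j
  have h := HopfAlgebra.sum_mul_antipode_eq_algebraMap_counit (V.reprMat e i j)
  rw [V.counit_mat] at h
  simpa [Matrix.mul_apply, Matrix.one_apply, apply_ite] using h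

lemma LeftComodule.map_antipode_mul_mat :
    (V.mat e).map (HopfAlgebra.antipode k) * V.mat e = 1 := by
  ext i j
  have h := HopfAlgebra.sum_antipode_mul_eq_algebraMap_counit (V.reprMat e i j)
  rw [V.counit_mat] at h
  simpa [Matrix.mul_apply, Matrix.one_apply, apply_ite] using h

end Comatrix

section Universal

variable {k : Type*} [Field k] {ι : Type*} [Fintype ι] [DecidableEq ι]
  {M : Type*} [AddCommGroup M] [Module k M] [FiniteDimensional k M]
  {c : M ⊗[k] M ≃ₗ[k] M ⊗[k] M} (e : Basis ι k M) (hc : IsRigidBraiding c)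

omit [FiniteDimensional k M] in
lemma YetterDrinfeld.act_mat {B : Type*} [Ring B] [Bialgebra k B] {V : YetterDrinfeld k B M}
    (hV : V.braiding = c) (i l j : ι) :
    V.act (V.mat e i j) (e l) = ∑ a, coeff c e i l a j • e a := by
  have h := congr(rightCoord e j ($hV (e i ⊗ₜ e l)))
  rw [YetterDrinfeld.braiding_basis, LinearEquiv.coe_coe, apply_tmul_eq_sum c e,
    rightCoord_sum] at h
  simpa [Finsupp.single_apply] using h

-- The Yetter-Drinfeld condition for h a matrix coefficient is the relation of the FRT algebra,
-- because these coefficients act by the coefficients of c.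
omit [FiniteDimensional k M] in
lemma YetterDrinfeld.compat_mat {B : Type*} [Ring B] [Bialgebra k B] {V : YetterDrinfeld k B M}
    (hV : V.braiding = c) (i l j m : ι) :
    ∑ a, ∑ b, coeff c e l i a b • (V.mat e a j * V.mat e b m) =
      ∑ a, ∑ b, coeff c e b a j m • (V.mat e l b * V.mat e i a) := by
  have h := congr(rightCoord e j ($V.compat (V.mat e l m ⊗ₜ e i)))
  simp [V.comul_mat, sum_tmul, tmul_sum, V.coact_basis, act_mat e hV, ← smul_tmul',
    Finsupp.single_apply] at h
  rw [Finset.sum_comm]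
  exact h

/-- The point of a Hopf algebra that is given by a Yetter-Drinfeld module. -/
@[simps X Y]
def YetterDrinfeld.point {B : Type*} [Ring B] [HopfAlgebra k B] {V : YetterDrinfeld k B M}
    (hV : V.braiding = c) : (RMatrix.ofBraiding c e hc).Point B where
  X := V.mat e
  Y := (V.mat e).map (HopfAlgebra.antipode k)
  mul_inv := V.mat_mul_map_antipode e
  inv_mul := V.map_antipode_mul_mat e
  rtt := (RMatrix.rtt_iff _).2 (V.compat_mat e hV)

namespace RMatrix.FRTAlgebra

/-- The coaction of the FRT algebra. -/
def comodule : LeftComodule k (FRTAlgebra (ofBraiding c e hc)) M :=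
  .ofMatrix e (univ _).X comul_X counit_X

@[simp]
lemma mat_comodule : (comodule e hc).mat e = (univ _).X := LeftComodule.mat_ofMatrix _ _ _

lemma form_X_X (i j a b : ι) : form (ofBraiding c e hc) ((univ _).X i j ⊗ₜ (univ _).X a b) =
    coeff c e a i j b := by
  rw [form_X, rightHom_X]
  rfl

lemma cqtBraiding_comodule :
    cqtBraiding (form (ofBraiding c e hc)) (comodule e hc).coact = c := by
  refine TensorProduct.ext (e.ext fun i => e.ext fun j => ?_)
  change cqtBraiding _ _ (e i ⊗ₜ e j) = c (e i ⊗ₜ e j)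
  rw [cqtBraiding_basis, apply_tmul_eq_sum c e]
  simp only [mat_comodule, form_X_X]

variable {B : Type*} [Ring B] [HopfAlgebra k B] {V : YetterDrinfeld k B M}

/-- The homomorphism given by a Yetter-Drinfeld module. -/
def toHopf (hV : V.braiding = c) : FRTAlgebra (ofBraiding c e hc) →ₐc[k] B :=
  .ofAlgHom (V.point e hc hV).lift
    (hom_ext fun i j => by simp [V.counit_mat])
    (hom_ext fun i j => by simp [V.comul_mat])

lemma toHopf_X (hV : V.braiding = c) (i j : ι) :
    toHopf e hc hV ((univ _).X i j) = V.mat e i j := by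
  exact (V.point e hc hV).lift_X i j

/-- Compatibility with the coactions prescribes the values on X, which generate enough to give
uniqueness. -/
lemma rTensor_comodule (f : FRTAlgebra (ofBraiding c e hc) →ₗ[k] B) :
    f.rTensor M ∘ₗ (comodule e hc).coact = V.coact ↔
      ∀ i j, f ((univ _).X i j) = V.mat e i j := by
  refine ⟨fun h i j => ?_, fun h => e.ext fun i => ?_⟩
  · have := congr(rightCoord e j ($h (e i)))
    simpa [LeftComodule.coact_basis, Finsupp.single_apply] using this
  · simp [LeftComodule.coact_basis, h]

/-- Both actions are algebra maps to End M, and on the entries of X both are given by the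
coefficients of c. -/
lemma cqtAction_comodule (hV : V.braiding = c) (h : FRTAlgebra (ofBraiding c e hc)) (m : M) :
    cqtAction (form _) (comodule e hc).coact (h ⊗ₜ m) = V.act (toHopf e hc hV h) m := by
  have : cqtAct (comodule e hc) (isCoquasitriangular_form _) =
      V.act.comp (toHopf e hc hV : FRTAlgebra (ofBraiding c e hc) →ₐ[k] B) := by
    refine hom_ext fun i j => e.ext fun l => ?_
    change cqtAction (form (ofBraiding c e hc)) (comodule e hc).coact (_ ⊗ₜ e l) =
      V.act (toHopf e hc hV _) _
    rw [toHopf_X, YetterDrinfeld.act_mat e hV, cqtAction_basis]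
    simp [form_X_X]
  exact congr($this h m)

end RMatrix.FRTAlgebra

end Universal

open RMatrix FRTAlgebra in
/-- The FRT Hopf algebra of a rigid braiding. -/
def frtHopfAlgebra {k : Type u} [Field k] {M : Type v} [AddCommGroup M] [Module k M]
    [FiniteDimensional k M] {c : M ⊗[k] M ≃ₗ[k] M ⊗[k] M} (hc : IsRigidBraiding c)
    {ι : Type (max v w)} [Fintype ι] [DecidableEq ι] (e : Basis ι k M) :
    FRTHopfAlgebra.{u, v, w} k M c where
  carrier := FRTAlgebra (ofBraiding c e hc)
  comodule := comodule e hc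
  r := form _
  cqt := isCoquasitriangular_form _
  braiding_eq := cqtBraiding_comodule e hc
  universal B _ _ V hV := by
    refine ⟨toHopf e hc hV, ⟨?_, cqtAction_comodule e hc hV⟩, fun ψ hψ => ?_⟩
    · exact (rTensor_comodule e hc _).2 (toHopf_X e hc hV)
    · have h : (ψ : FRTAlgebra (ofBraiding c e hc) →ₐ[k] B) = toHopf e hc hV :=
        hom_ext fun i j => ((rTensor_comodule e hc _).1 hψ.1 i j).trans (toHopf_X e hc hV i j).symm
      exact DFunLike.ext _ _ fun x => congr($h x)

open Module

/-! ### Subspaces of the form `H ⊗ N` -/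

section LeftTensor

variable {k : Type*} [Field k] {H : Type*} [AddCommGroup H] [Module k H]
  {M : Type*} [AddCommGroup M] [Module k M]

variable (H) in
/-- The image of `H ⊗ N` in `H ⊗ M`. -/
def leftTensor (N : Submodule k M) : Submodule k (H ⊗[k] M) :=
  LinearMap.range (N.subtype.lTensor H)

/-- Contraction of the left factor. -/
def leftContract (f : Dual k H) : H ⊗[k] M →ₗ[k] M :=
  (TensorProduct.lid k M).toLinearMap ∘ₗ f.rTensor M

/-- Contraction of the right factor. -/
def rightContract (f : Dual k M) : H ⊗[k] M →ₗ[k] H :=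
  (TensorProduct.rid k H).toLinearMap ∘ₗ f.lTensor H

@[simp]
lemma leftContract_tmul (f : Dual k H) (h : H) (m : M) : leftContract f (h ⊗ₜ m) = f h • m := by
  simp [leftContract]

@[simp]
lemma rightContract_tmul (f : Dual k M) (h : H) (m : M) : rightContract f (h ⊗ₜ m) = f m • h := by
  simp [rightContract]

lemma eq_zero_of_leftContract {z : H ⊗[k] M} (h : ∀ f : Dual k H, leftContract f z = 0) :
    z = 0 := by
  classical
  let b := Basis.ofVectorSpace k H
  apply (TensorProduct.equivFinsuppOfBasisLeft b).injective
  ext i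
  rw [TensorProduct.equivFinsuppOfBasisLeft_apply, map_zero]
  exact h (b.coord i)

lemma eq_zero_of_rightContract {z : H ⊗[k] M} (h : ∀ f : Dual k M, rightContract f z = 0) :
    z = 0 := by
  classical
  let b := Basis.ofVectorSpace k M
  apply (TensorProduct.equivFinsuppOfBasisRight b).injective
  ext i
  rw [TensorProduct.equivFinsuppOfBasisRight_apply, map_zero]
  exact h (b.coord i)

lemma mem_leftTensor_iff_mkQ {N : Submodule k M} {z : H ⊗[k] M} :
    z ∈ leftTensor H N ↔ N.mkQ.lTensor H z = 0 := by
  have h := lTensor_exact H (LinearMap.exact_subtype_mkQ N) N.mkQ_surjective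
  exact (h z).symm

lemma leftContract_lTensor {M' : Type*} [AddCommGroup M'] [Module k M'] (g : M →ₗ[k] M')
    (f : Dual k H) (z : H ⊗[k] M) : leftContract f (g.lTensor H z) = g (leftContract f z) := by
  induction z with
  | zero => simp
  | add x y hx hy => simp only [map_add, hx, hy]
  | tmul x y => simp

lemma rightContract_lTensor {M' : Type*} [AddCommGroup M'] [Module k M'] (g : M →ₗ[k] M')
    (f : Dual k M') (z : H ⊗[k] M) :
    rightContract f (g.lTensor H z) = rightContract (f ∘ₗ g) z := by
  induction z with
  | zero => simp
  | add x y hx hy => simp only [map_add, hx, hy]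
  | tmul x y => simp

/-- Modulo N this says that functionals on H separate the elements of H ⊗ (M/N). Statements about
coideals and subcomodules thus become statements about stable subspaces. -/
lemma mem_leftTensor_iff {N : Submodule k M} {z : H ⊗[k] M} :
    z ∈ leftTensor H N ↔ ∀ f : Dual k H, leftContract f z ∈ N := by
  rw [mem_leftTensor_iff_mkQ]
  refine ⟨fun h f => ?_, fun h => eq_zero_of_leftContract fun f => ?_⟩
  · rw [← Submodule.ker_mkQ N, LinearMap.mem_ker, ← leftContract_lTensor, h, map_zero]
  · rw [leftContract_lTensor]
    exact (Submodule.Quotient.mk_eq_zero N).2 (h f)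

/-- The same criterion with functionals on M/N, that is, functionals on M that vanish on N. -/
lemma mem_leftTensor_iff_rightContract {N : Submodule k M} {z : H ⊗[k] M} :
    z ∈ leftTensor H N ↔ ∀ φ : Dual k M, (∀ n ∈ N, φ n = 0) → rightContract φ z = 0 := by
  rw [mem_leftTensor_iff_mkQ]
  refine ⟨fun h φ hφ => ?_, fun h => eq_zero_of_rightContract fun f => ?_⟩
  · have : φ = N.liftQ φ hφ ∘ₗ N.mkQ := (N.liftQ_mkQ φ hφ).symm
    rw [this, ← rightContract_lTensor, h, map_zero]
  · rw [rightContract_lTensor]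
    exact h _ fun n hn => by simp [(Submodule.Quotient.mk_eq_zero N).2 hn]

lemma tmul_mem_leftTensor {N : Submodule k M} (h : H) {m : M} (hm : m ∈ N) :
    h ⊗ₜ m ∈ leftTensor H N :=
  ⟨h ⊗ₜ ⟨m, hm⟩, by simp⟩

lemma leftTensor_mono {N N' : Submodule k M} (h : N ≤ N') : leftTensor H N ≤ leftTensor H N' :=
  fun _ hz => mem_leftTensor_iff.2 fun f => h (mem_leftTensor_iff.1 hz f)

lemma leftTensor_induction {N : Submodule k M} {p : H ⊗[k] M → Prop} {z : H ⊗[k] M}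
    (hz : z ∈ leftTensor H N) (tmul : ∀ h : H, ∀ n ∈ N, p (h ⊗ₜ n)) (zero : p 0)
    (add : ∀ x y, p x → p y → p (x + y)) : p z := by
  obtain ⟨z, rfl⟩ := hz
  induction z with
  | zero => simpa
  | add x y hx hy => rw [map_add]; exact add _ _ hx hy
  | tmul h n => exact tmul h n n.2

lemma mul_mem_leftTensor {A B : Type*} [Ring A] [Algebra k A] [Ring B] [Algebra k B]
    {N N' : Submodule k B} {z z' : A ⊗[k] B} (hz : z ∈ leftTensor A N)
    (hz' : z' ∈ leftTensor A N') : z * z' ∈ leftTensor A (N * N') := by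
  refine leftTensor_induction (p := fun z => z * z' ∈ leftTensor A (N * N')) hz
    (fun h n hn => ?_) (by simp) fun x y hx hy => by rw [add_mul]; exact add_mem hx hy
  refine leftTensor_induction (p := fun z' => (h ⊗ₜ n) * z' ∈ leftTensor A (N * N')) hz'
    (fun h' n' hn' => ?_) (by simp) fun x y hx hy => by rw [mul_add]; exact add_mem hx hy
  rw [Algebra.TensorProduct.tmul_mul_tmul]
  exact tmul_mem_leftTensor (H := A) (h * h') (Submodule.mul_mem_mul hn hn')

end LeftTensor

/-! ### Triangular left coideals -/

section Triangular

variable {k : Type*} [Field k] {C : Type*} [AddCommGroup C] [Module k C] [Coalgebra k C]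

/-- A subspace of a coalgebra with a filtration by left coideals whose subquotients are one
dimensional and given by grouplike elements. -/
inductive IsTriangular : Submodule k C → Prop
  | bot : IsTriangular ⊥
  | step {W : Submodule k C} {g v : C} (hW : IsTriangular W) (hg : IsGroupLikeElem k g)
      (hv : comul v - g ⊗ₜ[k] v ∈ leftTensor C W) : IsTriangular (W ⊔ Submodule.span k {v})

namespace IsTriangular

lemma sup {W W' : Submodule k C} (h : IsTriangular W) (h' : IsTriangular W') :
    IsTriangular (W ⊔ W') := by
  induction h' with
  | bot => simpa
  | step _ hg hv ih =>
    rw [← sup_assoc]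
    exact ih.step hg (leftTensor_mono le_sup_right hv)

lemma comul_mem {W : Submodule k C} (h : IsTriangular W) {x : C} (hx : x ∈ W) :
    comul x ∈ leftTensor C W := by
  induction h generalizing x with
  | bot => rw [(Submodule.mem_bot k).1 hx, map_zero]; exact zero_mem _
  | @step W g v _ hg hv ih =>
    obtain ⟨w, hw, y, hy, rfl⟩ := Submodule.mem_sup.1 hx
    obtain ⟨a, rfl⟩ := Submodule.mem_span_singleton.1 hy
    rw [map_add, map_smul]
    refine add_mem (leftTensor_mono le_sup_left (ih hw)) (Submodule.smul_mem _ _ ?_)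
    rw [← sub_add_cancel (comul (R := k) v) (g ⊗ₜ v)]
    exact add_mem (leftTensor_mono le_sup_left hv) (tmul_mem_leftTensor _
      (Submodule.mem_sup_right (Submodule.mem_span_singleton_self v)))

lemma sup_span {W : Submodule k C} (h : IsTriangular W) (s : Finset C)
    (hs : ∀ v ∈ s, ∃ g, IsGroupLikeElem k g ∧ comul v - g ⊗ₜ[k] v ∈ leftTensor C W) :
    IsTriangular (W ⊔ Submodule.span k s) := by
  classical
  induction s using Finset.induction_on with
  | empty => simpa
  | insert v s _ ih =>
    obtain ⟨g, hg, hv⟩ := hs v (Finset.mem_insert_self v s)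
    rw [Finset.coe_insert, Submodule.span_insert, sup_comm (Submodule.span k {v}), ← sup_assoc]
    exact (ih fun v hv => hs v (Finset.mem_insert_of_mem hv)).step hg
      (leftTensor_mono le_sup_left hv)

/-- Take the first stage W + kv of the filtration that meets D, and d ≠ 0 in the intersection. Then
Δd − g ⊗ d lies in C ⊗ D and in C ⊗ W, hence in C ⊗ (D ∩ W) = 0. -/
lemma exists_comul_eq {W : Submodule k C} (h : IsTriangular W) {D : Submodule k C}
    (hD : ∀ x ∈ D, comul x ∈ leftTensor C D) (hDW : D ⊓ W ≠ ⊥) :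
    ∃ d ∈ D, d ≠ 0 ∧ ∃ g, IsGroupLikeElem k g ∧ comul d = g ⊗ₜ[k] d := by
  induction h with
  | bot => exact (hDW (inf_bot_eq D)).elim
  | @step W g v hW hg hv ih =>
    by_cases hDW' : D ⊓ W = ⊥
    · obtain ⟨d, hd, hd0⟩ := (Submodule.ne_bot_iff _).1 hDW
      refine ⟨d, hd.1, hd0, g, hg, ?_⟩
      obtain ⟨w, hw, y, hy, rfl⟩ := Submodule.mem_sup.1 hd.2
      obtain ⟨a, rfl⟩ := Submodule.mem_span_singleton.1 hy
      have h1 : comul (w + a • v) - g ⊗ₜ[k] (w + a • v) ∈ leftTensor C W := by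
        have : comul (w + a • v) - g ⊗ₜ[k] (w + a • v) =
            (comul w - g ⊗ₜ[k] w) + a • (comul v - g ⊗ₜ[k] v) := by
          rw [map_add, map_smul, tmul_add, tmul_smul, smul_sub]
          abel
        rw [this]
        exact add_mem (sub_mem (hW.comul_mem hw) (tmul_mem_leftTensor _ hw))
          (Submodule.smul_mem _ _ hv)
      have h2 : comul (w + a • v) - g ⊗ₜ[k] (w + a • v) ∈ leftTensor C D :=
        sub_mem (hD _ hd.1) (tmul_mem_leftTensor _ hd.1)
      rw [← sub_eq_zero]
      refine eq_zero_of_leftContract fun f => ?_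
      rw [← Submodule.mem_bot k, ← hDW']
      exact ⟨mem_leftTensor_iff.1 h2 f, mem_leftTensor_iff.1 h1 f⟩
    · exact ih hDW'

/-- (W + kv)(W' + kv') is the sum of W(W' + kv'), (W + kv)W' and the line of vv'. The first two are
triangular by the two inductions. The line is a further step with grouplike element gg', as Δ(vv') −
gg' ⊗ vv' has its right factors in the first two terms. -/
lemma mul {H : Type*} [Ring H] [Bialgebra k H] {W W' : Submodule k H} (h : IsTriangular W)
    (h' : IsTriangular W') : IsTriangular (W * W') := by
  induction h generalizing W' with
  | bot => rw [Submodule.bot_mul]; exact bot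
  | @step W g v hW hg hv ih =>
    induction h' with
    | bot => rw [Submodule.mul_bot]; exact bot
    | @step W' g' v' hW' hg' hv' ih' =>
      have key := (ih'.sup (ih (hW'.step hg' hv'))).step (v := v * v') (hg.mul hg') ?_
      · have e : W * W' ≤ (W ⊔ Submodule.span k {v}) * W' := mul_le_mul' le_sup_left le_rfl
        rw [Submodule.mul_sup, Submodule.sup_mul W _ (Submodule.span k {v'}),
          Submodule.span_mul_span, Set.singleton_mul_singleton, ← sup_assoc]
        rwa [Submodule.mul_sup, ← sup_assoc, sup_eq_left.2 e] at key
      · have e : comul (v * v') - (g * g') ⊗ₜ[k] (v * v') =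
            (comul v - g ⊗ₜ[k] v) * comul v' + (g ⊗ₜ[k] v) * (comul v' - g' ⊗ₜ[k] v') := by
          rw [Bialgebra.comul_mul, sub_mul, mul_sub, Algebra.TensorProduct.tmul_mul_tmul]
          abel
        rw [e]
        refine add_mem (leftTensor_mono le_sup_right (mul_mem_leftTensor hv
          ((hW'.step hg' hv').comul_mem ?_))) (leftTensor_mono le_sup_left (mul_mem_leftTensor
          (tmul_mem_leftTensor g ?_) hv'))
        · exact Submodule.mem_sup_right (Submodule.mem_span_singleton_self v')
        · exact Submodule.mem_sup_right (Submodule.mem_span_singleton_self v)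

end IsTriangular

/-- A simple subcoalgebra D contains some d ≠ 0 with Δd = g ⊗ d. Applying the counit on the right
gives d = ε(d) g, so D contains g and, being simple, is spanned by it. -/
lemma isPointed_of_isTriangular (h : ∀ x : C, ∃ W : Submodule k C, IsTriangular W ∧ x ∈ W) :
    IsPointed k C := by
  intro D hD
  have hD' : ∀ x ∈ D, comul x ∈ leftTensor C D := by
    intro x hx
    obtain ⟨z, hz⟩ := hD.isSubcoalgebra x hx
    refine ⟨D.subtype.rTensor D z, ?_⟩
    rw [← hz, ← LinearMap.comp_apply, LinearMap.lTensor_comp_rTensor]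
  obtain ⟨x, hx, hx0⟩ := (Submodule.ne_bot_iff _).1 hD.ne_bot
  obtain ⟨W, hW, hxW⟩ := h x
  obtain ⟨d, hd, hd0, g, hg, hdg⟩ := hW.exists_comul_eq hD'
    ((Submodule.ne_bot_iff _).2 ⟨x, ⟨hx, hxW⟩, hx0⟩)
  have hd1 : d = counit (R := k) d • g := by
    have := congr(TensorProduct.rid k C ((counit (R := k) (A := C)).lTensor C $hdg))
    simpa using this
  have hg0 : g ≠ 0 := hg.ne_zero
  have hgD : g ∈ D := by
    have : counit (R := k) d ≠ 0 := fun h0 => hd0 (by rw [hd1, h0, zero_smul])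
    rw [← inv_smul_smul₀ this g, ← hd1]
    exact D.smul_mem _ hd
  have hE : IsSubcoalgebra (Submodule.span k {g}) := by
    intro x hx
    obtain ⟨a, rfl⟩ := Submodule.mem_span_singleton.1 hx
    rw [map_smul, hg.comul_eq_tmul_self]
    exact ⟨a • (⟨g, Submodule.mem_span_singleton_self g⟩ ⊗ₜ
      ⟨g, Submodule.mem_span_singleton_self g⟩), by simp⟩
  rcases hD.eq_bot_or_eq _ hE (by simpa using hgD) with h | h
  · simp [hg0] at h
  · rw [← h, finrank_span_singleton hg0]

/-- The entries of a triangular matrix of comultiplicative elements span a triangular left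
coideal. -/
lemma exists_isTriangular_of_matrix {ι : Type*} [Fintype ι] [LinearOrder ι] {T : Matrix ι ι C}
    (h₁ : ∀ i j, comul (T i j) = ∑ l, T i l ⊗ₜ[k] T l j)
    (h₂ : ∀ i j, counit (R := k) (T i j) = (1 : Matrix ι ι k) i j)
    (h : ∀ i j, i < j → T i j = 0) : ∃ W : Submodule k C, IsTriangular W ∧ ∀ i j, T i j ∈ W := by
  classical
  suffices ∀ s : Finset ι, (∀ i ∈ s, ∀ l < i, l ∈ s) → ∃ W : Submodule k C, IsTriangular W ∧
      ∀ i ∈ s, ∀ j, T i j ∈ W by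
    obtain ⟨W, hW, hT⟩ := this Finset.univ (by simp)
    exact ⟨W, hW, fun i => hT i (Finset.mem_univ i)⟩
  intro s
  induction s using Finset.induction_on_max with
  | empty => exact fun _ => ⟨⊥, .bot, by simp⟩
  | insert a s ha ih =>
    intro hs
    obtain ⟨W, hW, hT⟩ := ih fun i hi l hl =>
      (Finset.mem_insert.1 (hs i (Finset.mem_insert_of_mem hi) l hl)).resolve_left
        (hl.trans (ha i hi)).ne
    have hg : IsGroupLikeElem k (T a a) := by
      refine ⟨by simp [h₂], ?_⟩
      rw [h₁, Finset.sum_eq_single a (fun l _ hl => ?_) (by simp)]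
      rcases lt_or_gt_of_ne hl with hl | hl
      · rw [h l a hl, tmul_zero]
      · rw [h a l hl, zero_tmul]
    refine ⟨W ⊔ Submodule.span k (Finset.univ.image (T a)),
      hW.sup_span _ fun v hv => ⟨T a a, hg, ?_⟩, fun i hi j => ?_⟩
    · obtain ⟨j, -, rfl⟩ := Finset.mem_image.1 hv
      -- Rows are added in increasing order. Apart from T a a ⊗ T a j, triangularity leaves only
      -- terms whose right factor lies in an earlier row, hence in W.
      rw [h₁, ← Finset.add_sum_erase _ _ (Finset.mem_univ a), add_sub_cancel_left]
      refine Submodule.sum_mem _ fun l hl => ?_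
      rcases lt_or_gt_of_ne (Finset.ne_of_mem_erase hl) with hl | hl
      · exact tmul_mem_leftTensor _ (hT l ((Finset.mem_insert.1
          (hs a (Finset.mem_insert_self a s) l hl)).resolve_left hl.ne) j)
      · rw [h a l hl, zero_tmul]
        exact zero_mem _
    · rcases Finset.mem_insert.1 hi with rfl | hi
      · exact Submodule.mem_sup_right (Submodule.subset_span (by simp))
      · exact Submodule.mem_sup_left (hT i hi j)

end Triangular

open Module

/-! ### Minimal subspaces and construction of flags -/

section Minimal

variable {k : Type*} [Field k] {M : Type*} [AddCommGroup M] [Module k M]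

lemma exists_minimal_submodule {P : Submodule k M → Prop} {W : Submodule k M}
    [FiniteDimensional k W] (hW : P W) (h0 : W ≠ ⊥) :
    ∃ N ≤ W, P N ∧ N ≠ ⊥ ∧ ∀ N' ≤ N, P N' → N' = ⊥ ∨ N' = N := by
  induction hn : finrank k W using Nat.strong_induction_on generalizing W with
  | h n ih =>
    by_cases h : ∃ N' < W, P N' ∧ N' ≠ ⊥
    · obtain ⟨N', hN', hP, hne⟩ := h
      have := Submodule.finiteDimensional_of_le hN'.le
      obtain ⟨N, hN, h⟩ := ih _ (hn ▸ Submodule.finrank_lt_finrank_of_lt hN') hP hne rfl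
      exact ⟨N, hN.trans hN'.le, h⟩
    · push Not at h
      refine ⟨W, le_rfl, hW, h0, fun N' hN' hP => ?_⟩
      rcases hN'.eq_or_lt with rfl | hlt
      · exact Or.inr rfl
      · exact Or.inl (h N' hlt hP)

lemma exists_isCompleteFlag [FiniteDimensional k M] {P : Submodule k M → Prop} (h0 : P ⊥)
    (h1 : ∀ N, P N → N ≠ ⊤ → ∃ N', N ≤ N' ∧ P N' ∧ finrank k N' = finrank k N + 1) :
    ∃ (r : ℕ) (F : Fin (r + 1) → Submodule k M), IsCompleteFlag F ∧ ∀ i, P (F i) := by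
  classical
  choose! next hle hP hrank using h1
  -- The value at ⊤ only makes the iteration total; the stages in use before the last one are proper
  -- subspaces.
  let G' (N : Submodule k M) : Submodule k M := if N = ⊤ then ⊤ else next N
  let G (i : ℕ) : Submodule k M := G'^[i] ⊥
  have hG (i : ℕ) (h : G i ≠ ⊤) : G (i + 1) = next (G i) := by
    simp only [G, Function.iterate_succ_apply', G']
    exact if_neg h
  have key (i : ℕ) (hi : i ≤ finrank k M) : P (G i) ∧ finrank k (G i) = i := by
    induction i with
    | zero => exact ⟨h0, finrank_bot k M⟩
    | succ i ih =>
      obtain ⟨hPi, hi'⟩ := ih (by omega)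
      have hne : G i ≠ ⊤ := fun h => by
        rw [h, finrank_top] at hi'
        omega
      rw [hG _ hne]
      exact ⟨hP _ hPi hne, by rw [hrank _ hPi hne, hi']⟩
  refine ⟨finrank k M, fun i => G i, ⟨rfl, ?_, ?_, fun i => (key i (by omega)).2⟩,
    fun i => (key i (by omega)).1⟩
  · exact Submodule.eq_top_of_finrank_eq (key _ le_rfl).2
  · refine Fin.monotone_iff_le_succ.2 fun i => ?_
    obtain ⟨hPi, hi'⟩ := key i (by omega)
    have hne : G i ≠ ⊤ := fun h => by
      rw [h, finrank_top] at hi'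
      omega
    simp only [Fin.val_castSucc, Fin.val_succ]
    rw [hG _ hne]
    exact hle _ hPi hne

end Minimal

/-! ### Flags of subcomodules over a pointed coalgebra -/

section Comodule

variable {k : Type*} [Field k] {C : Type*} [AddCommGroup C] [Module k C] [Coalgebra k C]
  {M : Type*} [AddCommGroup M] [Module k M] (V : LeftComodule k C M)

omit [Coalgebra k C] in
lemma isSubcomodule_iff {δ : M →ₗ[k] C ⊗[k] M} {N : Submodule k M} :
    IsSubcomodule δ N ↔ ∀ f : Dual k C, ∀ n ∈ N, leftContract f (δ n) ∈ N :=
  ⟨fun h f n hn => mem_leftTensor_iff.1 (h n hn) f,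
    fun h n hn => mem_leftTensor_iff.2 fun f => h f n hn⟩

lemma LeftComodule.comul_rightContract (φ : Dual k M) (m : M) :
    comul (rightContract φ (V.coact m)) =
      (rightContract φ ∘ₗ V.coact).lTensor C (V.coact m) := by
  have h1 (w : C ⊗[k] C) (m : M) :
      (rightContract φ).lTensor C (TensorProduct.assoc k C C M (w ⊗ₜ m)) = φ m • w := by
    induction w with
    | zero => simp
    | add x y hx hy => rw [add_tmul, map_add, map_add, hx, hy, smul_add]
    | tmul x y => simp
  have h2 (z : C ⊗[k] M) : (rightContract φ).lTensor C (TensorProduct.assoc k C C M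
      ((comul (R := k) (A := C)).rTensor M z)) = comul (rightContract φ z) := by
    induction z with
    | zero => simp
    | add x y hx hy => simp only [map_add, hx, hy]
    | tmul x y => rw [LinearMap.rTensor_tmul, h1, rightContract_tmul, map_smul]
  rw [LinearMap.lTensor_comp, LinearMap.comp_apply, ← h2]
  exact congr((rightContract φ).lTensor C ($V.coassoc m))

lemma LeftComodule.rightContract_leftContract (φ : Dual k M) (f : Dual k C) (m : M) :
    rightContract φ (V.coact (leftContract f (V.coact m))) =
      leftContract f (comul (rightContract φ (V.coact m))) := by
  rw [V.comul_rightContract, leftContract_lTensor]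
  rfl

section Transfer

variable {M' : Type*} [AddCommGroup M'] [Module k M'] {g : M →ₗ[k] M'} {d : M →ₗ[k] C ⊗[k] M}
  {d' : M' →ₗ[k] C ⊗[k] M'}

/-- This and the next two lemmas transport the comodule axioms along a linear map g compatible with
two candidate coactions. They serve an inclusion, where g is cancelled on the left, and a quotient
map, where it is cancelled on the right. -/
lemma assoc_rTensor_comul_comp (h : g.lTensor C ∘ₗ d = d' ∘ₗ g) :
    (g.lTensor C).lTensor C ∘ₗ ((TensorProduct.assoc k C C M).toLinearMap ∘ₗ
        (comul (R := k) (A := C)).rTensor M ∘ₗ d) =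
      ((TensorProduct.assoc k C C M').toLinearMap ∘ₗ
        (comul (R := k) (A := C)).rTensor M' ∘ₗ d') ∘ₗ g := by
  have h1 (w : (C ⊗[k] C) ⊗[k] M) : (g.lTensor C).lTensor C (TensorProduct.assoc k C C M w) =
      TensorProduct.assoc k C C M' (g.lTensor (C ⊗[k] C) w) := by
    refine congr($(TensorProduct.ext_threefold (g := (g.lTensor C).lTensor C ∘ₗ
      (TensorProduct.assoc k C C M).toLinearMap) (h := (TensorProduct.assoc k C C M').toLinearMap ∘ₗ
      g.lTensor (C ⊗[k] C)) fun x y z => ?_) w)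
    simp
  ext m
  simp only [LinearMap.comp_apply, LinearEquiv.coe_coe, h1]
  rw [← LinearMap.comp_apply (f := g.lTensor (C ⊗[k] C)), LinearMap.lTensor_comp_rTensor,
    ← LinearMap.rTensor_comp_lTensor, LinearMap.comp_apply,
    ← LinearMap.comp_apply (f := g.lTensor C),
    h]
  rfl

omit [Coalgebra k C] in
lemma lTensor_lTensor_comp (h : g.lTensor C ∘ₗ d = d' ∘ₗ g) :
    (g.lTensor C).lTensor C ∘ₗ (d.lTensor C ∘ₗ d) = (d'.lTensor C ∘ₗ d') ∘ₗ g := by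
  rw [← LinearMap.comp_assoc, ← LinearMap.lTensor_comp, h, LinearMap.lTensor_comp,
    LinearMap.comp_assoc, h, LinearMap.comp_assoc]

lemma lid_rTensor_counit_comp (h : g.lTensor C ∘ₗ d = d' ∘ₗ g) :
    g ∘ₗ ((TensorProduct.lid k M).toLinearMap ∘ₗ (counit (R := k) (A := C)).rTensor M ∘ₗ d) =
      ((TensorProduct.lid k M').toLinearMap ∘ₗ (counit (R := k) (A := C)).rTensor M' ∘ₗ d') ∘ₗ
        g := by
  ext m
  exact (leftContract_lTensor g counit (d m)).symm.trans congr(leftContract counit ($h m))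

end Transfer

omit [Coalgebra k C] in
lemma lTensor_subtype_injective (N : Submodule k M) : Function.Injective (N.subtype.lTensor C) :=
  Module.Flat.lTensor_preserves_injective_linearMap _ N.injective_subtype

/-- The restriction of a coaction to a subcomodule. -/
def restrictCoact {δ : M →ₗ[k] C ⊗[k] M} {N : Submodule k M} (hN : IsSubcomodule δ N) :
    N →ₗ[k] C ⊗[k] N :=
  (LinearEquiv.ofInjective _ (lTensor_subtype_injective N)).symm.toLinearMap ∘ₗ
    (δ ∘ₗ N.subtype).codRestrict _ fun n => hN n n.2

omit [Coalgebra k C] in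
lemma lTensor_comp_restrictCoact {δ : M →ₗ[k] C ⊗[k] M} {N : Submodule k M}
    (hN : IsSubcomodule δ N) : N.subtype.lTensor C ∘ₗ restrictCoact hN = δ ∘ₗ N.subtype :=
  LinearMap.ext fun n => congr(Subtype.val $((LinearEquiv.ofInjective _
    (lTensor_subtype_injective N)).apply_symm_apply ⟨δ n, hN n n.2⟩))

/-- The restriction of a comodule structure to a subcomodule. -/
def LeftComodule.restrict {N : Submodule k M} (hN : IsSubcomodule V.coact N) :
    LeftComodule k C N where
  coact := restrictCoact hN
  coassoc := by
    have h := lTensor_comp_restrictCoact hN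
    rw [← LinearMap.cancel_left (f := (N.subtype.lTensor C).lTensor C)
      (Module.Flat.lTensor_preserves_injective_linearMap _ (lTensor_subtype_injective N)),
      assoc_rTensor_comul_comp h, lTensor_lTensor_comp h, V.coassoc]
  counit_coact := by
    rw [← LinearMap.cancel_left N.injective_subtype,
      lid_rTensor_counit_comp (lTensor_comp_restrictCoact hN), V.counit_coact]
    rfl

/-- The comodule structure on the quotient by a subcomodule. -/
def LeftComodule.quotient {N : Submodule k M} (hN : IsSubcomodule V.coact N) :
    LeftComodule k C (M ⧸ N) where
  coact := N.liftQ (N.mkQ.lTensor C ∘ₗ V.coact) fun n hn => mem_leftTensor_iff_mkQ.1 (hN n hn)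
  coassoc := by
    have h := (N.liftQ_mkQ (N.mkQ.lTensor C ∘ₗ V.coact)
      fun n hn => mem_leftTensor_iff_mkQ.1 (hN n hn)).symm
    rw [← LinearMap.cancel_right N.mkQ_surjective, ← assoc_rTensor_comul_comp h,
      ← lTensor_lTensor_comp h, V.coassoc]
  counit_coact := by
    rw [← LinearMap.cancel_right N.mkQ_surjective, ← lid_rTensor_counit_comp
      (N.liftQ_mkQ (N.mkQ.lTensor C ∘ₗ V.coact)
        fun n hn => mem_leftTensor_iff_mkQ.1 (hN n hn)).symm, V.counit_coact]
    rfl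

/-- A generator x satisfies Δx = a x ⊗ x, and the counit axiom forces aε(x) = 1; then ax is
grouplike. -/
lemma exists_isGroupLikeElem_of_finrank_eq_one {D : Submodule k C} (hD : IsSubcoalgebra D)
    (h : finrank k D = 1) : ∃ g ∈ D, IsGroupLikeElem k g := by
  obtain ⟨⟨x, hx⟩, hx0, hspan⟩ := finrank_eq_one_iff'.1 h
  have hx0 : x ≠ 0 := fun h => hx0 (Subtype.ext h)
  have hle : ∀ y ∈ D, ∃ a : k, a • x = y := fun y hy => by
    obtain ⟨a, ha⟩ := hspan ⟨y, hy⟩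
    exact ⟨a, congr(Subtype.val $ha)⟩
  obtain ⟨a, ha⟩ : ∃ a : k, comul x = a • (x ⊗ₜ[k] x) := by
    obtain ⟨z, hz⟩ := hD x hx
    rw [← hz]
    clear hz
    induction z with
    | zero => exact ⟨0, by simp⟩
    | add y z hy hz =>
      obtain ⟨a, ha⟩ := hy
      obtain ⟨b, hb⟩ := hz
      exact ⟨a + b, by rw [map_add, ha, hb, add_smul]⟩
    | tmul y z =>
      obtain ⟨a, ha⟩ := hle y y.2
      obtain ⟨b, hb⟩ := hle z z.2
      refine ⟨a * b, ?_⟩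
      rw [TensorProduct.map_tmul, Submodule.subtype_apply, Submodule.subtype_apply, ← ha, ← hb,
        smul_tmul_smul]
  have h1 : (a * counit (R := k) x) • x = x := by
    have := congr(TensorProduct.rid k C ((counit (R := k) (A := C)).lTensor C $ha))
    simpa [smul_smul, eq_comm] using this
  have h2 : a * counit (R := k) x = 1 := by
    rw [← sub_eq_zero, ← smul_eq_zero_iff_left hx0, sub_smul, h1, one_smul, sub_self]
  refine ⟨a • x, D.smul_mem _ hx, ⟨by simpa using h2, ?_⟩⟩
  rw [map_smul, ha, smul_tmul_smul, smul_smul]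

/-- The matrix coefficients span a nonzero finite-dimensional subcoalgebra. A minimal nonzero
subcoalgebra inside it is simple, hence a line spanned by a grouplike element, which is then a sum
of coefficients of M. -/
lemma LeftComodule.exists_isGroupLikeElem [Nontrivial M] (hC : IsPointed k C)
    {ι : Type*} [Fintype ι] (e : Basis ι k M) :
    ∃ g : C, IsGroupLikeElem k g ∧
      ∃ n : ι → M, g = ∑ j, rightContract (e.coord j) (V.coact (n j)) := by
  classical
  let D : Submodule k C := Submodule.span k (Set.range fun p : ι × ι => V.mat e p.1 p.2)
  have hmem (i j : ι) : V.mat e i j ∈ D := Submodule.subset_span ⟨(i, j), rfl⟩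
  have hD : IsSubcoalgebra D := by
    intro x hx
    induction hx using Submodule.span_induction with
    | zero => rw [map_zero]; exact zero_mem _
    | add x y _ _ hx hy => rw [map_add]; exact add_mem hx hy
    | smul a x _ hx => rw [map_smul]; exact Submodule.smul_mem _ _ hx
    | mem x hx =>
      obtain ⟨⟨i, j⟩, rfl⟩ := hx
      rw [V.comul_mat]
      exact Submodule.sum_mem _ fun l _ => ⟨⟨_, hmem i l⟩ ⊗ₜ ⟨_, hmem l j⟩, by simp⟩
  have hD0 : D ≠ ⊥ := fun h0 => by
    obtain ⟨i⟩ := e.index_nonempty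
    have h := hmem i i
    rw [h0, Submodule.mem_bot] at h
    have := V.counit_mat (e := e) i i
    simp [h] at this
  have : FiniteDimensional k D := FiniteDimensional.span_of_finite k (Set.finite_range _)
  obtain ⟨E, hED, hE, hE0, hmin⟩ := exists_minimal_submodule hD hD0
  obtain ⟨g, hg, hgl⟩ := exists_isGroupLikeElem_of_finrank_eq_one hE
    (hC E ⟨hE, hE0, fun E' hE' hle => hmin E' hle hE'⟩)
  refine ⟨g, hgl, ?_⟩
  have := hED hg
  clear hg hgl
  induction this using Submodule.span_induction with
  | zero => exact ⟨0, by simp⟩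
  | add x y _ _ hx hy =>
    obtain ⟨n, rfl⟩ := hx
    obtain ⟨n', rfl⟩ := hy
    exact ⟨n + n', by simp [Finset.sum_add_distrib]⟩
  | smul a x _ hx =>
    obtain ⟨n, rfl⟩ := hx
    exact ⟨a • n, by simp [Finset.smul_sum]⟩
  | mem x hx =>
    obtain ⟨⟨i, j⟩, rfl⟩ := hx
    refine ⟨Pi.single j (e i), ?_⟩
    rw [Finset.sum_eq_single j (fun l _ hl => by simp [hl]) (by simp), Pi.single_eq_same]
    rfl

variable [FiniteDimensional k M]

/-- Write the grouplike g as a sum of coefficients of vectors n j over an index set s, and shorten s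
while possible. The map Φ respects contraction by functionals on C. If its kernel has a nonzero
coordinate at some j ∈ s, the projection of the kernel to that coordinate is a nonzero subcomodule,
hence M, and n can be corrected to drop j. Otherwise elements of the kernel vanish on s, and the
grouplike property of g forces δ(n j) = g ⊗ n j. -/
lemma LeftComodule.exists_coact_eq_of_simple [Nontrivial M] (hC : IsPointed k C)
    (hM : ∀ N, IsSubcomodule V.coact N → N = ⊥ ∨ N = ⊤) :
    ∃ g : C, ∃ m : M, m ≠ 0 ∧ V.coact m = g ⊗ₜ m := by
  classical
  let e := finBasis k M
  obtain ⟨g, hg, n, hn⟩ := V.exists_isGroupLikeElem hC e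
  suffices ∀ s : Finset (Fin (finrank k M)), ∀ n : Fin (finrank k M) → M,
      g = ∑ j ∈ s, rightContract (e.coord j) (V.coact (n j)) →
      ∃ g : C, ∃ m : M, m ≠ 0 ∧ V.coact m = g ⊗ₜ m from this _ n hn
  clear n hn
  intro s
  induction s using Finset.strongInduction with
  | H s ih =>
  intro n hn
  let Φ : (Fin (finrank k M) → M) →ₗ[k] C :=
    ∑ j ∈ s, rightContract (e.coord j) ∘ₗ V.coact ∘ₗ LinearMap.proj j
  have hΦ (x) : Φ x = ∑ j ∈ s, rightContract (e.coord j) (V.coact (x j)) := by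
    simp [Φ]
  have hΦf (f : Dual k C) (x) :
      Φ (fun j => leftContract f (V.coact (x j))) = leftContract f (comul (Φ x)) := by
    simp only [hΦ, V.rightContract_leftContract, map_sum]
  by_cases h : ∃ x, Φ x = 0 ∧ ∃ j ∈ s, x j ≠ 0
  · obtain ⟨x, hx, j, hj, hxj⟩ := h
    have hsub : IsSubcomodule V.coact ((LinearMap.ker Φ).map (LinearMap.proj j)) := by
      rw [isSubcomodule_iff]
      rintro f _ ⟨y, hy, rfl⟩
      refine ⟨fun j => leftContract f (V.coact (y j)), ?_, rfl⟩
      rw [SetLike.mem_coe, LinearMap.mem_ker] at hy ⊢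
      rw [hΦf, hy, map_zero, map_zero]
    have htop := (hM _ hsub).resolve_left fun h0 => hxj (by
      rw [← Submodule.mem_bot k, ← h0]
      exact ⟨x, hx, rfl⟩)
    obtain ⟨y, hy, hyj⟩ : n j ∈ (LinearMap.ker Φ).map (LinearMap.proj j) := by
      rw [htop]
      trivial
    refine ih _ (Finset.erase_ssubset hj) (n - y) ?_
    have : g = Φ (n - y) := by rw [map_sub, hy, sub_zero, hn, hΦ]
    rw [this, hΦ, ← Finset.add_sum_erase _ _ hj, Pi.sub_apply]
    have hyj : y j = n j := hyj
    rw [hyj, sub_self, map_zero, map_zero, zero_add]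
  · push Not at h
    obtain ⟨j, hj, hnj⟩ : ∃ j ∈ s, n j ≠ 0 := by
      by_contra! h0
      refine hg.ne_zero ?_
      rw [hn]
      exact Finset.sum_eq_zero fun j hj => by rw [h0 j hj, map_zero, map_zero]
    refine ⟨g, n j, hnj, ?_⟩
    rw [← sub_eq_zero]
    refine eq_zero_of_leftContract fun f => ?_
    -- The tuple formed from f(n₍₋₁₎) n₍₀₎ − f(g) n lies in the kernel of Φ, because contracting Δg
    -- = g ⊗ g with f gives f(g) g.
    have := h ((fun j => leftContract f (V.coact (n j))) - f g • n) (by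
      rw [map_sub, hΦf, map_smul, hΦ, ← hn, hg.comul_eq_tmul_self, leftContract_tmul, sub_self])
      j hj
    rw [map_sub, leftContract_tmul]
    exact this

lemma LeftComodule.exists_coact_eq [Nontrivial M] (hC : IsPointed k C) :
    ∃ g : C, ∃ m : M, m ≠ 0 ∧ V.coact m = g ⊗ₜ m := by
  obtain ⟨N, -, hN, hN0, hmin⟩ := exists_minimal_submodule (P := IsSubcomodule V.coact) (W := ⊤)
    (fun m _ => mem_leftTensor_iff.2 fun _ => trivial) top_ne_bot
  have := Submodule.nontrivial_iff_ne_bot.2 hN0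
  have hres (n : N) : N.subtype.lTensor C (restrictCoact hN n) = V.coact n :=
    congr($(lTensor_comp_restrictCoact hN) n)
  obtain ⟨g, m, hm, hgm⟩ := (V.restrict hN).exists_coact_eq_of_simple hC fun N' hN' => by
    have hsub : IsSubcomodule V.coact (N'.map N.subtype) := by
      rw [isSubcomodule_iff] at hN' ⊢
      rintro f _ ⟨n, hn, rfl⟩
      refine ⟨_, hN' f n hn, ?_⟩
      rw [Submodule.subtype_apply n, ← hres, leftContract_lTensor]
      rfl
    rcases hmin _ (Submodule.map_subtype_le N N') hsub with h | h
    · exact Or.inl (Submodule.map_injective_of_injective N.injective_subtype (by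
        rw [h, Submodule.map_bot]))
    · refine Or.inr (Submodule.map_injective_of_injective N.injective_subtype ?_)
      rw [h, Submodule.map_subtype_top]
  refine ⟨g, m, by simpa using hm, ?_⟩
  rw [← hres]
  refine congr(N.subtype.lTensor C $hgm).trans ?_
  rw [LinearMap.lTensor_tmul, Submodule.subtype_apply]

/-- A line in M/N on which the coaction is m ↦ g ⊗ m lifts to a subcomodule N + km with one more
dimension. -/
lemma LeftComodule.exists_flag (hC : IsPointed k C) :
    ∃ (r : ℕ) (F : Fin (r + 1) → Submodule k M), IsCompleteFlag F ∧
      ∀ i, IsSubcomodule V.coact (F i) := by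
  refine exists_isCompleteFlag (fun m hm => ?_) fun N hN hne => ?_
  · rw [(Submodule.mem_bot k).1 hm, map_zero]
    exact zero_mem _
  have := Submodule.Quotient.nontrivial_iff.2 hne
  obtain ⟨g, m, hm, hgm⟩ := (V.quotient hN).exists_coact_eq hC
  obtain ⟨m, rfl⟩ := N.mkQ_surjective m
  have hmN : m ∉ N := fun h => hm ((Submodule.Quotient.mk_eq_zero N).2 h)
  have hgm' : V.coact m - g ⊗ₜ m ∈ leftTensor C N := by
    rw [mem_leftTensor_iff_mkQ, map_sub, LinearMap.lTensor_tmul, sub_eq_zero, ← hgm]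
    rfl
  refine ⟨N ⊔ Submodule.span k {m}, le_sup_left, ?_, ?_⟩
  · intro x hx
    obtain ⟨n, hn, y, hy, rfl⟩ := Submodule.mem_sup.1 hx
    obtain ⟨a, rfl⟩ := Submodule.mem_span_singleton.1 hy
    rw [map_add, map_smul]
    refine add_mem (leftTensor_mono le_sup_left (hN n hn)) (Submodule.smul_mem _ _ ?_)
    rw [← sub_add_cancel (V.coact m) (g ⊗ₜ m)]
    exact add_mem (leftTensor_mono le_sup_left hgm') (tmul_mem_leftTensor _
      (Submodule.mem_sup_right (Submodule.mem_span_singleton_self m)))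
  · have hm0 : m ≠ 0 := fun h => hmN (h ▸ zero_mem N)
    have hd : N ⊓ Submodule.span k {m} = ⊥ :=
      ((Submodule.disjoint_span_singleton' hm0).2 hmN).eq_bot
    have := Submodule.finrank_sup_add_finrank_inf_eq N (Submodule.span k {m})
    rwa [hd, finrank_bot, add_zero, finrank_span_singleton hm0] at this

end Comodule

open Module

/-! ### Change of the coacting algebra -/

section Pushforward

variable {k : Type*} [Field k] {M : Type*} [AddCommGroup M] [Module k M]

/-- The comodule structure that is induced by a morphism of coalgebras. -/
def LeftComodule.pushforward {C D : Type*} [AddCommGroup C] [Module k C] [Coalgebra k C]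
    [AddCommGroup D] [Module k D] [Coalgebra k D] (V : LeftComodule k C M) (f : C →ₗc[k] D) :
    LeftComodule k D M where
  coact := f.toLinearMap.rTensor M ∘ₗ V.coact
  coassoc := by
    have h1 (z : C ⊗[k] M) : TensorProduct.assoc k D D M ((comul (R := k) (A := D)).rTensor M
        (f.toLinearMap.rTensor M z)) = TensorProduct.map f.toLinearMap (f.toLinearMap.rTensor M)
          (TensorProduct.assoc k C C M ((comul (R := k) (A := C)).rTensor M z)) := by
      induction z with
      | zero => simp
      | add x y hx hy => simp only [map_add, hx, hy]
      | tmul x m =>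
        simp only [LinearMap.rTensor_tmul]
        rw [show comul (R := k) (f.toLinearMap x) = TensorProduct.map f.toLinearMap f.toLinearMap
          (comul x) from congr($(f.map_comp_comul) x).symm]
        generalize comul (R := k) x = w
        induction w with
        | zero => simp
        | add x y hx hy => simp only [map_add, add_tmul, hx, hy]
        | tmul x y => simp
    ext m
    simp only [LinearMap.comp_apply, LinearEquiv.coe_coe, h1]
    rw [show TensorProduct.assoc k C C M ((comul (R := k) (A := C)).rTensor M (V.coact m)) =
      V.coact.lTensor C (V.coact m) from congr($(V.coassoc) m)]
    generalize V.coact m = w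
    induction w with
    | zero => simp
    | add x y hx hy => simp only [map_add, hx, hy]
    | tmul x y => simp
  counit_coact := by
    rw [← V.counit_coact, ← LinearMap.comp_assoc (f := V.coact), ← LinearMap.rTensor_comp,
      f.counit_comp]

variable {H H' : Type*} [Ring H] [Bialgebra k H] [Ring H'] [Bialgebra k H']

/-- The Yetter-Drinfeld module structure that is induced by a surjective morphism of bialgebras
whose kernel acts trivially. -/
def YetterDrinfeld.pushforward (V : YetterDrinfeld k H M) (f : H →ₐc[k] H')
    (hf : Function.Surjective f) (a : H' →ₐ[k] Module.End k M) (ha : ∀ h, a (f h) = V.act h) :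
    YetterDrinfeld k H' M where
  toLeftComodule := V.toLeftComodule.pushforward f
  act := a
  compat := by
    refine TensorProduct.ext' fun h' m => ?_
    obtain ⟨h, rfl⟩ := hf h'
    have hc : comul (R := k) (f h) = TensorProduct.map (f : H →ₗ[k] H') (f : H →ₗ[k] H')
      (comul h) := congr($(f.toCoalgHom.map_comp_comul) h).symm
    have h1 (z : H ⊗[k] H) : (LinearMap.mul' k H').rTensor M (TensorProduct.rightComm k H' M H'
        (((f : H →ₗ[k] H').rTensor M ∘ₗ V.coact ∘ₗ TensorProduct.lift a.toLinearMap).rTensor H'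
          (TensorProduct.rightComm k H' H' M
            (TensorProduct.map (f : H →ₗ[k] H') (f : H →ₗ[k] H') z ⊗ₜ m)))) =
        (f : H →ₗ[k] H').rTensor M ((LinearMap.mul' k H).rTensor M (TensorProduct.rightComm k H M H
        ((V.coact ∘ₗ TensorProduct.lift V.act.toLinearMap).rTensor H
          (TensorProduct.rightComm k H H M (z ⊗ₜ m))))) := by
      induction z with
      | zero => simp
      | add x y hx hy => simp only [map_add, add_tmul, hx, hy]
      | tmul x y =>
        simp only [TensorProduct.map_tmul, TensorProduct.rightComm_tmul, LinearMap.rTensor_tmul,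
          LinearMap.comp_apply, TensorProduct.lift.tmul, AlgHom.toLinearMap_apply]
        rw [show a ((f : H →ₗ[k] H') x) = V.act x from ha x]
        generalize V.coact (V.act x m) = w
        induction w with
        | zero => simp
        | add x y hx hy => simp only [map_add, add_tmul, hx, hy]
        | tmul x y => simp
    have h2 (z : H ⊗[k] H) (w : H ⊗[k] M) : TensorProduct.map (LinearMap.mul' k H')
        (TensorProduct.lift a.toLinearMap) (TensorProduct.tensorTensorTensorComm k H' H' H' M
          (TensorProduct.map (f : H →ₗ[k] H') (f : H →ₗ[k] H') z ⊗ₜ (f : H →ₗ[k] H').rTensor M w)) =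
        (f : H →ₗ[k] H').rTensor M (TensorProduct.map (LinearMap.mul' k H)
          (TensorProduct.lift V.act.toLinearMap) (TensorProduct.tensorTensorTensorComm k H H H M
            (z ⊗ₜ w))) := by
      induction z with
      | zero => simp
      | add x y hx hy => simp only [map_add, add_tmul, hx, hy]
      | tmul x y =>
        induction w with
        | zero => simp
        | add x y hx hy => simp only [map_add, tmul_add, hx, hy]
        | tmul x y => simp [ha]
    have h3 := congr((f : H →ₗ[k] H').rTensor M ($(V.compat) (h ⊗ₜ m)))
    simp only [LinearMap.comp_apply, LinearEquiv.coe_coe, LinearMap.rTensor_tmul,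
      TensorProduct.map_tmul] at h3
    rw [← h1, ← h2, ← hc] at h3
    exact h3

lemma YetterDrinfeld.pushforward_braiding (V : YetterDrinfeld k H M) (f : H →ₐc[k] H')
    (hf : Function.Surjective f) (a : H' →ₐ[k] Module.End k M) (ha : ∀ h, a (f h) = V.act h) :
    (V.pushforward f hf a ha).braiding = V.braiding := by
  refine TensorProduct.ext' fun m n => ?_
  change (TensorProduct.lift a.toLinearMap).rTensor M (TensorProduct.rightComm k H' M M
    ((f : H →ₗ[k] H').rTensor M (V.coact m) ⊗ₜ n)) =
    (TensorProduct.lift V.act.toLinearMap).rTensor M (TensorProduct.rightComm k H M M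
    (V.coact m ⊗ₜ n))
  generalize V.coact m = w
  induction w with
  | zero => simp
  | add x y hx hy => simp only [map_add, add_tmul, hx, hy]
  | tmul x y => simp [ha]

end Pushforward

/-! ### Stable subspaces under the generators and their inverses -/

section Stable

variable {k : Type*} [Field k]

lemma map_le_of_leftInverse {V : Type*} [AddCommGroup V] [Module k V] [FiniteDimensional k V]
    {L L' : V →ₗ[k] V} (h : L' ∘ₗ L = LinearMap.id) {W : Submodule k V} (hW : W.map L ≤ W) :
    W.map L' ≤ W := by
  have hinj : Function.Injective L := LinearMap.injective_of_comp_eq_id _ _ h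
  have : W.map L = W := Submodule.eq_of_le_of_finrank_eq hW
    (LinearEquiv.finrank_eq (Submodule.equivMapOfInjective L hinj W)).symm
  conv_lhs => rw [← this]
  rw [← Submodule.map_comp, h, Submodule.map_id]

open RMatrix FRTAlgebra in
lemma RMatrix.FRTAlgebra.stable_of_stable_X {ι : Type*} [Fintype ι] [DecidableEq ι]
    {r : RMatrix k ι} {M : Type*} [AddCommGroup M]
    [Module k M] [FiniteDimensional k M] (f : FRTAlgebra r →ₐ[k] (Module.End k M)ᵐᵒᵖ)
    {F : Submodule k M} (hF : ∀ i j, ∀ m ∈ F, (f ((univ r).X i j)).unop m ∈ F)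
    (a : FRTAlgebra r) : ∀ m ∈ F, (f a).unop m ∈ F := by
  induction a using FRTAlgebra.induction with
  | hk c =>
    intro m hm
    rw [AlgHom.commutes, MulOpposite.algebraMap_apply, MulOpposite.unop_op]
    exact F.smul_mem c hm
  | hX i j => exact hF i j
  | hadd a b ha hb =>
    intro m hm
    rw [map_add]
    exact add_mem (ha m hm) (hb m hm)
  | hmul a b ha hb =>
    intro m hm
    rw [map_mul]
    exact hb _ (ha m hm)
  | hY i j =>
    -- The operators of X and Y are assembled into operators on M^ι. Values in the opposite algebra
    -- reverse composition, so X Y = 1 says that L' is a left inverse of L; since L preserves F^ι,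
    -- so does L'.
    let L : (ι → M) →ₗ[k] (ι → M) := LinearMap.pi fun j => ∑ i,
      (f ((univ r).X i j)).unop ∘ₗ LinearMap.proj i
    let L' : (ι → M) →ₗ[k] (ι → M) := LinearMap.pi fun j => ∑ i,
      (f ((univ r).Y i j)).unop ∘ₗ LinearMap.proj i
    have h : L' ∘ₗ L = LinearMap.id := by
      refine LinearMap.ext fun x => funext fun l => ?_
      have key (i : ι) (m : M) : ∑ j, (f ((univ r).Y j l)).unop ((f ((univ r).X i j)).unop m) =
          if i = l then m else 0 := by
        have := congr((f $(congr($((univ r).mul_inv) i l))).unop m)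
        rw [Matrix.mul_apply, map_sum, Matrix.one_apply] at this
        simp only [map_mul] at this
        rw [Finset.unop_sum, LinearMap.sum_apply] at this
        refine Eq.trans ?_ (this.trans ?_)
        · rfl
        · split_ifs <;> simp
      simp only [L, L', LinearMap.comp_apply, LinearMap.pi_apply, LinearMap.sum_apply,
        LinearMap.proj_apply, map_sum, LinearMap.id_apply]
      rw [Finset.sum_comm]
      simp [key]
    have hL := map_le_of_leftInverse (W := Submodule.pi Set.univ fun _ => F) h (by
      rintro _ ⟨x, hx, rfl⟩ j -
      simp only [L, LinearMap.pi_apply, LinearMap.sum_apply, LinearMap.comp_apply,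
        LinearMap.proj_apply]
      exact Submodule.sum_mem _ fun i _ => hF i j _ (hx i trivial))
    intro m hm
    have := hL ⟨Pi.single i m, fun l _ => ?_, rfl⟩ j trivial
    · simp only [L', LinearMap.pi_apply, LinearMap.sum_apply, LinearMap.comp_apply,
        LinearMap.proj_apply] at this
      rwa [Finset.sum_eq_single i (fun l _ hl => by simp [hl]) (by simp), Pi.single_eq_same]
        at this
    · by_cases hl : l = i
      · subst hl; simpa
      · simp [hl]

end Stable

/-! ### Bases adapted to a flag -/

section FlagBasis

variable {k : Type*} [Field k] {M : Type*} [AddCommGroup M] [Module k M]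
  [FiniteDimensional k M]

lemma IsCompleteFlag.exists_basis {r : ℕ} {F : Fin (r + 1) → Submodule k M}
    (hF : IsCompleteFlag F) : ∃ b : Basis (Fin r) k M,
      ∀ i : Fin (r + 1), F i = Submodule.span k (b '' {j | j.castSucc < i}) := by
  have hlt (j : Fin r) : F j.castSucc < F j.succ := by
    refine lt_of_le_of_ne (hF.mono (Fin.castSucc_le_succ j)) fun h => ?_
    have h1 := hF.finrank_eq j.castSucc
    have h2 := hF.finrank_eq j.succ
    rw [h, h2] at h1
    simp at h1
  -- The vector b j lies in F (j + 1) but not in F j, so F i is spanned by the b j with j < i.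
  choose b hb hb' using fun j => SetLike.exists_of_lt (hlt j)
  have hstep (j : Fin r) : F j.succ = F j.castSucc ⊔ Submodule.span k {b j} := by
    symm
    refine Submodule.eq_of_le_of_finrank_le (sup_le (hlt j).le
      ((Submodule.span_singleton_le_iff_mem _ _).2 (hb j))) ?_
    rw [hF.finrank_eq, Fin.val_succ, ← Fin.val_castSucc j, ← hF.finrank_eq j.castSucc]
    refine Submodule.finrank_lt_finrank_of_lt (lt_of_le_of_ne le_sup_left fun h => hb' j ?_)
    rw [h]
    exact Submodule.mem_sup_right (Submodule.mem_span_singleton_self _)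
  have hspan (i : Fin (r + 1)) : F i = Submodule.span k (b '' {j | j.castSucc < i}) := by
    induction i using Fin.induction with
    | zero => simp [hF.zero]
    | succ i ih =>
      rw [hstep, ih, ← Submodule.span_union]
      congr 1
      have : {j : Fin r | j.castSucc < i.succ} = {j | j.castSucc < i.castSucc} ∪ {i} := by
        ext j
        simp [Fin.castSucc_lt_succ_iff, le_iff_lt_or_eq, or_comm]
      rw [this, Set.image_union, Set.image_singleton]
  have htop : ⊤ ≤ Submodule.span k (Set.range b) := by
    rw [← hF.last, hspan]
    exact Submodule.span_mono (Set.image_subset_range _ _)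
  have hcard : Fintype.card (Fin r) = finrank k M := by
    rw [Fintype.card_fin, ← finrank_top, ← hF.last, hF.finrank_eq, Fin.val_last]
  refine ⟨basisOfTopLeSpanOfCardEqFinrank b htop hcard, ?_⟩
  rwa [coe_basisOfTopLeSpanOfCardEqFinrank]

end FlagBasis

open Module

/-! ### The operators given by the left argument of r -/

section Operators

open WithConv

variable {k : Type*} [Field k] {H : Type*} [Ring H] [Bialgebra k H]
  {M : Type*} [AddCommGroup M] [Module k M] (V : LeftComodule k H M)
  {r : H ⊗[k] H →ₗ[k] k} (hr : IsCoquasitriangular r)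

/-- The operator `m ↦ r (x ⊗ m₍₋₁₎) m₍₀₎`. -/
def leftOp (r : H ⊗[k] H →ₗ[k] k) (x : H) : M →ₗ[k] M :=
  leftContract (r ∘ₗ TensorProduct.mk k H H x) ∘ₗ V.coact

lemma leftOp_basis {ι : Type*} [Fintype ι] {e : Basis ι k M} (x : H) (i : ι) :
    leftOp V r x (e i) = ∑ j, r (x ⊗ₜ V.mat e i j) • e j := by
  simp [leftOp, V.coact_basis]

lemma cqtBraiding_tmul_basis {ι : Type*} [Fintype ι] (e : Basis ι k M) (m : M) (i : ι) :
    cqtBraiding r V.coact (m ⊗ₜ e i) = ∑ a, e a ⊗ₜ leftOp V r (V.mat e i a) m := by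
  simp only [cqtBraiding, V.coact_basis, LinearMap.comp_apply, map_tmul, leftOp]
  generalize V.coact m = w
  induction w with
  | zero => simp
  | add x y hx hy => simp only [map_add, add_tmul, tmul_add, Finset.sum_add_distrib, hx, hy]
  | tmul x y => simp [tmul_sum]

variable [FiniteDimensional k M]

/-- The operators `leftOp` form an antirepresentation. -/
def leftOpHom : H →ₐ[k] (Module.End k M)ᵐᵒᵖ :=
  .ofLinearMap
    { toFun x := MulOpposite.op (leftOp V r x)
      map_add' x y := by
        rw [← MulOpposite.op_add]
        refine congrArg _ ((finBasis k M).ext fun i => ?_)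
        simp [leftOp_basis, add_tmul, add_smul, Finset.sum_add_distrib]
      map_smul' a x := by
        rw [RingHom.id_apply, ← MulOpposite.op_smul]
        refine congrArg _ ((finBasis k M).ext fun i => ?_)
        simp [leftOp_basis, ← smul_tmul', smul_smul, Finset.smul_sum] }
    (by
      rw [← MulOpposite.op_one]
      refine congrArg MulOpposite.op ((finBasis k M).ext fun i => ?_)
      simp [leftOp_basis, hr.apply_one_left, V.counit_mat, Matrix.one_apply])
    (fun x y => by
      refine congrArg MulOpposite.op ((finBasis k M).ext fun i => ?_)
      -- In r(xy ⊗ ·) the factor x pairs with the first leg of the coproduct, which is the leg of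
      -- the first coaction; so x acts before y.
      change leftOp V r (x * y) _ = leftOp V r y (leftOp V r x _)
      simp [leftOp_basis, hr.apply_mul_left_repr _ _ (V.reprMat (finBasis k M) i _),
        Finset.sum_smul, Finset.smul_sum, smul_smul]
      rw [Finset.sum_comm])

end Operators

/-! ### Subcomodules of the reduced algebra and the braiding -/

namespace FRTHopfAlgebra

variable {k : Type u} [Field k] {M : Type v} [AddCommGroup M] [Module k M]
  {c : M ⊗[k] M ≃ₗ[k] M ⊗[k] M} (A : FRTHopfAlgebra.{u, v, w} k M c)

/-- The form `r (x ⊗ ·)` on the reduced FRT Hopf algebra. -/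
def reducedForm (x : A.carrier) : A.Reduced →ₗ[k] k := radicalForm A.cqt x

lemma reducedForm_mk (x h : A.carrier) :
    A.reducedForm x (Ideal.Quotient.mk _ h) = A.r (x ⊗ₜ h) := rfl

lemma leftContract_reducedCoact (x : A.carrier) (m : M) :
    leftContract (A.reducedForm x) (A.reducedCoact m) = leftOp A.comodule A.r x m := by
  simp only [reducedCoact, leftOp, LinearMap.comp_apply]
  generalize A.comodule.coact m = w
  induction w with
  | zero => simp
  | add x y hx hy => simp only [map_add, hx, hy]
  | tmul x y => simp [reducedForm_mk]

lemma apply_rightContract (x : A.carrier) (φ : Dual k M) (m : M) :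
    A.r (x ⊗ₜ rightContract φ (A.comodule.coact m)) = φ (leftOp A.comodule A.r x m) := by
  simp only [leftOp, LinearMap.comp_apply]
  generalize A.comodule.coact m = w
  induction w with
  | zero => simp
  | add x y hx hy => simp only [map_add, tmul_add, hx, hy]
  | tmul x y => simp [mul_comm]

lemma rightContract_reducedCoact (φ : Dual k M) (m : M) :
    rightContract φ (A.reducedCoact m) =
      Ideal.Quotient.mk _ (rightContract φ (A.comodule.coact m)) := by
  simp only [reducedCoact, LinearMap.comp_apply]
  generalize A.comodule.coact m = w
  induction w with
  | zero => simp
  | add x y hx hy => simp only [map_add, hx, hy]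
  | tmul x y => exact (rightContract_tmul _ _ _).trans (by
      rw [rightContract_tmul]
      exact (map_smul (Ideal.Quotient.mkₐ k (rightRadical A.cqt)) _ _).symm)

/-- If φ vanishes on F, the coefficient of m ∈ F along φ pairs with each x to φ of the operator of x
applied to m, which is zero. So the coefficient lies in the radical and dies in the quotient. -/
lemma isSubcomodule_reducedCoact_iff {F : Submodule k M} :
    IsSubcomodule A.reducedCoact F ↔ ∀ x, ∀ m ∈ F, leftOp A.comodule A.r x m ∈ F := by
  refine ⟨fun h x m hm => ?_, fun h m hm => ?_⟩
  · rw [← leftContract_reducedCoact]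
    exact isSubcomodule_iff.1 h _ m hm
  · refine mem_leftTensor_iff_rightContract.2 fun φ hφ => ?_
    rw [rightContract_reducedCoact, Ideal.Quotient.eq_zero_iff_mem]
    intro x
    rw [apply_rightContract]
    exact hφ _ (h x m hm)

/-- The second leg of c(m ⊗ e i) consists of the operators of the matrix coefficients in row i
applied to m; their first legs are basis vectors and can be separated. -/
lemma braiding_mem_iff {ι : Type*} [Fintype ι] (e : Basis ι k M) {F : Submodule k M} :
    (∀ x ∈ F, ∀ m : M, c (x ⊗ₜ m) ∈ LinearMap.range (F.subtype.lTensor M)) ↔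
      ∀ i j, ∀ m ∈ F, leftOp A.comodule A.r (A.comodule.mat e i j) m ∈ F := by
  classical
  have hc (m : M) (i : ι) : c (m ⊗ₜ e i) =
      ∑ a, e a ⊗ₜ leftOp A.comodule A.r (A.comodule.mat e i a) m := by
    rw [← cqtBraiding_tmul_basis, A.braiding_eq]
    rfl
  refine ⟨fun h i j m hm => ?_, fun h x hx m => ?_⟩
  · have := mem_leftTensor_iff.1 (h m hm (e i)) (e.coord j)
    rw [hc] at this
    simpa [Finsupp.single_apply] using this
  · rw [← e.sum_repr m, tmul_sum, map_sum]
    refine Submodule.sum_mem _ fun i _ => ?_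
    rw [tmul_smul, map_smul, hc]
    exact Submodule.smul_mem _ _ (Submodule.sum_mem _ fun a _ =>
      tmul_mem_leftTensor _ (h i a x hx))

/-- The projection to the reduced FRT Hopf algebra as a morphism of bialgebras. -/
def toReduced : A.carrier →ₐc[k] A.Reduced := Bialgebra.Quotient.mkBialgHom (rightRadical A.cqt)

/-- The comodule over the reduced FRT Hopf algebra. -/
def reducedComodule : LeftComodule k A.Reduced M := A.comodule.pushforward A.toReduced

end FRTHopfAlgebra

open Module

/-! ### Comparison with the explicit algebra and pointedness -/

namespace FRTHopfAlgebra

open RMatrix FRTAlgebra WithConv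

variable {k : Type u} [Field k] {M : Type v} [AddCommGroup M] [Module k M]
  [FiniteDimensional k M] {c : M ⊗[k] M ≃ₗ[k] M ⊗[k] M} (hc : IsRigidBraiding c)
  (A : FRTHopfAlgebra.{u, v, w} k M c)

/-- The Yetter-Drinfeld module structure over the FRT Hopf algebra. -/
def yetterDrinfeld : YetterDrinfeld k A.carrier M := cqtYetterDrinfeld A.comodule A.cqt

lemma yetterDrinfeld_braiding : A.yetterDrinfeld.braiding = c :=
  (cqtYetterDrinfeld_braiding _ _).trans A.braiding_eq

lemma yetterDrinfeld_act (h : A.carrier) (m : M) :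
    A.yetterDrinfeld.act h m = cqtAction A.r A.comodule.coact (h ⊗ₜ m) := rfl

section Finite

variable {ι : Type (max v w)} [Fintype ι] [DecidableEq ι] (e : Basis ι k M)

/-- The morphism from the explicit FRT Hopf algebra. -/
def ofFRT : FRTAlgebra (ofBraiding c e hc) →ₐc[k] A.carrier :=
  toHopf e hc A.yetterDrinfeld_braiding

lemma ofFRT_X (i j : ι) : A.ofFRT hc e ((univ _).X i j) = A.comodule.mat e i j :=
  toHopf_X e hc A.yetterDrinfeld_braiding i j

/-- The universal property of A gives a morphism back to the explicit algebra. The composite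
endomorphism of A is compatible with coaction and action, so by uniqueness it is the identity. -/
lemma ofFRT_surjective : Function.Surjective (A.ofFRT hc e) := by
  let A₀ := frtHopfAlgebra.{u, v, w} hc e
  obtain ⟨φ, ⟨hφ₁, hφ₂⟩, -⟩ := A.universal A₀.carrier A₀.yetterDrinfeld A₀.yetterDrinfeld_braiding
  obtain ⟨ψ, -, huniq⟩ := A.universal A.carrier A.yetterDrinfeld A.yetterDrinfeld_braiding
  let f : A₀.carrier →ₐc[k] A.carrier := A.ofFRT hc e
  have h1 : (f : A₀.carrier →ₗ[k] A.carrier).rTensor M ∘ₗ A₀.comodule.coact =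
      A.comodule.coact :=
    (rTensor_comodule e hc (V := A.yetterDrinfeld) _).2 (A.ofFRT_X hc e)
  have hφ₁ : (φ : A.carrier →ₗ[k] A₀.carrier).rTensor M ∘ₗ A.comodule.coact =
    A₀.comodule.coact := hφ₁
  have h2 : f.comp φ = BialgHom.id k A.carrier := by
    rw [huniq (f.comp φ) ⟨?_, fun h m => ?_⟩,
      huniq (BialgHom.id k _) ⟨?_, fun h m => rfl⟩]
    · exact congr($(LinearMap.rTensor_id M A.carrier) ∘ₗ _).trans (LinearMap.id_comp _)
    · rw [show ((f.comp φ : A.carrier →ₐc[k] A.carrier) : A.carrier →ₗ[k] A.carrier) =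
        (f : A₀.carrier →ₗ[k] A.carrier) ∘ₗ (φ : A.carrier →ₗ[k] A₀.carrier) from rfl,
        LinearMap.rTensor_comp, LinearMap.comp_assoc, hφ₁, h1]
      rfl
    · rw [hφ₂]
      exact cqtAction_comodule e hc A.yetterDrinfeld_braiding (φ h) m
  exact fun x => ⟨φ x, congr($h2 x)⟩

/-- The values r(X i j ⊗ h) are the matrix entries of the action of h on M, and the morphism
respects the actions. -/
lemma apply_ofFRT_X (i j : ι) (h : FRTAlgebra (ofBraiding c e hc)) :
    A.r (A.ofFRT hc e ((univ _).X i j) ⊗ₜ A.ofFRT hc e h) =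
      form (ofBraiding c e hc) ((univ _).X i j ⊗ₜ h) := by
  have h1 := cqtAction_comodule e hc A.yetterDrinfeld_braiding h (e i)
  have h2 := A.yetterDrinfeld_act (A.ofFRT hc e h) (e i)
  rw [ofFRT, ← h1, cqtAction_basis, cqtAction_basis] at h2
  have h3 := congr(e.repr $h2 j)
  rw [ofFRT_X, ofFRT]
  simpa [Finsupp.single_apply] using h3.symm

/-- Both forms are algebra maps in x with values in the convolution dual, so agreement on the
entries of X suffices. -/
lemma apply_ofFRT (x h : FRTAlgebra (ofBraiding c e hc)) :
    A.r (A.ofFRT hc e x ⊗ₜ A.ofFRT hc e h) = form (ofBraiding c e hc) (x ⊗ₜ h) := by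
  let ψ : FRTAlgebra (ofBraiding c e hc) →ₗ[k] A.carrier := (A.ofFRT hc e : _ →ₗ[k] A.carrier)
  let f : FRTAlgebra (ofBraiding c e hc) →ₐ[k]
      WithConv (FRTAlgebra (ofBraiding c e hc) →ₗ[k] k) :=
    .ofLinearMap
      { toFun x := toConv (A.r ∘ₗ TensorProduct.mk k _ _ (ψ x) ∘ₗ ψ)
        map_add' x y := by ext; simp
        map_smul' a x := by ext; simp }
      (by
        ext h
        change A.r (A.ofFRT hc e 1 ⊗ₜ A.ofFRT hc e h) = _
        rw [map_one, A.cqt.apply_one_left]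
        simp)
      (fun x y => by
        ext h
        rw [(ℛ k h).convMul_apply]
        change A.r (A.ofFRT hc e (x * y) ⊗ₜ A.ofFRT hc e h) = _
        rw [map_mul, A.cqt.apply_mul_left_repr _ _ ((ℛ k h).induced (A.ofFRT hc e))]
        rfl)
  have hf : f = (formPoint _).lift := hom_ext fun i j => by
    ext h
    exact A.apply_ofFRT_X hc e i j h
  exact congr(($hf x).ofConv h)

lemma ofFRT_mem_rightRadical_iff {h : FRTAlgebra (ofBraiding c e hc)} :
    A.ofFRT hc e h ∈ rightRadical A.cqt ↔ h ∈ rightRadical (isCoquasitriangular_form _) := by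
  refine ⟨fun hh x => ?_, fun hh x => ?_⟩
  · rw [← A.apply_ofFRT hc e]
    exact hh _
  · obtain ⟨x, rfl⟩ := A.ofFRT_surjective hc e x
    rw [A.apply_ofFRT hc e]
    exact hh _

/-- The braiding gives stability for the generators X; `stable_of_stable_X` extends it to the
explicit algebra, which maps onto A. -/
lemma isSubcomodule_of_braiding_mem (hc : IsRigidBraiding c) (e : Basis ι k M) {F : Submodule k M}
    (hF : ∀ x ∈ F, ∀ m : M, c (x ⊗ₜ m) ∈ LinearMap.range (F.subtype.lTensor M)) :
    IsSubcomodule A.reducedCoact F := by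
  rw [A.isSubcomodule_reducedCoact_iff]
  intro x
  obtain ⟨x, rfl⟩ := A.ofFRT_surjective hc e x
  refine stable_of_stable_X ((leftOpHom A.comodule A.cqt).comp
    (A.ofFRT hc e : FRTAlgebra (ofBraiding c e hc) →ₐ[k] A.carrier)) (fun i j m hm => ?_) x
  have := (A.braiding_mem_iff e).1 hF i j m hm
  rw [← A.ofFRT_X hc e] at this
  exact this

/-- The morphism from the explicit FRT Hopf algebra to the reduced FRT Hopf algebra. -/
def ofFRTReduced : FRTAlgebra (ofBraiding c e hc) →ₐc[k] A.Reduced :=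
  A.toReduced.comp (A.ofFRT hc e)

lemma ofFRTReduced_eq_zero_iff {h : FRTAlgebra (ofBraiding c e hc)} :
    A.ofFRTReduced hc e h = 0 ↔ h ∈ rightRadical (isCoquasitriangular_form _) := by
  rw [← A.ofFRT_mem_rightRadical_iff hc e, ← Ideal.Quotient.eq_zero_iff_mem]
  rfl

/-- In the quotient X is triangular, and so is Y = S(X) because S preserves the radical. Both have
entries in triangular left coideals, and sums and products of such coideals reach every element. -/
lemma isPointed_reduced_of_triangular [LinearOrder ι] (hc : IsRigidBraiding c)
    (e : Basis ι k M)
    (h : ∀ i j, i < j → rightCoord e j (A.reducedCoact (e i)) = 0) : IsPointed k A.Reduced := by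
  let q := A.ofFRTReduced hc e
  have hcomul (a) : comul (R := k) (q a) = TensorProduct.map (q : _ →ₗ[k] A.Reduced)
    (q : _ →ₗ[k] A.Reduced) (comul a) := congr($(q.toCoalgHom.map_comp_comul) a).symm
  have hcounit (a) : counit (R := k) (q a) = counit (R := k) a :=
    congr($(q.toCoalgHom.counit_comp) a)
  have hX (i j : ι) (hij : i < j) : q ((univ _).X i j) = 0 := by
    rw [← h i j hij]
    refine Eq.trans ?_ (A.rightContract_reducedCoact (e.coord j) (e i)).symm
    exact congr(Ideal.Quotient.mk _ $(A.ofFRT_X hc e i j))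
  have hY (i j : ι) (hij : i < j) : q ((univ _).Y i j) = 0 := by
    rw [A.ofFRTReduced_eq_zero_iff, ← antipode_X]
    exact antipode_mem_rightRadical ((A.ofFRTReduced_eq_zero_iff hc e).1 (hX i j hij))
  obtain ⟨W₁, hW₁, hXW⟩ := exists_isTriangular_of_matrix (k := k)
    (T := (.of fun i j => q ((univ _).X i j) : Matrix ι ι A.Reduced))
    (fun i j => by simp [hcomul]) (fun i j => by simp [hcounit, Matrix.one_apply]) hX
  -- The coproduct of Y is that of a transposed comatrix, so Y is transposed; the dual order makes
  -- it triangular in the required sense again.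
  obtain ⟨W₂, hW₂, hYW⟩ := exists_isTriangular_of_matrix (k := k)
    (T := (.of fun i j => q ((univ _).Y (OrderDual.ofDual j) (OrderDual.ofDual i)) :
      Matrix ιᵒᵈ ιᵒᵈ A.Reduced))
    (fun i j => by simp [hcomul]; rfl) (fun i j => by simp [hcounit, Matrix.one_apply, eq_comm])
    (fun i j hij => hY _ _ hij)
  refine isPointed_of_isTriangular fun x => ?_
  obtain ⟨x, rfl⟩ := Ideal.Quotient.mk_surjective x
  obtain ⟨x, rfl⟩ := A.ofFRT_surjective hc e x
  change ∃ W : Submodule k A.Reduced, IsTriangular W ∧ q x ∈ W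
  induction x using FRTAlgebra.induction with
  | hX i j => exact ⟨W₁, hW₁, hXW i j⟩
  | hY i j => exact ⟨W₂, hW₂, hYW (OrderDual.toDual j) (OrderDual.toDual i)⟩
  | hk a =>
    refine ⟨_, IsTriangular.bot.step (g := 1) (v := 1) .one ?_, ?_⟩
    · rw [Bialgebra.comul_one, Algebra.TensorProduct.one_def, sub_self]
      exact zero_mem _
    · rw [AlgHomClass.commutes, Algebra.algebraMap_eq_smul_one]
      exact Submodule.mem_sup_right (Submodule.smul_mem _ _ (Submodule.mem_span_singleton_self _))
  | hadd a b ha hb =>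
    obtain ⟨W, hW, ha⟩ := ha
    obtain ⟨W', hW', hb⟩ := hb
    refine ⟨_, hW.sup hW', ?_⟩
    rw [map_add]
    exact add_mem (Submodule.mem_sup_left ha) (Submodule.mem_sup_right hb)
  | hmul a b ha hb =>
    obtain ⟨W, hW, ha⟩ := ha
    obtain ⟨W', hW', hb⟩ := hb
    refine ⟨_, hW.mul hW', ?_⟩
    rw [map_mul]
    exact Submodule.mul_mem_mul ha hb

end Finite

lemma isPointed_reduced_of_flag (hc : IsRigidBraiding c) {n : ℕ} {F : Fin (n + 1) → Submodule k M}
    (hF : IsCompleteFlag F)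
    (h : ∀ i, IsSubcomodule A.reducedCoact (F i)) : IsPointed k A.Reduced := by
  obtain ⟨b, hb⟩ := hF.exists_basis
  let : LinearOrder (ULift.{max v w} (Fin n)) := LinearOrder.lift' ULift.down ULift.down_injective
  let e : Basis (ULift.{max v w} (Fin n)) k M := b.reindex Equiv.ulift.symm
  refine A.isPointed_reduced_of_triangular hc e fun i j hij => ?_
  have hij : i.down < j.down := hij
  have hi : e i ∈ F i.down.succ := by
    rw [hb]
    exact Submodule.subset_span ⟨i.down, Fin.castSucc_lt_succ, by simp [e]⟩
  refine mem_leftTensor_iff_rightContract.1 (h _ _ hi) (e.coord j) fun m hm => ?_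
  rw [hb] at hm
  induction hm using Submodule.span_induction with
  | zero => rw [map_zero]
  | add x y _ _ hx hy => rw [map_add, hx, hy, add_zero]
  | smul a x _ hx => rw [map_smul, hx, smul_zero]
  | mem x hx =>
    obtain ⟨l, hl, rfl⟩ := hx
    have hl : l ≤ i.down := Fin.castSucc_lt_succ_iff.1 hl
    have hlj : l ≠ j.down := (hl.trans_lt hij).ne
    have hel : b l = e (ULift.up l) := by simp [e]
    rw [hel, Basis.coord_apply, Basis.repr_self, Finsupp.single_eq_of_ne]
    exact fun h => hlj congr(ULift.down $h.symm)

/-- The Yetter-Drinfeld module structure over the reduced FRT Hopf algebra. -/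
def reducedYetterDrinfeld : YetterDrinfeld k A.Reduced M :=
  A.yetterDrinfeld.pushforward A.toReduced Ideal.Quotient.mk_surjective
    -- An element h acts through the values r(m₍₋₁₎ ⊗ h), which vanish on the right radical.
    (Ideal.Quotient.liftₐ _ A.yetterDrinfeld.act fun h hh => LinearMap.ext fun m => by
      classical
      have e := finBasis k M
      rw [yetterDrinfeld_act, ← e.sum_repr m, tmul_sum, map_sum]
      refine Finset.sum_eq_zero fun i _ => ?_
      rw [tmul_smul, map_smul, cqtAction_basis, Finset.sum_eq_zero, smul_zero]
      intro j _
      rw [hh, zero_smul]) fun h => rfl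

lemma reducedYetterDrinfeld_braiding : A.reducedYetterDrinfeld.braiding = c :=
  (A.yetterDrinfeld.pushforward_braiding _ _ _ _).trans A.yetterDrinfeld_braiding

end FRTHopfAlgebra

lemma YetterDrinfeld.braiding_mem {k : Type*} [Field k] {M : Type*} [AddCommGroup M] [Module k M]
    {H : Type*} [Ring H] [Bialgebra k H] (V : YetterDrinfeld k H M) {F : Submodule k M}
    (hF : IsSubcomodule V.coact F) {x : M} (hx : x ∈ F) (m : M) :
    V.braiding (x ⊗ₜ m) ∈ leftTensor M F := by
  simp only [YetterDrinfeld.braiding, LinearMap.comp_apply, LinearMap.rTensor_tmul]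
  refine leftTensor_induction (p := fun z => (TensorProduct.lift V.act.toLinearMap).rTensor M
    (TensorProduct.rightComm k H M M (z ⊗ₜ m)) ∈ leftTensor M F) (hF x hx) (fun h n hn => ?_)
    (by simp) fun x y hx hy => by simp only [add_tmul, map_add]; exact add_mem hx hy
  exact tmul_mem_leftTensor _ hn

end FRT

end

/-! ### Existence and the equivalences -/

theorem mainTheorem2 (k : Type u) [Field k] (M : Type v) [AddCommGroup M] [Module k M]
    [FiniteDimensional k M] (c : M ⊗[k] M ≃ₗ[k] M ⊗[k] M) (hc : FRT.IsRigidBraiding c) :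
    Nonempty (FRT.FRTHopfAlgebra.{u, v, w} k M c) ∧
    ∀ A : FRT.FRTHopfAlgebra.{u, v, w} k M c,
      List.TFAE [
        FRT.IsPointed k A.Reduced,
        (∃ (H : Type (max u v w)) (_ : Ring H) (_ : HopfAlgebra k H),
          FRT.IsPointed k H ∧ ∃ V : FRT.YetterDrinfeld k H M, V.braiding = c),
        (∃ (r : ℕ) (F : Fin (r + 1) → Submodule k M), FRT.IsCompleteFlag F ∧
          ∀ i, FRT.IsSubcomodule A.reducedCoact (F i)),
        (∃ (r : ℕ) (F : Fin (r + 1) → Submodule k M), FRT.IsCompleteFlag F ∧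
          ∀ i, ∀ x ∈ F i, ∀ m : M,
            c (x ⊗ₜ[k] m) ∈ LinearMap.range ((F i).subtype.lTensor M))] := by
  classical
  -- The index type is lifted so that the explicit algebra lives in the universe of the universal
  -- property.
  let e : Module.Basis (ULift.{max v w} (Fin (Module.finrank k M))) k M :=
    (Module.finBasis k M).reindex Equiv.ulift.symm
  let A₀ : FRT.FRTHopfAlgebra.{u, v, w} k M c := FRT.frtHopfAlgebra hc e
  refine ⟨⟨A₀⟩, fun A => ?_⟩
  tfae_have 1 → 3 := fun h => A.reducedComodule.exists_flag h
  tfae_have 3 → 4 := fun ⟨r, F, hF, h⟩ => ⟨r, F, hF, fun i => (A.braiding_mem_iff e).2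
    fun a b => A.isSubcomodule_reducedCoact_iff.1 (h i) _⟩
  tfae_have 4 → 3 := fun ⟨r, F, hF, h⟩ => ⟨r, F, hF, fun i =>
    A.isSubcomodule_of_braiding_mem hc e (h i)⟩
  tfae_have 3 → 1 := fun ⟨r, F, hF, h⟩ => A.isPointed_reduced_of_flag hc hF h
  -- The witness is the reduction of the explicit algebra, for which the radical is known to be a
  -- Hopf ideal.
  tfae_have 4 → 2 := fun ⟨r, F, hF, h⟩ => ⟨A₀.Reduced, inferInstance,
    (inferInstance : HopfAlgebra k (FRT.RMatrix.FRTAlgebra (FRT.RMatrix.ofBraiding c e hc) ⧸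
      FRT.rightRadical (FRT.RMatrix.FRTAlgebra.isCoquasitriangular_form _))),
    A₀.isPointed_reduced_of_flag hc hF fun i => A₀.isSubcomodule_of_braiding_mem hc e (h i),
    A₀.reducedYetterDrinfeld, A₀.reducedYetterDrinfeld_braiding⟩
  tfae_have 2 → 4 := fun ⟨H, _, _, hH, V, hV⟩ => by
    obtain ⟨r, F, hF, h⟩ := V.toLeftComodule.exists_flag hH
    refine ⟨r, F, hF, fun i x hx m => ?_⟩
    have := V.braiding_mem (h i) hx m
    rw [hV] at this
    exact this
  tfae_finish
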